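/- Let $X,Y_1,\dots,Y_L$ be zero-mean jointly Gaussian real random variables with non-singular covariance matrix, and let $\mathcal L=\{1,\dots,L\}$. For $\mathcal S\subseteq\mathcal L$ write $\mathbf Y_{\mathcal S}=(Y_\ell)_{\ell\in\mathcal S}$. Let $\mathbb A$ be a family of subsets of $\mathcal L$ such that every subset of $\mathcal L$ containing a member of $\mathbb A$ is in $\mathbb A$, let $\mathbb B=2^{\mathcal L}\setminus\mathbb A$, and let $D>0$. All information quantities are in bits. Let $(X_i,Y_{1,i},\dots,Y_{L,i})_{i\ge1}$ be independent copies of $(X,Y_1,\dots,Y_L)$. A $(2^{nR},n)$ source code consists of a measurable encoder $f:\mathbb R^n\to\{1,\dots,\lceil 2^{nR}\rceil\}$, with message $M=f(X^n)$, and, for every $\mathcal A\in\mathbb A$, a measurable decoder that forms an estimate $\hat X^n(\mathcal A)\in\mathbb R^n$ of $X^n$ from $(M,\mathbf Y_{\mathcal A}^n)$. A pair $(R,\Delta)$ with $R,\Delta\ge0$ is achievable if there is a sequence of $(2^{nR},n)$ source codes, $n=1,2,\dots$, with $$\limsup_{n\to\infty}\frac1n\sum_{i=1}^n\mathbb E\big[(X_i-\hat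 X_i(\mathcal A))^2\big]\le D\quad\text{for all }\mathcal A\in\mathbb A,\qquad \limsup_{n\to\infty}\frac1n I(X^n;M,\mathbf Y_{\mathcal B}^n)\le\Delta\quad\text{for all }\mathcal B\in\mathbb B.$$ The rate-leakage region $\mathcal R(D,\mathbb A)$ is the set of all achievable pairs. Then $$\mathcal R(D,\mathbb A)\subseteq\bigcap_{\mathcal A\in\mathbb A,\ \mathcal B\in\mathbb B}\mathcal R_G(\mathbf Y_{\mathcal A},\mathbf Y_{\mathcal B}),$$ where $\mathcal R_G(\mathbf Y_{\mathcal A},\mathbf Y_{\mathcal B})$ is the union, over all random variables $U,V$ (with values in standard Borel spaces) such that $U-V-X-(\mathbf Y_{\mathcal A},\mathbf Y_{\mathcal B})$ is a Markov chain and $\mathbb E\big[\sigma^2_{X|\mathbf Y_{\mathcal A},V}\big]\le D$, of the sets of pairs $(R,\Delta)$ with $$R\ge I(V;X|\mathbf Y_{\mathcal A}),\qquad \Delta\ge I(V;X)-I(V;\mathbf Y_{\mathcal A}|U)+I(X;\mathbf Y_{\mathcal B}|U).$$ Here $\sigma^2_{X|\mathbf Y_{\mathcal A},V}$ is the conditional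 variance of $X$ given $(\mathbf Y_{\mathcal A},V)$. -/

import Mathlib

open MeasureTheory ProbabilityTheory Filter
open scoped ENNReal

noncomputable section

namespace SecureSourceCoding

/-! ### Mutual information, in bits, for arbitrary random variables -/

/-- The mutual information `I(X;Y)` in bits: the relative entropy of the joint law of `(X,Y)`
with respect to the product of the marginal laws (`klDiv` is measured in nats). -/
def mutualInfo {Ω α β : Type*} [MeasurableSpace Ω] [MeasurableSpace α] [MeasurableSpace β]
    (X : Ω → α) (Y : Ω → β) (μ : Measure Ω) : ℝ≥0∞ :=
  InformationTheory.klDiv (μ.map fun ω => (X ω, Y ω)) ((μ.map X).prod (μ.map Y))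
    / ENNReal.ofReal (Real.log 2)

/-- The conditional mutual information `I(X;Y|Z)` in bits: the relative entropy of the law
`P_{ZXY}` with respect to `P_Z ⊗ (P_{X|Z} × P_{Y|Z})`. -/
def condMutualInfo {Ω α β γ : Type*} [MeasurableSpace Ω]
    [MeasurableSpace α] [StandardBorelSpace α] [Nonempty α]
    [MeasurableSpace β] [StandardBorelSpace β] [Nonempty β] [MeasurableSpace γ]
    (X : Ω → α) (Y : Ω → β) (Z : Ω → γ) (μ : Measure Ω) [IsFiniteMeasure μ] : ℝ≥0∞ :=
  InformationTheory.klDiv (μ.map fun ω => (Z ω, X ω, Y ω))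
      ((μ.map Z).compProd ((condDistrib X Z μ).prod (condDistrib Y Z μ)))
    / ENNReal.ofReal (Real.log 2)

/-! ### The source -/

/-- The covariance matrix of the vector `(X, Y_1, …, Y_L)` under its joint law `P`
(the index `none` is that of `X`). -/
def covMatrix {L : ℕ} (P : Measure (ℝ × (Fin L → ℝ))) :
    Matrix (Option (Fin L)) (Option (Fin L)) ℝ :=
  let coord : Option (Fin L) → ℝ × (Fin L → ℝ) → ℝ := fun i p => i.elim p.1 p.2
  Matrix.of fun i j => covariance (coord i) (coord j) P

/-- `P` is the joint law of zero-mean jointly Gaussian real random variables `X, Y_1, …, Y_L`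
with non-singular covariance matrix. -/
structure IsGaussianSource {L : ℕ} (P : Measure (ℝ × (Fin L → ℝ))) : Prop where
  gaussian : IsGaussian P
  mean_source : ∫ p, p.1 ∂P = 0
  mean_side : ∀ l, ∫ p, p.2 l ∂P = 0
  nonsingular : (covMatrix P).det ≠ 0

/-! ### Codes and the rate-leakage region -/

/-- The alphabet of `n` symbols emitted by the source. -/
abbrev Block (L n : ℕ) : Type := Fin n → ℝ × (Fin L → ℝ)

/-- The source sequence `X^n`. -/
def srcSeq {L n : ℕ} (ω : Block L n) : Fin n → ℝ := fun i => (ω i).1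

/-- The side information `Y_S^n` of the set of users `S`. -/
def sideSeq {L n : ℕ} (S : Finset (Fin L)) (ω : Block L n) : Fin n → (S → ℝ) :=
  fun i => S.restrict (ω i).2

/-- A source code of block length `n` and rate `R`, for the authorized sets `𝔸`: an encoder with
`⌈2 ^ (n R)⌉` messages, and one decoder for every authorized set of users. -/
structure SourceCode {L : ℕ} (𝔸 : Set (Finset (Fin L))) (R : ℝ) (n : ℕ) where
  enc : (Fin n → ℝ) → Fin ⌈(2 : ℝ) ^ ((n : ℝ) * R)⌉₊
  measurable_enc : Measurable enc
  dec : (A : 𝔸) → Fin ⌈(2 : ℝ) ^ ((n : ℝ) * R)⌉₊ × (Fin n → (A.1 → ℝ)) → (Fin n → ℝ)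
  measurable_dec : ∀ A, Measurable (dec A)

/-- The expected mean square distortion `E[(1/n) ∑ i, (X_i - X̂_i(A))²]` of a code at the
authorized set `A`, for `n` independent draws from `P`. -/
def SourceCode.distortion {L : ℕ} {𝔸 : Set (Finset (Fin L))} {R : ℝ} {n : ℕ}
    (c : SourceCode 𝔸 R n) (P : Measure (ℝ × (Fin L → ℝ))) (A : 𝔸) : ℝ≥0∞ :=
  ∫⁻ ω : Block L n,
    ENNReal.ofReal ((1 / (n : ℝ)) *
      ∑ i, (srcSeq ω i - c.dec A (c.enc (srcSeq ω), sideSeq A.1 ω) i) ^ 2)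
    ∂(Measure.pi fun _ => P)

/-- The leakage rate `(1/n) I(X^n; M, Y_B^n)`, in bits, to the set of users `B`. -/
def SourceCode.leakage {L : ℕ} {𝔸 : Set (Finset (Fin L))} {R : ℝ} {n : ℕ}
    (c : SourceCode 𝔸 R n) (P : Measure (ℝ × (Fin L → ℝ))) (B : Finset (Fin L)) : ℝ≥0∞ :=
  mutualInfo (fun ω : Block L n => srcSeq ω) (fun ω => (c.enc (srcSeq ω), sideSeq B ω))
    (Measure.pi fun _ => P) / (n : ℝ≥0∞)

/-- The rate-leakage region `ℛ(D, 𝔸)`: all achievable pairs `(R, Δ)`. The unauthorized sets are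
all the sets of users outside `𝔸`. -/
def rateLeakageRegion {L : ℕ} (P : Measure (ℝ × (Fin L → ℝ))) (D : ℝ)
    (𝔸 : Set (Finset (Fin L))) : Set (ℝ × ℝ) :=
  {p | 0 ≤ p.1 ∧ 0 ≤ p.2 ∧ ∃ c : (n : ℕ) → SourceCode 𝔸 p.1 n,
    (∀ A : 𝔸, limsup (fun n => (c n).distortion P A) atTop ≤ ENNReal.ofReal D) ∧
    (∀ B ∈ 𝔸ᶜ, limsup (fun n => (c n).leakage P B) atTop ≤ ENNReal.ofReal p.2)}

/-! ### The single-letter region -/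

/-- The Markov chain `U − V − X − Y`: given `V`, `U` is independent of `(X, Y)`, and
given `X`, `(U, V)` is independent of `Y`. -/
def IsMarkovChain {Ω α β γ δ : Type*} [MeasurableSpace Ω] [StandardBorelSpace Ω]
    [MeasurableSpace α] [mβ : MeasurableSpace β] [mγ : MeasurableSpace γ] [MeasurableSpace δ]
    (U : Ω → α) {V : Ω → β} {X : Ω → γ} (Y : Ω → δ) (hV : Measurable V) (hX : Measurable X)
    (μ : Measure Ω) [IsFiniteMeasure μ] : Prop :=
  CondIndepFun (mβ.comap V) hV.comap_le U (fun ω => (X ω, Y ω)) μ ∧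
  CondIndepFun (mγ.comap X) hX.comap_le (fun ω => (U ω, V ω)) Y μ

/-- The single-letter region `ℛ_G(Y₁, Y₂)` of a source `(X, Y₁, Y₂)` with joint law `Q`: the union,
over all the random variables `U, V` with values in standard Borel spaces for which
`U − V − X − (Y₁, Y₂)` is a Markov chain and `E[Var(X | Y₁, V)] ≤ D`, of the set of all `(R, Δ)`
with `R ≥ I(V;X|Y₁)` and `Δ ≥ I(V;X) − I(V;Y₁|U) + I(X;Y₂|U)`. -/
def singleLetterRegion {𝒴₁ 𝒴₂ : Type} [MeasurableSpace 𝒴₁] [StandardBorelSpace 𝒴₁] [Nonempty 𝒴₁]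
    [MeasurableSpace 𝒴₂] [StandardBorelSpace 𝒴₂] [Nonempty 𝒴₂]
    (Q : Measure (ℝ × 𝒴₁ × 𝒴₂)) (D : ℝ) : Set (ℝ × ℝ) :=
  {p | ∃ (Ω 𝒰 𝒱 : Type)
      (_ : MeasurableSpace Ω) (_ : StandardBorelSpace Ω)
      (_ : MeasurableSpace 𝒰) (_ : StandardBorelSpace 𝒰) (_ : Nonempty 𝒰)
      (_ : MeasurableSpace 𝒱) (_ : StandardBorelSpace 𝒱) (_ : Nonempty 𝒱)
      (μ : Measure Ω) (_ : IsProbabilityMeasure μ)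
      (U : Ω → 𝒰) (V : Ω → 𝒱) (X : Ω → ℝ) (Y₁ : Ω → 𝒴₁) (Y₂ : Ω → 𝒴₂)
      (_ : Measurable U) (hV : Measurable V) (hX : Measurable X)
      (_ : Measurable Y₁) (_ : Measurable Y₂),
      μ.map (fun ω => (X ω, Y₁ ω, Y₂ ω)) = Q ∧
      IsMarkovChain U (fun ω => (Y₁ ω, Y₂ ω)) hV hX μ ∧
      ∫ ω, (condVar (MeasurableSpace.comap (fun ω => (Y₁ ω, V ω)) inferInstance) X μ) ω ∂μ ≤ D ∧
      (condMutualInfo V X Y₁ μ : EReal) ≤ (p.1 : EReal) ∧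
      (mutualInfo V X μ : EReal) - (condMutualInfo V Y₁ U μ : EReal)
        + (condMutualInfo X Y₂ U μ : EReal) ≤ (p.2 : EReal)}

/-- The joint law of `(X, Y_A, Y_B)` when `(X, Y_1, …, Y_L)` has the law `P`. -/
def pairLaw {L : ℕ} (P : Measure (ℝ × (Fin L → ℝ))) (A B : Finset (Fin L)) :
    Measure (ℝ × (A → ℝ) × (B → ℝ)) :=
  P.map fun p => (p.1, A.restrict p.2, B.restrict p.2)

end SecureSourceCoding

end

open MeasureTheory ProbabilityTheory Filter
open scoped ENNReal

noncomputable section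

namespace SecureSourceCoding

open InformationTheory

/-! ### A variational lower bound on the relative entropy -/

/-! Fix `A` and `B`, put `s = Var X`, and let `σA`, `σB` be the error variances of the linear
estimates `TA`, `TB` of `X` from `Y_A`, `Y_B`. What is left of `Y_A` after removing its component
along `TA` is independent of `(X, TA)`, and likewise for `B`, so vector side information acts like a
scalar estimate. Both inclusion steps are then explicit. Every achievable pair satisfies
inequalities in `s`, `σA`, `σB`, `D`, and Gaussian auxiliaries `U`, `V` reach those same bounds; no
single-letterization by the chain rule is needed.

In nats, an achievable pair has rate at least `½ log (σA / D)` (`rate_ge`). Its leakage is at least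
`½ log (s / σB)` always (`leakage_ge`), at least `½ log (s (1/D + 1/σB - 1/σA))` if `σB ≤ σA`
(`leakage_ge_of_le`), and at least `½ log (s / σB) + ½ log (σA / D)` if `σA ≤ σB`
(`leakage_ge_of_ge`). If `σA ≤ D`, constant `U` and `V` suffice. Otherwise `V` is `X` plus
independent Gaussian noise of variance `v`, where `1/v = 1/D - 1/σA`, with `U = V` when `σB ≤ σA`
and `U` constant when `σA ≤ σB`.

The leakage bounds that involve `D` rest on a change of coupling. The distortion at `A` depends only
on the law of `(X^n, Y_A^n)` and the leakage to `B` only on that of `(X^n, Y_B^n)`. So `Y_A` may be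
replaced by a copy simulated from `X`, `TB` and fresh noise (`simLaw`, `simLaw_map_side`), chosen so
that the two users are physically degraded even if the original ones are not. If `B` is better, it
simulates `A`, decodes, and fuses the reconstruction with its own estimate
(`combined_estimate_le_klDiv`). If `A` is better, the information splits into the part carried by
`TB` and the part that the reconstruction adds to the better estimate
(`degraded_side_information_le_klDiv`).

All information bounds come from one inequality: `klDiv μ ν ≥ ∫ ℓ dμ` whenever `∫ exp ℓ dν ≤ 1`. The
test functions `ℓ` are sums of Gaussian log-likelihood ratios, whose exponentials integrate to one
and whose means are controlled by mean square errors alone. -/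

theorem ofReal_integral_le_klDiv {α : Type*} [MeasurableSpace α] {μ ν : Measure α}
    [IsProbabilityMeasure μ] [IsProbabilityMeasure ν] {ℓ : α → ℝ} (hℓ : Measurable ℓ)
    (hint : Integrable ℓ μ) (hν : ∫⁻ x, ENNReal.ofReal (Real.exp (ℓ x)) ∂ν ≤ 1) :
    ENNReal.ofReal (∫ x, ℓ x ∂μ) ≤ klDiv μ ν := by
  by_cases hac : μ ≪ ν
  swap
  · simp [klDiv_of_not_ac hac]
  by_cases hllr : Integrable (llr μ ν) μ
  swap
  · simp [klDiv_of_not_integrable hllr]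
  have hkl : klDiv μ ν = ENNReal.ofReal (∫ x, llr μ ν x ∂μ) := by
    rw [klDiv_of_ac_of_integrable hac hllr]; simp
  rw [hkl]
  refine ENNReal.ofReal_le_ofReal ?_
  -- Multiplying `exp (ℓ - llr)` by `dμ/dν` gives back `exp ℓ` where the derivative is nonzero and
  -- `0` elsewhere. Combined with `u + 1 ≤ exp u` for `u = ℓ - llr`, this yields `∫ (ℓ - llr) dμ ≤
  -- 0`.
  have hle : ∫⁻ x, ENNReal.ofReal (Real.exp (ℓ x - llr μ ν x)) ∂μ ≤ 1 := by
    refine le_trans ?_ hν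
    have hwd := lintegral_withDensity_eq_lintegral_mul ν (Measure.measurable_rnDeriv μ ν)
      (g := fun x => ENNReal.ofReal (Real.exp (ℓ x - llr μ ν x))) (by fun_prop)
    rw [Measure.withDensity_rnDeriv_eq μ ν hac] at hwd
    rw [hwd]
    refine lintegral_mono_ae ?_
    filter_upwards [Measure.rnDeriv_ne_top μ ν] with x hx
    simp only [Pi.mul_apply]
    by_cases h0 : μ.rnDeriv ν x = 0
    · simp [h0]
    · have hpos : 0 < (μ.rnDeriv ν x).toReal := ENNReal.toReal_pos h0 hx
      rw [llr, Real.exp_sub, Real.exp_log hpos]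
      nth_rw 1 [← ENNReal.ofReal_toReal hx]
      rw [← ENNReal.ofReal_mul hpos.le]
      apply le_of_eq
      congr 1
      field_simp
  have hexp : Integrable (fun x => Real.exp (ℓ x - llr μ ν x)) μ := by
    refine ⟨by fun_prop, ?_⟩
    rw [hasFiniteIntegral_iff_ofReal (ae_of_all _ fun x => (Real.exp_pos _).le)]
    exact lt_of_le_of_lt hle ENNReal.one_lt_top
  have h1 : ∫ x, Real.exp (ℓ x - llr μ ν x) ∂μ ≤ 1 := by
    rw [integral_eq_lintegral_of_nonneg_ae (ae_of_all _ fun x => (Real.exp_pos _).le)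
      (by fun_prop)]
    exact ENNReal.toReal_le_of_le_ofReal zero_le_one (by simpa using hle)
  have h2 : ∫ x, (ℓ x - llr μ ν x) ∂μ ≤ ∫ x, (Real.exp (ℓ x - llr μ ν x) - 1) ∂μ :=
    integral_mono (hint.sub hllr) (hexp.sub (integrable_const _)) fun x => by
      have := Real.add_one_le_exp (ℓ x - llr μ ν x)
      simp only; linarith
  rw [integral_sub hint hllr, integral_sub hexp (integrable_const _)] at h2
  simp at h2
  linarith

/-- Adjoining independent randomness does not change a relative entropy. -/
theorem klDiv_prod_right {α β : Type*} [MeasurableSpace α] [MeasurableSpace β] (μ ν : Measure α)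
    [IsProbabilityMeasure μ] [IsProbabilityMeasure ν] (ξ : Measure β) [IsProbabilityMeasure ξ] :
    klDiv (μ.prod ξ) (ν.prod ξ) = klDiv μ ν := by
  rw [← Measure.compProd_const, ← Measure.compProd_const, klDiv_compProd_left]

theorem klDiv_eq_of_withDensity {α : Type*} [MeasurableSpace α] {μ ν : Measure α}
    [IsProbabilityMeasure μ] [IsProbabilityMeasure ν] {ℓ : α → ℝ} (hℓ : Measurable ℓ)
    (hint : Integrable ℓ μ) (h : μ = ν.withDensity fun x => ENNReal.ofReal (Real.exp (ℓ x))) :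
    klDiv μ ν = ENNReal.ofReal (∫ x, ℓ x ∂μ) := by
  have hac : μ ≪ ν := by rw [h]; exact withDensity_absolutelyContinuous _ _
  have hm : Measurable fun x => ENNReal.ofReal (Real.exp (ℓ x)) := by fun_prop
  have hr : llr μ ν =ᵐ[μ] ℓ := by
    have : μ.rnDeriv ν =ᵐ[ν] fun x => ENNReal.ofReal (Real.exp (ℓ x)) := by
      conv_lhs => rw [h]
      exact Measure.rnDeriv_withDensity ν hm
    filter_upwards [hac.ae_le this] with x hx
    rw [llr, hx, ENNReal.toReal_ofReal (Real.exp_pos _).le, Real.log_exp]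
  rw [klDiv_of_ac_of_integrable hac (hint.congr hr.symm), integral_congr_ae hr]
  simp

/-! ### Gaussian likelihood ratios -/

/-- The logarithm of the density of `N(m, v)` with respect to `N(m₀, v₀)`. -/
def gaussLogRatio (m v m₀ v₀ x : ℝ) : ℝ :=
  1 / 2 * Real.log (v₀ / v) - (x - m) ^ 2 / (2 * v) + (x - m₀) ^ 2 / (2 * v₀)

@[fun_prop]
theorem measurable_gaussLogRatio {α : Type*} [MeasurableSpace α] {m m₀ x : α → ℝ} (v v₀ : ℝ)
    (hm : Measurable m) (hm₀ : Measurable m₀) (hx : Measurable x) :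
    Measurable fun a => gaussLogRatio (m a) v (m₀ a) v₀ (x a) := by
  unfold gaussLogRatio
  fun_prop

theorem exp_gaussLogRatio_mul_pdf {m v m₀ v₀ : ℝ} (hv : 0 < v) (hv₀ : 0 < v₀) (x : ℝ) :
    gaussianPDFReal m₀ v₀.toNNReal x * Real.exp (gaussLogRatio m v m₀ v₀ x)
      = gaussianPDFReal m v.toNNReal x := by
  have hsq : Real.exp (1 / 2 * Real.log (v₀ / v)) = √(v₀ / v) := by
    rw [Real.sqrt_eq_rpow, Real.rpow_def_of_pos (by positivity), mul_comm]
  simp only [gaussianPDFReal, gaussLogRatio, Real.coe_toNNReal _ hv.le, Real.coe_toNNReal _ hv₀.le]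
  rw [show (1 / 2 * Real.log (v₀ / v) - (x - m) ^ 2 / (2 * v) + (x - m₀) ^ 2 / (2 * v₀))
    = 1 / 2 * Real.log (v₀ / v) + (-(x - m) ^ 2 / (2 * v)) + (x - m₀) ^ 2 / (2 * v₀) by ring,
    Real.exp_add, Real.exp_add, hsq]
  have hc : (√(2 * Real.pi * v₀))⁻¹ * √(v₀ / v) = (√(2 * Real.pi * v))⁻¹ := by
    rw [← Real.sqrt_inv, ← Real.sqrt_inv, ← Real.sqrt_mul (by positivity)]
    congr 1
    field_simp
  have he : Real.exp (-(x - m₀) ^ 2 / (2 * v₀)) * Real.exp ((x - m₀) ^ 2 / (2 * v₀)) = 1 := by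
    rw [← Real.exp_add, neg_div, neg_add_cancel, Real.exp_zero]
  rw [← hc]
  linear_combination ((√(2 * Real.pi * v₀))⁻¹ * √(v₀ / v) *
    Real.exp (-(x - m) ^ 2 / (2 * v))) * he

theorem gaussianReal_withDensity {m v m₀ v₀ : ℝ} (hv : 0 < v) (hv₀ : 0 < v₀) :
    (gaussianReal m₀ v₀.toNNReal).withDensity
      (fun x => ENNReal.ofReal (Real.exp (gaussLogRatio m v m₀ v₀ x)))
      = gaussianReal m v.toNNReal := by
  have h1 : v.toNNReal ≠ 0 := by simpa using hv
  have h2 : v₀.toNNReal ≠ 0 := by simpa using hv₀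
  rw [gaussianReal_of_var_ne_zero _ h1, gaussianReal_of_var_ne_zero _ h2,
    ← withDensity_mul _ (by fun_prop) (by fun_prop)]
  congr 1
  ext x
  simp only [Pi.mul_apply, gaussianPDF]
  rw [← ENNReal.ofReal_mul (gaussianPDFReal_nonneg _ _ _), exp_gaussLogRatio_mul_pdf hv hv₀]

/-- The coordinates are independent under the product measure, so the integral of a product of
one-coordinate factors over a box splits. -/
theorem pi_withDensity {ι α : Type*} [Fintype ι] [MeasurableSpace α] (μ : ι → Measure α)
    [∀ i, IsProbabilityMeasure (μ i)] (f : ι → α → ℝ≥0∞) (hf : ∀ i, Measurable (f i))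
    [∀ i, SigmaFinite ((μ i).withDensity (f i))] :
    (Measure.pi μ).withDensity (fun x => ∏ i, f i (x i))
      = Measure.pi fun i => (μ i).withDensity (f i) := by
  refine (Measure.pi_eq fun s hs => ?_).symm
  rw [withDensity_apply _ (.univ_pi hs), ← lintegral_indicator (.univ_pi hs)]
  have hX : ∀ i, Measurable ((s i).indicator (f i)) := fun i => (hf i).indicator (hs i)
  have hprod : ∀ x : ι → α, (Set.univ.pi s).indicator (fun x => ∏ i, f i (x i)) x
      = ∏ i, (s i).indicator (f i) (x i) := by
    intro x
    by_cases hx : x ∈ Set.univ.pi s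
    · rw [Set.indicator_of_mem hx]
      exact Finset.prod_congr rfl fun i _ => (Set.indicator_of_mem (hx i trivial) _).symm
    · rw [Set.indicator_of_notMem hx]
      obtain ⟨i, hi⟩ : ∃ i, x i ∉ s i := by simpa [Set.mem_pi] using hx
      exact (Finset.prod_eq_zero (Finset.mem_univ i) (Set.indicator_of_notMem hi _)).symm
  simp_rw [hprod]
  rw [lintegral_prod_eq_prod_lintegral_of_indepFun Finset.univ
    (fun i (x : ι → α) => (s i).indicator (f i) (x i))
    (iIndepFun_pi fun i => (hX i).aemeasurable) fun i => (hX i).comp (measurable_pi_apply i)]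
  refine Finset.prod_congr rfl fun i _ => ?_
  rw [withDensity_apply _ (hs i), ← lintegral_indicator (hs i)]
  exact (measurePreserving_eval μ i).lintegral_comp (hX i)

theorem pi_gaussianReal_withDensity {ι : Type*} [Fintype ι] {m m₀ : ι → ℝ} {v v₀ : ℝ}
    (hv : 0 < v) (hv₀ : 0 < v₀) :
    (Measure.pi fun i => gaussianReal (m₀ i) v₀.toNNReal).withDensity
      (fun x => ENNReal.ofReal (Real.exp (∑ i, gaussLogRatio (m i) v (m₀ i) v₀ (x i))))
      = Measure.pi fun i => gaussianReal (m i) v.toNNReal := by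
  have hg (i : ι) := gaussianReal_withDensity (m := m i) (m₀ := m₀ i) hv hv₀
  have (i : ι) : SigmaFinite ((gaussianReal (m₀ i) v₀.toNNReal).withDensity
      (fun x => ENNReal.ofReal (Real.exp (gaussLogRatio (m i) v (m₀ i) v₀ x)))) := by
    rw [hg]; infer_instance
  simp_rw [← hg]
  rw [← pi_withDensity _ _ (fun i => by fun_prop)]
  congr 1
  ext x
  rw [Real.exp_sum, ENNReal.ofReal_prod_of_nonneg fun i _ => (Real.exp_pos _).le]

/-- A likelihood ratio has total mass one under the reference law. This supplies the normalization
`∫ exp ℓ dν ≤ 1` in every application of the variational bound. -/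
theorem lintegral_exp_sum_gaussLogRatio {ι : Type*} [Fintype ι] {m m₀ : ι → ℝ} {v v₀ : ℝ}
    (hv : 0 < v) (hv₀ : 0 < v₀) :
    ∫⁻ x, ENNReal.ofReal (Real.exp (∑ i, gaussLogRatio (m i) v (m₀ i) v₀ (x i)))
      ∂(Measure.pi fun i => gaussianReal (m₀ i) v₀.toNNReal) = 1 := by
  rw [← setLIntegral_univ, ← withDensity_apply _ .univ, pi_gaussianReal_withDensity hv hv₀]
  simp

/-! ### Products of laws -/

theorem pi_prod_pi_map {ι α β γ : Type*} [Fintype ι] [MeasurableSpace α]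
    [MeasurableSpace β] [MeasurableSpace γ] (μ : ι → Measure α) (ν : ι → Measure β)
    [∀ i, IsProbabilityMeasure (μ i)] [∀ i, IsProbabilityMeasure (ν i)] {f : ι → α × β → γ}
    (hf : ∀ i, Measurable (f i)) :
    ((Measure.pi μ).prod (Measure.pi ν)).map (fun p i => f i (p.1 i, p.2 i))
      = Measure.pi fun i => ((μ i).prod (ν i)).map (f i) := by
  rw [← (measurePreserving_arrowProdEquivProdArrow α β ι μ ν).map_eq,
    Measure.map_map (by fun_prop) (MeasurableEquiv.measurable _)]
  have (i : ι) : IsProbabilityMeasure (((μ i).prod (ν i)).map (f i)) :=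
    Measure.isProbabilityMeasure_map (hf i).aemeasurable
  rw [← Measure.pi_map_pi fun i => (hf i).aemeasurable]
  rfl

theorem pi_map_prodMk_of_indepFun {ι Ω α β : Type*} [Fintype ι] [MeasurableSpace Ω]
    [MeasurableSpace α] [MeasurableSpace β] {μ : Measure Ω} [IsProbabilityMeasure μ]
    {U : Ω → α} {V : Ω → β} (hU : Measurable U) (hV : Measurable V) (h : IndepFun U V μ) :
    (Measure.pi fun _ : ι => μ).map (fun ω => (fun i => U (ω i), fun i => V (ω i)))
      = (Measure.pi fun _ : ι => μ.map U).prod (Measure.pi fun _ : ι => μ.map V) := by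
  have : IsProbabilityMeasure (μ.map U) := Measure.isProbabilityMeasure_map hU.aemeasurable
  have : IsProbabilityMeasure (μ.map V) := Measure.isProbabilityMeasure_map hV.aemeasurable
  rw [← (measurePreserving_arrowProdEquivProdArrow α β ι _ _).map_eq,
    ← h.map_prod_eq_prod_map_map hU.aemeasurable hV.aemeasurable]
  have : IsProbabilityMeasure (μ.map fun ω => (U ω, V ω)) :=
    Measure.isProbabilityMeasure_map (by fun_prop)
  rw [← Measure.pi_map_pi fun i => by fun_prop,
    Measure.map_map (MeasurableEquiv.measurable _) (by fun_prop)]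
  rfl

theorem indepFun_pi {ι Ω α β : Type*} [Fintype ι] [MeasurableSpace Ω]
    [MeasurableSpace α] [MeasurableSpace β] {μ : Measure Ω} [IsProbabilityMeasure μ]
    {U : Ω → α} {V : Ω → β} (hU : Measurable U) (hV : Measurable V) (h : IndepFun U V μ) :
    IndepFun (fun (ω : ι → Ω) i => U (ω i)) (fun ω i => V (ω i)) (Measure.pi fun _ : ι => μ) := by
  have : IsProbabilityMeasure (μ.map U) := Measure.isProbabilityMeasure_map hU.aemeasurable
  have : IsProbabilityMeasure (μ.map V) := Measure.isProbabilityMeasure_map hV.aemeasurable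
  have hU' : Measurable fun (ω : ι → Ω) i => U (ω i) := by fun_prop
  have hV' : Measurable fun (ω : ι → Ω) i => V (ω i) := by fun_prop
  rw [indepFun_iff_map_prod_eq_prod_map_map hU'.aemeasurable hV'.aemeasurable,
    pi_map_prodMk_of_indepFun hU hV h, Measure.pi_map_pi fun i => hU.aemeasurable,
    Measure.pi_map_pi fun i => hV.aemeasurable]

/-- Revealing independent randomness does not increase the information. -/
theorem klDiv_map_prodMk_le {Ω α β γ : Type*} [MeasurableSpace Ω] [MeasurableSpace α]
    [MeasurableSpace β] [MeasurableSpace γ] {μ : Measure Ω} [IsProbabilityMeasure μ]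
    {X : Ω → α} {Z : Ω → β} {ξ : Ω → γ} (hX : Measurable X) (hZ : Measurable Z)
    (hξ : Measurable ξ) (h : IndepFun (fun ω => (X ω, Z ω)) ξ μ) :
    klDiv (μ.map fun ω => (X ω, (Z ω, ξ ω))) ((μ.map X).prod (μ.map fun ω => (Z ω, ξ ω)))
      ≤ klDiv (μ.map fun ω => (X ω, Z ω)) ((μ.map X).prod (μ.map Z)) := by
  have : IsProbabilityMeasure (μ.map X) := Measure.isProbabilityMeasure_map hX.aemeasurable
  have : IsProbabilityMeasure (μ.map Z) := Measure.isProbabilityMeasure_map hZ.aemeasurable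
  have : IsProbabilityMeasure (μ.map ξ) := Measure.isProbabilityMeasure_map hξ.aemeasurable
  have : IsProbabilityMeasure (μ.map fun ω => (X ω, Z ω)) :=
    Measure.isProbabilityMeasure_map (by fun_prop)
  rw [← klDiv_prod_right (μ.map fun ω => (X ω, Z ω)) _ (μ.map ξ)]
  have hZξ : IndepFun Z ξ μ := h.comp measurable_snd measurable_id
  have h1 : μ.map (fun ω => (X ω, (Z ω, ξ ω)))
      = ((μ.map fun ω => (X ω, Z ω)).prod (μ.map ξ)).map MeasurableEquiv.prodAssoc := by
    rw [← h.map_prod_eq_prod_map_map (by fun_prop) (by fun_prop),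
      Measure.map_map (by fun_prop) (by fun_prop)]
    rfl
  have h2 : (μ.map X).prod (μ.map fun ω => (Z ω, ξ ω))
      = (((μ.map X).prod (μ.map Z)).prod (μ.map ξ)).map MeasurableEquiv.prodAssoc := by
    rw [hZξ.map_prod_eq_prod_map_map (by fun_prop) (by fun_prop)]
    exact Measure.prodAssoc_prod.symm
  rw [h1, h2]
  exact klDiv_map_le _ _ (by fun_prop)

/-! ### Gaussian pairs -/

theorem _root_.ProbabilityTheory.HasGaussianLaw.integral_combo {Ω : Type*} [MeasurableSpace Ω]
    {μ : Measure Ω} {U V : Ω → ℝ} (h : HasGaussianLaw (fun ω => (U ω, V ω)) μ) (a b : ℝ) :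
    ∫ ω, (a * U ω + b * V ω) ∂μ = a * ∫ ω, U ω ∂μ + b * ∫ ω, V ω ∂μ := by
  rw [integral_add (h.fst.integrable.const_mul a) (h.snd.integrable.const_mul b),
    integral_const_mul, integral_const_mul]

theorem _root_.ProbabilityTheory.HasGaussianLaw.variance_combo {Ω : Type*} [MeasurableSpace Ω]
    {μ : Measure Ω} {U V : Ω → ℝ} (h : HasGaussianLaw (fun ω => (U ω, V ω)) μ) (a b : ℝ) :
    Var[fun ω => a * U ω + b * V ω; μ]
      = a ^ 2 * cov[U, U; μ] + 2 * a * b * cov[U, V; μ] + b ^ 2 * cov[V, V; μ] := by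
  have := h.isProbabilityMeasure
  rw [variance_fun_add (h.fst.memLp_two.const_mul a) (h.snd.memLp_two.const_mul b),
    variance_const_mul, variance_const_mul, covariance_const_mul_left, covariance_const_mul_right,
    covariance_self h.fst.aemeasurable, covariance_self h.snd.aemeasurable]
  ring

/-- The characteristic function of a Gaussian pair depends only on the mean and variance of each
linear combination, hence on the two means and three covariances. -/
theorem map_prodMk_eq_of_hasGaussianLaw {Ω Ω' : Type*} [MeasurableSpace Ω] [MeasurableSpace Ω']
    {μ : Measure Ω} {μ' : Measure Ω'} {U V : Ω → ℝ} {U' V' : Ω' → ℝ}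
    (h : HasGaussianLaw (fun ω => (U ω, V ω)) μ) (h' : HasGaussianLaw (fun ω => (U' ω, V' ω)) μ')
    (hU : ∫ ω, U ω ∂μ = ∫ ω, U' ω ∂μ') (hV : ∫ ω, V ω ∂μ = ∫ ω, V' ω ∂μ')
    (hUU : cov[U, U; μ] = cov[U', U'; μ']) (hUV : cov[U, V; μ] = cov[U', V'; μ'])
    (hVV : cov[V, V; μ] = cov[V', V'; μ']) :
    μ.map (fun ω => (U ω, V ω)) = μ'.map (fun ω => (U' ω, V' ω)) := by
  have := h.isProbabilityMeasure
  have := h'.isProbabilityMeasure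
  have : IsProbabilityMeasure (μ.map fun ω => (U ω, V ω)) :=
    Measure.isProbabilityMeasure_map h.aemeasurable
  have : IsProbabilityMeasure (μ'.map fun ω => (U' ω, V' ω)) :=
    Measure.isProbabilityMeasure_map h'.aemeasurable
  refine Measure.ext_of_charFunDual ?_
  ext L
  rw [h.charFunDual_map_eq_fun, h'.charFunDual_map_eq_fun]
  obtain ⟨a, b, hL⟩ : ∃ a b : ℝ, ∀ u v : ℝ, L (u, v) = a * u + b * v := by
    refine ⟨L (1, 0), L (0, 1), fun u v => ?_⟩
    have : ((u, v) : ℝ × ℝ) = u • (1, 0) + v • (0, 1) := by simp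
    rw [this, map_add, map_smul, map_smul]
    simp only [smul_eq_mul]; ring
  simp_rw [hL]
  rw [h.integral_combo, h.variance_combo, h'.integral_combo, h'.variance_combo, hU, hV, hUU, hUV, hVV]

theorem hasGaussianLaw_fst_snd (m₁ m₂ : ℝ) (v₁ v₂ : NNReal) :
    HasGaussianLaw (fun p : ℝ × ℝ => (p.1, p.2))
      ((gaussianReal m₁ v₁).prod (gaussianReal m₂ v₂)) := by
  have h1 : HasLaw (fun p : ℝ × ℝ => p.1) (gaussianReal m₁ v₁)
      ((gaussianReal m₁ v₁).prod (gaussianReal m₂ v₂)) := ⟨by fun_prop, by simp⟩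
  have h2 : HasLaw (fun p : ℝ × ℝ => p.2) (gaussianReal m₂ v₂)
      ((gaussianReal m₁ v₁).prod (gaussianReal m₂ v₂)) := ⟨by fun_prop, by simp⟩
  exact (indepFun_prod measurable_id measurable_id).hasGaussianLaw h1.hasGaussianLaw
    h2.hasGaussianLaw

theorem moments_of_map_eq_gaussianReal {Ω : Type*} [MeasurableSpace Ω] {μ : Measure Ω}
    {U : Ω → ℝ} {m : ℝ} {v : NNReal} (hU : AEMeasurable U μ) (h : μ.map U = gaussianReal m v) :
    HasGaussianLaw U μ ∧ ∫ ω, U ω ∂μ = m ∧ cov[U, U; μ] = v := by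
  have hl : HasLaw U (gaussianReal m v) μ := ⟨hU, h⟩
  refine ⟨hl.hasGaussianLaw, ?_, ?_⟩
  · rw [hl.integral_eq]; simp
  · rw [covariance_self hU, hl.variance_eq]; simp

theorem covariance_combo_left {Ω : Type*} [MeasurableSpace Ω] {μ : Measure Ω} [IsFiniteMeasure μ]
    {U V W : Ω → ℝ} (hU : MemLp U 2 μ) (hV : MemLp V 2 μ) (hW : MemLp W 2 μ) (a b : ℝ) :
    cov[fun ω => a * U ω + b * V ω, W; μ] = a * cov[U, W; μ] + b * cov[V, W; μ] := by
  rw [← covariance_const_mul_left, ← covariance_const_mul_left]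
  exact covariance_add_left (hU.const_mul a) (hV.const_mul b) hW

theorem covariance_combo_right {Ω : Type*} [MeasurableSpace Ω] {μ : Measure Ω} [IsFiniteMeasure μ]
    {U V W : Ω → ℝ} (hU : MemLp U 2 μ) (hV : MemLp V 2 μ) (hW : MemLp W 2 μ) (a b : ℝ) :
    cov[W, fun ω => a * U ω + b * V ω; μ] = a * cov[W, U; μ] + b * cov[W, V; μ] := by
  rw [covariance_comm, covariance_combo_left hU hV hW, covariance_comm W U, covariance_comm W V]

/-- If `T` is the conditional mean of the Gaussian `X` up to independent noise and `ζ` is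
independent Gaussian noise, then `bX + cT + ζ` is a noisier (or cleaner) version of `T`, provided
that the first two moments fit. -/
theorem map_prodMk_combo_eq {Ω : Type*} [MeasurableSpace Ω] {μ : Measure Ω}
    {X T ζ : Ω → ℝ} (hXT : HasGaussianLaw (fun ω => (X ω, T ω)) μ) (hζ : Measurable ζ)
    {s r m σ b c v : ℝ} (hζl : μ.map ζ = gaussianReal 0 v.toNNReal)
    (hind : IndepFun (fun ω => (X ω, T ω)) ζ μ) (hX : ∫ ω, X ω ∂μ = m) (hT : ∫ ω, T ω ∂μ = m)
    (hXX : cov[X, X; μ] = s) (hcXT : cov[X, T; μ] = r) (hTT : cov[T, T; μ] = r)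
    (hv : 0 ≤ v) (hσ : 0 ≤ σ) (hσs : σ ≤ s) (hm : b * m + c * m = m)
    (hc : b * s + c * r = s - σ)
    (hvar : b ^ 2 * s + 2 * b * c * r + c ^ 2 * r + v = s - σ) :
    μ.map (fun ω => (X ω, b * X ω + c * T ω + ζ ω))
      = ((gaussianReal m (s - σ).toNNReal).prod (gaussianReal 0 σ.toNNReal)).map
        (fun p : ℝ × ℝ => (p.1 + p.2, p.1)) := by
  have := hXT.isProbabilityMeasure
  obtain ⟨hζG, hζm, hζv⟩ := moments_of_map_eq_gaussianReal hζ.aemeasurable hζl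
  rw [Real.coe_toNNReal _ hv] at hζv
  have hG3 := hind.hasGaussianLaw hXT hζG
  have hG' := hasGaussianLaw_fst_snd m 0 (s - σ).toNNReal σ.toNNReal
  have hX2 := hXT.fst.memLp_two
  have hT2 := hXT.snd.memLp_two
  have hζ2 := hζG.memLp_two
  have cXζ : cov[X, ζ; μ] = 0 :=
    (hind.comp measurable_fst measurable_id).covariance_eq_zero hX2 hζ2
  have cTζ : cov[T, ζ; μ] = 0 :=
    (hind.comp measurable_snd measurable_id).covariance_eq_zero hT2 hζ2
  have cζX : cov[ζ, X; μ] = 0 := by rw [covariance_comm, cXζ]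
  have cζT : cov[ζ, T; μ] = 0 := by rw [covariance_comm, cTζ]
  have cTX : cov[T, X; μ] = r := by rw [covariance_comm, hcXT]
  have c2 : cov[fun p : ℝ × ℝ => p.1, fun p => p.2;
      (gaussianReal m (s - σ).toNNReal).prod (gaussianReal 0 σ.toNNReal)] = 0 :=
    (indepFun_prod measurable_id measurable_id).covariance_eq_zero hG'.fst.memLp_two
      hG'.snd.memLp_two
  obtain ⟨-, m1, v1⟩ := moments_of_map_eq_gaussianReal (U := fun p : ℝ × ℝ => p.1)
    (μ := (gaussianReal m (s - σ).toNNReal).prod (gaussianReal 0 σ.toNNReal))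
    (m := m) (v := (s - σ).toNNReal) (by fun_prop) (by simp)
  obtain ⟨-, m2, v2⟩ := moments_of_map_eq_gaussianReal (U := fun p : ℝ × ℝ => p.2)
    (μ := (gaussianReal m (s - σ).toNNReal).prod (gaussianReal 0 σ.toNNReal))
    (m := 0) (v := σ.toNNReal) (by fun_prop) (by simp)
  rw [Real.coe_toNNReal _ (by linarith)] at v1 v2
  have hT' : (fun ω => b * X ω + c * T ω + ζ ω)
      = fun ω => 1 * (b * X ω + c * T ω) + 1 * ζ ω := by ext; ring
  have hbc : MemLp (fun ω => b * X ω + c * T ω) 2 μ := (hX2.const_mul b).add (hT2.const_mul c)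
  have hS : (fun p : ℝ × ℝ => p.1 + p.2) = fun p => 1 * p.1 + 1 * p.2 := by ext; ring
  have hT2' : MemLp (fun ω => 1 * (b * X ω + c * T ω) + 1 * ζ ω) 2 μ :=
    (hbc.const_mul 1).add (hζ2.const_mul 1)
  have hS2' : MemLp (fun p : ℝ × ℝ => 1 * p.1 + 1 * p.2) 2
      ((gaussianReal m (s - σ).toNNReal).prod (gaussianReal 0 σ.toNNReal)) :=
    (hG'.fst.memLp_two.const_mul 1).add (hG'.snd.memLp_two.const_mul 1)
  have c2' : cov[fun p : ℝ × ℝ => p.2, fun p => p.1;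
      (gaussianReal m (s - σ).toNNReal).prod (gaussianReal 0 σ.toNNReal)] = 0 := by
    rw [covariance_comm, c2]
  refine map_prodMk_eq_of_hasGaussianLaw ?_ ?_ ?_ ?_ ?_ ?_ ?_
  · exact hG3.map_fun ((ContinuousLinearMap.fst ℝ ℝ ℝ ∘L ContinuousLinearMap.fst ℝ (ℝ × ℝ) ℝ).prod
      ((b • ContinuousLinearMap.fst ℝ ℝ ℝ + c • ContinuousLinearMap.snd ℝ ℝ ℝ)
        ∘L ContinuousLinearMap.fst ℝ (ℝ × ℝ) ℝ + ContinuousLinearMap.snd ℝ (ℝ × ℝ) ℝ))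
  · exact hG'.map_fun ((ContinuousLinearMap.fst ℝ ℝ ℝ + ContinuousLinearMap.snd ℝ ℝ ℝ).prod
      (ContinuousLinearMap.fst ℝ ℝ ℝ))
  · rw [hX, integral_add hG'.fst.integrable hG'.snd.integrable, m1, m2, add_zero]
  · rw [integral_add (f := fun ω => b * X ω + c * T ω)
      ((hXT.fst.integrable.const_mul b).add (hXT.snd.integrable.const_mul c))
      hζG.integrable, integral_add (hXT.fst.integrable.const_mul b)
      (hXT.snd.integrable.const_mul c), integral_const_mul, integral_const_mul, hX, hT, hζm, m1]
    linarith
  · rw [hS, covariance_combo_left hG'.fst.memLp_two hG'.snd.memLp_two hS2',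
      covariance_combo_right hG'.fst.memLp_two hG'.snd.memLp_two hG'.fst.memLp_two,
      covariance_combo_right hG'.fst.memLp_two hG'.snd.memLp_two hG'.snd.memLp_two,
      v1, v2, c2, c2', hXX]
    ring
  · rw [hT', hS, covariance_combo_right hbc hζ2 hX2, covariance_combo_right hX2 hT2 hX2,
      covariance_combo_left hG'.fst.memLp_two hG'.snd.memLp_two hG'.fst.memLp_two, v1, c2', cXζ,
      hXX, hcXT]
    linarith
  · rw [hT', covariance_combo_left hbc hζ2 hT2', covariance_combo_right hbc hζ2 hbc,
      covariance_combo_right hbc hζ2 hζ2, covariance_combo_left hX2 hT2 hbc,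
      covariance_combo_left hX2 hT2 hζ2, covariance_combo_right hX2 hT2 hX2,
      covariance_combo_right hX2 hT2 hT2, covariance_combo_right hX2 hT2 hζ2,
      hXX, hcXT, hTT, cTX, cXζ, cTζ, cζX, cζT, hζv, v1]
    linarith

/-- The two factorizations of the law of `(X, bX + cτ + ζ)`, where `X ~ N(τ, w)`. -/
theorem gaussianReal_prod_map_eq {σ w : ℝ} (hσ : 0 < σ) (hσw : σ ≤ w) (τ : ℝ) :
    ((gaussianReal τ w.toNNReal).prod (gaussianReal 0 (σ * (w - σ) / w).toNNReal)).map
        (fun p : ℝ × ℝ => (p.1, (w - σ) / w * p.1 + σ / w * τ + p.2))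
      = ((gaussianReal τ (w - σ).toNNReal).prod (gaussianReal 0 σ.toNNReal)).map
        (fun p : ℝ × ℝ => (p.1 + p.2, p.1)) := by
  have hw : 0 < w := hσ.trans_le hσw
  obtain ⟨h1, h2, h3⟩ := moments_of_map_eq_gaussianReal (U := fun p : ℝ × ℝ => p.1)
    (μ := (gaussianReal τ w.toNNReal).prod (gaussianReal 0 (σ * (w - σ) / w).toNNReal))
    (m := τ) (v := w.toNNReal) (by fun_prop) (by simp)
  rw [Real.coe_toNNReal _ hw.le] at h3
  -- The constant `τ` counts as a degenerate Gaussian estimate, with covariance parameter `r = 0`,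
  -- so the general moment-matching lemma applies.
  have hτ : HasGaussianLaw (fun _ : ℝ × ℝ => τ)
      ((gaussianReal τ w.toNNReal).prod (gaussianReal 0 (σ * (w - σ) / w).toNNReal)) := by
    refine ⟨?_⟩
    rw [Measure.map_const]
    simp only [measure_univ, one_smul]
    infer_instance
  refine map_prodMk_combo_eq (T := fun _ => τ) (ζ := fun p => p.2) (r := 0)
    (v := σ * (w - σ) / w)
    ((indepFun_const_right _ τ).hasGaussianLaw h1 hτ) measurable_snd (by simp)
    (indepFun_prod (X := fun x : ℝ => (x, τ)) (by fun_prop) measurable_id) h2 (by simp) h3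
    (by simp) (by simp) (by have := sub_nonneg.2 hσw; positivity) hσ.le hσw ?_ ?_ ?_
  · field_simp; ring
  · field_simp; ring
  · field_simp; ring

/-! ### Converse bounds for blocks -/

theorem lintegral_prodMk_of_indepFun {Ω α β : Type*} [MeasurableSpace Ω] [MeasurableSpace α]
    [MeasurableSpace β] {μ : Measure Ω} [IsProbabilityMeasure μ] {U : Ω → α} {V : Ω → β}
    (hU : Measurable U) (hV : Measurable V) (h : IndepFun U V μ) {F : α × β → ℝ≥0∞}
    (hF : Measurable F) :
    ∫⁻ ω, F (U ω, V ω) ∂μ = ∫⁻ a, ∫⁻ b, F (a, b) ∂(μ.map V) ∂(μ.map U) := by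
  have : IsProbabilityMeasure (μ.map V) := Measure.isProbabilityMeasure_map hV.aemeasurable
  rw [← lintegral_prod _ hF.aemeasurable,
    ← h.map_prod_eq_prod_map_map hU.aemeasurable hV.aemeasurable, lintegral_map hF (by fun_prop)]

theorem integrable_of_lintegral_ofReal_le {Ω : Type*} [MeasurableSpace Ω] {μ : Measure Ω}
    {f : Ω → ℝ} (hf : Measurable f) (h0 : ∀ ω, 0 ≤ f ω) {c : ℝ} (hc : 0 ≤ c)
    (h : ∫⁻ ω, ENNReal.ofReal (f ω) ∂μ ≤ ENNReal.ofReal c) :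
    Integrable f μ ∧ ∫ ω, f ω ∂μ ≤ c := by
  refine ⟨⟨hf.aestronglyMeasurable, ?_⟩, ?_⟩
  · rw [hasFiniteIntegral_iff_ofReal (ae_of_all _ h0)]
    exact h.trans_lt ENNReal.ofReal_lt_top
  · rw [integral_eq_lintegral_of_nonneg_ae (ae_of_all _ h0) hf.aestronglyMeasurable]
    exact ENNReal.toReal_le_of_le_ofReal hc h

theorem integral_sq_of_map_eq_gaussianReal {Ω : Type*} [MeasurableSpace Ω] {μ : Measure Ω}
    {U : Ω → ℝ} {v : ℝ} (hv : 0 ≤ v) (hU : AEMeasurable U μ)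
    (h : μ.map U = gaussianReal 0 v.toNNReal) :
    Integrable (fun ω => U ω ^ 2) μ ∧ ∫ ω, U ω ^ 2 ∂μ = v := by
  obtain ⟨h1, h2, h3⟩ := moments_of_map_eq_gaussianReal hU h
  have := h1.isProbabilityMeasure
  refine ⟨h1.memLp_two.integrable_sq, ?_⟩
  rw [Real.coe_toNNReal _ hv, covariance_eq_sub h1.memLp_two h1.memLp_two, h2] at h3
  rw [← h3, mul_zero, sub_zero]
  exact integral_congr_ae (ae_of_all _ fun ω => by simp [sq])

/-- The reference term contributes exactly `1/2` per coordinate and the other quadratic term at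
least `-1/2`, since the mean square error is at most `v` per coordinate. They cancel and leave the
logarithm. The estimate `m` may depend on `X` in any measurable way; only its distortion enters. -/
theorem integral_sum_gaussLogRatio {ι Ω : Type*} [Fintype ι] [MeasurableSpace Ω] {μ : Measure Ω}
    [IsProbabilityMeasure μ] {X m m₀ : Ω → ι → ℝ} (hX : Measurable X) (hm : Measurable m)
    (hm₀ : Measurable m₀) {v v₀ : ℝ} (hv : 0 < v) (hv₀ : 0 < v₀)
    (hd : ∫⁻ ω, ENNReal.ofReal (∑ i, (X ω i - m ω i) ^ 2) ∂μ
      ≤ ENNReal.ofReal (Fintype.card ι * v))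
    (h₀ : ∀ i, μ.map (fun ω => X ω i - m₀ ω i) = gaussianReal 0 v₀.toNNReal) :
    Integrable (fun ω => ∑ i, gaussLogRatio (m ω i) v (m₀ ω i) v₀ (X ω i)) μ ∧
      Fintype.card ι * (1 / 2 * Real.log (v₀ / v))
        ≤ ∫ ω, ∑ i, gaussLogRatio (m ω i) v (m₀ ω i) v₀ (X ω i) ∂μ := by
  obtain ⟨i1, e1⟩ := integrable_of_lintegral_ofReal_le
    (f := fun ω => ∑ i, (X ω i - m ω i) ^ 2) (by fun_prop)
    (fun ω => Finset.sum_nonneg fun i _ => sq_nonneg _) (by positivity) hd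
  have hi (i : ι) := integral_sq_of_map_eq_gaussianReal (μ := μ)
    (U := fun ω => X ω i - m₀ ω i) hv₀.le (by fun_prop) (h₀ i)
  have i2 : Integrable (fun ω => ∑ i, (X ω i - m₀ ω i) ^ 2) μ :=
    integrable_finsetSum _ fun i _ => (hi i).1
  have e2 : ∫ ω, ∑ i, (X ω i - m₀ ω i) ^ 2 ∂μ = Fintype.card ι * v₀ := by
    rw [integral_finsetSum _ fun i _ => (hi i).1, Finset.sum_congr rfl fun i _ => (hi i).2]
    simp
  have hsplit : (fun ω => ∑ i, gaussLogRatio (m ω i) v (m₀ ω i) v₀ (X ω i))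
      = fun ω => Fintype.card ι * (1 / 2 * Real.log (v₀ / v))
        - (1 / (2 * v)) * ∑ i, (X ω i - m ω i) ^ 2
        + (1 / (2 * v₀)) * ∑ i, (X ω i - m₀ ω i) ^ 2 := by
    ext ω
    simp only [gaussLogRatio, Finset.sum_add_distrib, Finset.sum_sub_distrib, Finset.sum_const,
      Finset.card_univ, nsmul_eq_mul, ← Finset.sum_div]
    ring
  have i3 : Integrable (fun ω => Fintype.card ι * (1 / 2 * Real.log (v₀ / v))
        - (1 / (2 * v)) * ∑ i, (X ω i - m ω i) ^ 2) μ :=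
    (integrable_const _).sub (i1.const_mul _)
  rw [hsplit]
  refine ⟨i3.add (i2.const_mul _), ?_⟩
  rw [integral_add i3 (i2.const_mul _), integral_sub (integrable_const _) (i1.const_mul _),
    integral_const_mul (1 / (2 * v)), integral_const_mul (1 / (2 * v₀)), e2]
  have h1 : 1 / (2 * v₀) * (Fintype.card ι * v₀) = Fintype.card ι / 2 := by field_simp
  have h2 : 1 / (2 * v) * ∫ ω, ∑ i, (X ω i - m ω i) ^ 2 ∂μ ≤ Fintype.card ι / 2 := by
    calc _ ≤ 1 / (2 * v) * (Fintype.card ι * v) := by gcongr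
      _ = _ := by field_simp
  rw [h1]
  simp only [integral_const, probReal_univ, smul_eq_mul, one_mul]
  linarith

/-- Revealing an estimate of a Gaussian vector with small distortion costs much information. -/
theorem rate_distortion_le_klDiv {ι Ω 𝒵 : Type*} [Fintype ι] [MeasurableSpace Ω]
    [MeasurableSpace 𝒵] {μ : Measure Ω} [IsProbabilityMeasure μ] {X : Ω → ι → ℝ} {Z : Ω → 𝒵}
    (hX : Measurable X) (hZ : Measurable Z) {φ : 𝒵 → ι → ℝ} (hφ : Measurable φ) {s d : ℝ}
    (hs : 0 < s) (hd : 0 < d)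
    (hlaw : μ.map X = Measure.pi fun _ => gaussianReal 0 s.toNNReal)
    (hdist : ∫⁻ ω, ENNReal.ofReal (∑ i, (X ω i - φ (Z ω) i) ^ 2) ∂μ
      ≤ ENNReal.ofReal (Fintype.card ι * d)) :
    ENNReal.ofReal (Fintype.card ι * (1 / 2 * Real.log (s / d)))
      ≤ klDiv (μ.map fun ω => (X ω, Z ω)) ((μ.map X).prod (μ.map Z)) := by
  have : IsProbabilityMeasure (μ.map X) := Measure.isProbabilityMeasure_map hX.aemeasurable
  have : IsProbabilityMeasure (μ.map Z) := Measure.isProbabilityMeasure_map hZ.aemeasurable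
  have : IsProbabilityMeasure (μ.map fun ω => (X ω, Z ω)) :=
    Measure.isProbabilityMeasure_map (by fun_prop)
  have h₀ (i : ι) : μ.map (fun ω => X ω i - (0 : Ω → ι → ℝ) ω i) = gaussianReal 0 s.toNNReal := by
    have : (fun ω => X ω i - (0 : Ω → ι → ℝ) ω i) = Function.eval i ∘ X := by ext; simp
    rw [this, ← Measure.map_map (measurable_pi_apply i) hX, hlaw]
    exact (measurePreserving_eval (fun _ : ι => gaussianReal 0 s.toNNReal) i).map_eq
  obtain ⟨hint, hle⟩ := integral_sum_gaussLogRatio (m := fun ω => φ (Z ω)) (m₀ := 0) hX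
    (by fun_prop) measurable_zero hd hs hdist h₀
  have hℓ : Measurable fun p : (ι → ℝ) × 𝒵 => ∑ i, gaussLogRatio (φ p.2 i) d 0 s (p.1 i) := by
    fun_prop
  have hXZ : AEMeasurable (fun ω => (X ω, Z ω)) μ := by fun_prop
  have key := ofReal_integral_le_klDiv (μ := μ.map fun ω => (X ω, Z ω))
    (ν := (μ.map X).prod (μ.map Z)) hℓ
    ((integrable_map_measure hℓ.aestronglyMeasurable hXZ).2 hint) ?_
  · refine le_trans (ENNReal.ofReal_le_ofReal ?_) key
    rw [integral_map hXZ hℓ.aestronglyMeasurable]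
    exact hle
  -- Under the product law `z` is frozen while `x` is integrated, so `φ z` is a deterministic mean
  -- and each inner integral is one.
  · rw [lintegral_prod_symm' _ (by fun_prop), hlaw]
    simp_rw [lintegral_exp_sum_gaussLogRatio (m₀ := fun _ : ι => (0 : ℝ)) hd hs]
    simp

/-- A code whose decoder has side information. -/
theorem log_card_ge_of_distortion {ι Ω 𝒴 : Type*} [Fintype ι] [MeasurableSpace Ω]
    [MeasurableSpace 𝒴] {μ : Measure Ω} [IsProbabilityMeasure μ] {X : Ω → ι → ℝ} {Y : Ω → 𝒴}
    (hX : Measurable X) (hY : Measurable Y) {t : 𝒴 → ι → ℝ} (ht : Measurable t) {K : ℕ}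
    {f : (ι → ℝ) → Fin K} (hf : Measurable f) {φ : Fin K × 𝒴 → ι → ℝ} (hφ : Measurable φ)
    {σ d : ℝ} (hσ : 0 < σ) (hd : 0 < d)
    (hlaw : μ.map (fun ω => X ω - t (Y ω)) = Measure.pi fun _ => gaussianReal 0 σ.toNNReal)
    (hind : IndepFun Y (fun ω => X ω - t (Y ω)) μ)
    (hdist : ∫⁻ ω, ENNReal.ofReal (∑ i, (X ω i - φ (f (X ω), Y ω) i) ^ 2) ∂μ
      ≤ ENNReal.ofReal (Fintype.card ι * d)) :
    Fintype.card ι * (1 / 2 * Real.log (σ / d)) ≤ Real.log K := by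
  have hK : 0 < K := Fin.pos (f 0)
  have h₀ (i : ι) : μ.map (fun ω => X ω i - t (Y ω) i) = gaussianReal 0 σ.toNNReal := by
    have : (fun ω => X ω i - t (Y ω) i) = Function.eval i ∘ fun ω => X ω - t (Y ω) := by
      ext; simp
    rw [this, ← Measure.map_map (measurable_pi_apply i) (by fun_prop), hlaw]
    exact (measurePreserving_eval (fun _ : ι => gaussianReal 0 σ.toNNReal) i).map_eq
  obtain ⟨hint, hle⟩ := integral_sum_gaussLogRatio (m := fun ω => φ (f (X ω), Y ω))
    (m₀ := fun ω => t (Y ω)) hX (by fun_prop) (by fun_prop) hd hσ hdist h₀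
  have hW : Measurable fun ω => X ω - t (Y ω) := by fun_prop
  -- For a fixed message the reconstruction depends on the side information only, which is
  -- independent of the estimation error; recentring at `t (Y ω)` reduces to the normalized
  -- likelihood ratio.
  have hone (k : Fin K) : ∫⁻ ω, ENNReal.ofReal (Real.exp (∑ i,
      gaussLogRatio (φ (k, Y ω) i) d (t (Y ω) i) σ (X ω i))) ∂μ = 1 := by
    have hF : Measurable fun p : 𝒴 × (ι → ℝ) => ENNReal.ofReal (Real.exp (∑ i,
          gaussLogRatio (φ (k, p.1) i - t p.1 i) d 0 σ (p.2 i))) := by fun_prop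
    have hshift : ∀ ω, ∑ i, gaussLogRatio (φ (k, Y ω) i) d (t (Y ω) i) σ (X ω i)
        = ∑ i, gaussLogRatio (φ (k, Y ω) i - t (Y ω) i) d 0 σ ((X ω - t (Y ω)) i) := by
      intro ω
      simp only [gaussLogRatio, Pi.sub_apply]
      refine Finset.sum_congr rfl fun i _ => ?_
      ring
    simp only [hshift]
    rw [lintegral_prodMk_of_indepFun hY hW hind hF, hlaw]
    simp_rw [lintegral_exp_sum_gaussLogRatio (m₀ := fun _ : ι => (0 : ℝ)) hd hσ]
    have : IsProbabilityMeasure (μ.map Y) := Measure.isProbabilityMeasure_map hY.aemeasurable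
    simp
  -- With both laws equal the relative entropy vanishes, so the variational bound says `∫ ℓ dμ ≤ 0`.
  -- Subtracting `log K` pays for bounding the term of the actual message by the sum over all `K`
  -- messages.
  have key := ofReal_integral_le_klDiv (μ := μ) (ν := μ)
    (ℓ := fun ω => ∑ i, gaussLogRatio (φ (f (X ω), Y ω) i) d (t (Y ω) i) σ (X ω i) - Real.log K)
    (by fun_prop) (hint.sub (integrable_const _)) ?_
  · rw [klDiv_self, integral_sub hint (integrable_const _)] at key
    simp only [integral_const, probReal_univ, smul_eq_mul, one_mul, nonpos_iff_eq_zero,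
      ENNReal.ofReal_eq_zero] at key
    linarith
  · have hKr : (0 : ℝ) < K := by exact_mod_cast hK
    calc ∫⁻ ω, ENNReal.ofReal (Real.exp (∑ i, gaussLogRatio (φ (f (X ω), Y ω) i) d (t (Y ω) i) σ
          (X ω i) - Real.log K)) ∂μ
        ≤ ∫⁻ ω, (∑ k, ENNReal.ofReal (Real.exp (∑ i, gaussLogRatio (φ (k, Y ω) i) d (t (Y ω) i) σ
          (X ω i)))) * (K : ℝ≥0∞)⁻¹ ∂μ := by
          refine lintegral_mono fun ω => ?_
          rw [Real.exp_sub, Real.exp_log hKr, ENNReal.ofReal_div_of_pos hKr,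
            ENNReal.ofReal_natCast, div_eq_mul_inv]
          gcongr
          exact Finset.single_le_sum (f := fun k => ENNReal.ofReal (Real.exp (∑ i,
            gaussLogRatio (φ (k, Y ω) i) d (t (Y ω) i) σ (X ω i)))) (fun _ _ => zero_le)
            (Finset.mem_univ (f (X ω)))
      _ = 1 := by
          rw [lintegral_mul_const _ (by fun_prop), lintegral_finsetSum _ (by fun_prop)]
          simp_rw [hone]
          simp only [Finset.sum_const, Finset.card_univ, Fintype.card_fin, nsmul_eq_mul, mul_one]
          exact ENNReal.mul_inv_cancel (by simp [hK.ne']) (by simp)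
      _ ≤ 1 := le_rfl

/-- For fixed `e` the cross term integrates to zero because `N` is centred and independent of `e`.
Working with `∫⁻` avoids assuming that `e` is square integrable. -/
theorem lintegral_sum_add_sq_le {ι Ω : Type*} [Fintype ι] [MeasurableSpace Ω] {μ : Measure Ω}
    [IsProbabilityMeasure μ] {e N : Ω → ι → ℝ} (he : Measurable e) (hN : Measurable N)
    (hind : IndepFun e N μ) {w : ℝ} (hw : 0 ≤ w)
    (hlaw : ∀ i, μ.map (fun ω => N ω i) = gaussianReal 0 w.toNNReal) :
    ∫⁻ ω, ENNReal.ofReal (∑ i, (e ω i + N ω i) ^ 2) ∂μ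
      ≤ ∫⁻ ω, ENNReal.ofReal (∑ i, e ω i ^ 2) ∂μ + ENNReal.ofReal (Fintype.card ι * w) := by
  have : IsProbabilityMeasure (μ.map e) := Measure.isProbabilityMeasure_map he.aemeasurable
  have h1 : ∫⁻ ω, ENNReal.ofReal (∑ i, (e ω i + N ω i) ^ 2) ∂μ
      = ∫⁻ a, ∫⁻ ω, ENNReal.ofReal (∑ i, (a i + N ω i) ^ 2) ∂μ ∂(μ.map e) := by
    have hF : Measurable fun p : (ι → ℝ) × (ι → ℝ) =>
        ENNReal.ofReal (∑ i, (p.1 i + p.2 i) ^ 2) := by fun_prop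
    rw [lintegral_prodMk_of_indepFun he hN hind hF]
    refine lintegral_congr fun a => ?_
    rw [lintegral_map (by fun_prop) hN]
  have hNi (i : ι) : Measurable fun ω => N ω i := by fun_prop
  have h2 : ∀ a : ι → ℝ, ∫⁻ ω, ENNReal.ofReal (∑ i, (a i + N ω i) ^ 2) ∂μ
      = ENNReal.ofReal (∑ i, a i ^ 2) + ENNReal.ofReal (Fintype.card ι * w) := by
    intro a
    have hi (i : ι) := integral_sq_of_map_eq_gaussianReal hw (hNi i).aemeasurable (hlaw i)
    have hi' (i : ι) := moments_of_map_eq_gaussianReal (hNi i).aemeasurable (hlaw i)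
    have hexp : ∀ i, (fun ω => (a i + N ω i) ^ 2)
        = fun ω => a i ^ 2 + (2 * a i) * N ω i + N ω i ^ 2 := fun i => by ext; ring
    have hl (i : ι) : Integrable (fun ω => a i ^ 2 + (2 * a i) * N ω i) μ :=
      (integrable_const _).add ((hi' i).1.integrable.const_mul _)
    have hint (i : ι) : Integrable (fun ω => (a i + N ω i) ^ 2) μ := by
      rw [hexp]
      exact (hl i).add (hi i).1
    have hval (i : ι) : ∫ ω, (a i + N ω i) ^ 2 ∂μ = a i ^ 2 + w := by
      rw [hexp, integral_add (hl i) (hi i).1, (hi i).2,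
        integral_add (integrable_const _) ((hi' i).1.integrable.const_mul _), integral_const_mul,
        (hi' i).2.1]
      simp
    rw [← ofReal_integral_eq_lintegral_ofReal (integrable_finsetSum _ fun i _ => hint i)
      (ae_of_all _ fun ω => Finset.sum_nonneg fun i _ => sq_nonneg _),
      integral_finsetSum _ fun i _ => hint i, Finset.sum_congr rfl fun i _ => hval i,
      Finset.sum_add_distrib, ENNReal.ofReal_add (Finset.sum_nonneg fun i _ => sq_nonneg _)
      (by positivity)]
    simp
  rw [h1]
  simp_rw [h2]
  rw [lintegral_add_right _ measurable_const, lintegral_map (by fun_prop) he]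
  simp

theorem lintegral_sum_sq_of_map_eq_gaussianReal {ι Ω : Type*} [Fintype ι] [MeasurableSpace Ω]
    {μ : Measure Ω} [IsProbabilityMeasure μ] {U : Ω → ι → ℝ} (hU : Measurable U) {v : ℝ}
    (hv : 0 ≤ v) (h : ∀ i, μ.map (fun ω => U ω i) = gaussianReal 0 v.toNNReal) :
    ∫⁻ ω, ENNReal.ofReal (∑ i, U ω i ^ 2) ∂μ = ENNReal.ofReal (Fintype.card ι * v) := by
  have hi (i : ι) := integral_sq_of_map_eq_gaussianReal (μ := μ) (U := fun ω => U ω i) hv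
    (by fun_prop) (h i)
  rw [← ofReal_integral_eq_lintegral_ofReal (integrable_finsetSum _ fun i _ => (hi i).1)
      (ae_of_all _ fun ω => Finset.sum_nonneg fun i _ => sq_nonneg _),
      integral_finsetSum _ fun i _ => (hi i).1, Finset.sum_congr rfl fun i _ => (hi i).2]
  simp

/-- Combining an estimate with independent Gaussian side information of better quality. -/
theorem combined_estimate_le_klDiv {ι Ω 𝒵 𝒲 : Type*} [Fintype ι] [MeasurableSpace Ω]
    [MeasurableSpace 𝒵] [MeasurableSpace 𝒲] {μ : Measure Ω} [IsProbabilityMeasure μ]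
    {X : Ω → ι → ℝ} {Z : Ω → 𝒵} {ζ : Ω → ι → ℝ} {R : Ω → 𝒲} (hX : Measurable X)
    (hZ : Measurable Z) (hζ : Measurable ζ) (hR : Measurable R)
    (hind : IndepFun (fun ω => (X ω, Z ω)) (fun ω => (ζ ω, R ω)) μ)
    {τ : 𝒵 → ι → ℝ} (hτ : Measurable τ) {φ : 𝒵 × (ι → ℝ) × 𝒲 → ι → ℝ} (hφ : Measurable φ)
    {s σA σB d c : ℝ} (hs : 0 < s) (hσB : 0 < σB) (hAB : σB ≤ σA) (hd : 0 < d)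
    (hlaw : μ.map X = Measure.pi fun _ => gaussianReal 0 s.toNNReal)
    (hN : IndepFun (fun ω => φ (Z ω, c • τ (Z ω) + ζ ω, R ω) - X ω)
      (fun ω i => (τ (Z ω) i - X ω i) / σB - (c * τ (Z ω) i + ζ ω i - X ω i) / σA) μ)
    (hNlaw : ∀ i, μ.map (fun ω => (τ (Z ω) i - X ω i) / σB
      - (c * τ (Z ω) i + ζ ω i - X ω i) / σA) = gaussianReal 0 (1 / σB - 1 / σA).toNNReal)
    (hdist : ∫⁻ ω, ENNReal.ofReal (∑ i, (X ω i - φ (Z ω, c • τ (Z ω) + ζ ω, R ω) i) ^ 2) ∂μ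
      ≤ ENNReal.ofReal (Fintype.card ι * d)) :
    ENNReal.ofReal (Fintype.card ι * (1 / 2 * Real.log (s * (1 / d + 1 / σB - 1 / σA))))
      ≤ klDiv (μ.map fun ω => (X ω, Z ω)) ((μ.map X).prod (μ.map Z)) := by
  have hσA : 0 < σA := hσB.trans_le hAB
  have hw : 0 ≤ 1 / σB - 1 / σA := sub_nonneg.2 (one_div_le_one_div_of_le hσB hAB)
  set w := 1 / σB - 1 / σA with hwdef
  have hq : 0 < 1 / d + w := by positivity
  refine le_trans ?_ (klDiv_map_prodMk_le hX hZ (hζ.prodMk hR) hind)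
  have hlog : s * (1 / d + 1 / σB - 1 / σA) = s / (1 / (1 / d + w)) := by
    rw [hwdef]; field_simp; ring
  rw [hlog]
  -- Precision-weighted fusion: the reconstruction gets weight `1/d`, the better estimate `1/σB`,
  -- and the simulated estimate `-1/σA`, because its information is already used in the
  -- reconstruction. The total precision is `1/d + w`, with `w = 1/σB - 1/σA`.
  refine rate_distortion_le_klDiv (Z := fun ω => (Z ω, (ζ ω, R ω))) hX (by fun_prop)
    (φ := fun p i => (1 / (1 / d + w)) * (φ (p.1, c • τ p.1 + p.2.1, p.2.2) i / d
      + τ p.1 i / σB - (c * τ p.1 i + p.2.1 i) / σA)) (by fun_prop) hs (by positivity) hlaw ?_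
  -- The fused error is, up to sign, `(1/(1/d + w)) * (reconstruction error / d + N)`, with `N`
  -- independent of the reconstruction and of variance `w`. Its mean square per coordinate is
  -- therefore at most `(1/d + w) / (1/d + w)^2`.
  have herr : ∀ ω, ∑ i, (X ω i - (1 / (1 / d + w)) * (φ (Z ω, c • τ (Z ω) + ζ ω, R ω) i / d
      + τ (Z ω) i / σB - (c * τ (Z ω) i + ζ ω i) / σA)) ^ 2
      = (1 / (1 / d + w)) ^ 2 * ∑ i, ((φ (Z ω, c • τ (Z ω) + ζ ω, R ω) - X ω) i * (1 / d)
        + ((τ (Z ω) i - X ω i) / σB - (c * τ (Z ω) i + ζ ω i - X ω i) / σA)) ^ 2 := by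
    intro ω
    rw [Finset.mul_sum]
    refine Finset.sum_congr rfl fun i _ => ?_
    have hx : X ω i = (1 / (1 / d + w)) * (X ω i * (1 / d) + X ω i / σB - X ω i / σA) := by
      rw [show X ω i * (1 / d) + X ω i / σB - X ω i / σA = X ω i * (1 / d + w) by
        rw [hwdef]; ring]
      field_simp
    nth_rw 1 [hx]
    simp only [Pi.sub_apply]
    ring
  simp only [herr]
  have hE : Measurable fun ω i => (φ (Z ω, c • τ (Z ω) + ζ ω, R ω) - X ω) i * (1 / d) := by
    fun_prop
  have hNm : Measurable fun ω i => (τ (Z ω) i - X ω i) / σB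
    - (c * τ (Z ω) i + ζ ω i - X ω i) / σA := by fun_prop
  have hind' := hN.comp (φ := fun e : ι → ℝ => fun i => e i * (1 / d)) (ψ := id)
    (by fun_prop) measurable_id
  have hsum := lintegral_sum_add_sq_le hE hNm hind' hw hNlaw
  have hsc : ∀ ω, ∑ i, ((φ (Z ω, c • τ (Z ω) + ζ ω, R ω) - X ω) i * (1 / d)) ^ 2
      = (1 / d) ^ 2 * ∑ i, (X ω i - φ (Z ω, c • τ (Z ω) + ζ ω, R ω) i) ^ 2 := by
    intro ω
    rw [Finset.mul_sum]
    refine Finset.sum_congr rfl fun i _ => ?_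
    simp only [Pi.sub_apply]
    ring
  simp only [hsc] at hsum
  simp_rw [ENNReal.ofReal_mul (sq_nonneg (1 / d))] at hsum
  rw [lintegral_const_mul _ (by fun_prop)] at hsum
  simp_rw [ENNReal.ofReal_mul (sq_nonneg (1 / (1 / d + w)))]
  rw [lintegral_const_mul _ (by fun_prop)]
  calc _ ≤ ENNReal.ofReal ((1 / (1 / d + w)) ^ 2) * (ENNReal.ofReal ((1 / d) ^ 2)
        * ENNReal.ofReal (Fintype.card ι * d) + ENNReal.ofReal (Fintype.card ι * w)) := by
        gcongr
        exact hsum.trans (by gcongr)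
    _ = ENNReal.ofReal (Fintype.card ι * (1 / (1 / d + w))) := by
        rw [← ENNReal.ofReal_mul (by positivity), ← ENNReal.ofReal_add (by positivity)
          (by positivity), ← ENNReal.ofReal_mul (by positivity)]
        congr 1
        field_simp
    _ ≤ _ := le_rfl

/-- The first ratio turns the prior `N(0, s)` of `x` into `N(τ, σB)`. Together with the noise, this
makes `x` equal to the refined estimate plus an independent `N(0, σA)` error. For a fixed refined
estimate the argument of `ψ` is fixed, so the second ratio integrates to one. -/
theorem lintegral_exp_sum_gaussLogRatio_add {ι : Type*} [Fintype ι] {s σA σB d : ℝ} (hs : 0 < s)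
    (hσA : 0 < σA) (hAB : σA ≤ σB) (hd : 0 < d) (τ : ι → ℝ) {ψ : (ι → ℝ) → ι → ℝ}
    (hψ : Measurable ψ) :
    ∫⁻ ζ, ∫⁻ x, ENNReal.ofReal (Real.exp (∑ i, gaussLogRatio (τ i) σB 0 s (x i)
      + ∑ i, gaussLogRatio (ψ (fun j => (σB - σA) / σB * x j + σA / σB * τ j + ζ j) i) d
        ((σB - σA) / σB * x i + σA / σB * τ i + ζ i) σA (x i)))
      ∂(Measure.pi fun _ : ι => gaussianReal 0 s.toNNReal)
      ∂(Measure.pi fun _ : ι => gaussianReal 0 (σA * (σB - σA) / σB).toNNReal) = 1 := by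
  have hσB : 0 < σB := hσA.trans_le hAB
  set H : (ι → ℝ × ℝ) → ℝ≥0∞ := fun q => ENNReal.ofReal (Real.exp (∑ i,
    gaussLogRatio (ψ (fun j => (q j).2) i) d (q i).2 σA (q i).1)) with hH
  have hHm : Measurable H := by fun_prop
  have hstep : ∀ ζ : ι → ℝ, ∫⁻ x, ENNReal.ofReal (Real.exp (∑ i, gaussLogRatio (τ i) σB 0 s (x i)
      + ∑ i, gaussLogRatio (ψ (fun j => (σB - σA) / σB * x j + σA / σB * τ j + ζ j) i) d
        ((σB - σA) / σB * x i + σA / σB * τ i + ζ i) σA (x i)))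
      ∂(Measure.pi fun _ : ι => gaussianReal 0 s.toNNReal)
      = ∫⁻ x, H (fun i => (x i, (σB - σA) / σB * x i + σA / σB * τ i + ζ i))
        ∂(Measure.pi fun i : ι => gaussianReal (τ i) σB.toNNReal) := by
    intro ζ
    rw [← pi_gaussianReal_withDensity (m₀ := fun _ : ι => (0 : ℝ)) hσB hs,
      lintegral_withDensity_eq_lintegral_mul _ (by fun_prop) (by fun_prop)]
    refine lintegral_congr fun x => ?_
    rw [Real.exp_add, ENNReal.ofReal_mul (Real.exp_pos _).le]
    rfl
  simp_rw [hstep]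
  have hf (i : ι) : Measurable fun p : ℝ × ℝ =>
    (p.1, (σB - σA) / σB * p.1 + σA / σB * τ i + p.2) := by fun_prop
  have hf' : Measurable fun p : ℝ × ℝ => (p.1 + p.2, p.1) := by fun_prop
  rw [← lintegral_prod_symm' (μ := Measure.pi fun i : ι => gaussianReal (τ i) σB.toNNReal)
    (ν := Measure.pi fun _ : ι => gaussianReal 0 (σA * (σB - σA) / σB).toNNReal)
    (fun p : (ι → ℝ) × (ι → ℝ) => H (fun i => (p.1 i,
      (σB - σA) / σB * p.1 i + σA / σB * τ i + p.2 i))) (by fun_prop),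
    ← lintegral_map (f := H) (g := fun (p : (ι → ℝ) × (ι → ℝ)) i => (p.1 i,
      (σB - σA) / σB * p.1 i + σA / σB * τ i + p.2 i)) hHm (by fun_prop),
    pi_prod_pi_map (fun i => gaussianReal (τ i) σB.toNNReal)
      (fun _ => gaussianReal 0 (σA * (σB - σA) / σB).toNNReal) hf]
  -- The factorization is reversed here: instead of drawing `x` and then the refined estimate, one
  -- draws the refined estimate from `N(τ, σB - σA)` and adds an `N(0, σA)` error to get `x`.
  simp_rw [gaussianReal_prod_map_eq hσA hAB]
  rw [← pi_prod_pi_map (fun i => gaussianReal (τ i) (σB - σA).toNNReal)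
      (fun _ => gaussianReal 0 σA.toNNReal) (fun _ => hf'), lintegral_map hHm (by fun_prop),
      lintegral_prod _ (by fun_prop)]
  have hshift : ∀ t w : ι → ℝ, H (fun i => (t i + w i, t i)) = ENNReal.ofReal (Real.exp (∑ i,
      gaussLogRatio (ψ t i - t i) d 0 σA (w i))) := by
    intro t w
    simp only [hH, gaussLogRatio]
    congr 2
    refine Finset.sum_congr rfl fun i _ => ?_
    ring
  simp_rw [hshift, lintegral_exp_sum_gaussLogRatio (m₀ := fun _ : ι => (0 : ℝ)) hd hσA]
  simp

/-- Leakage to a user whose side information is degraded with respect to the decoder's. -/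
theorem degraded_side_information_le_klDiv {ι Ω 𝒵 𝒲 : Type*} [Fintype ι] [MeasurableSpace Ω]
    [MeasurableSpace 𝒵] [MeasurableSpace 𝒲] {μ : Measure Ω} [IsProbabilityMeasure μ]
    {X : Ω → ι → ℝ} {Z : Ω → 𝒵} {ζ : Ω → ι → ℝ} {R : Ω → 𝒲} (hX : Measurable X)
    (hZ : Measurable Z) (hζ : Measurable ζ) (hR : Measurable R)
    (hind : IndepFun (fun ω => (X ω, Z ω)) (fun ω => (ζ ω, R ω)) μ) (hζR : IndepFun ζ R μ)
    {τ : 𝒵 → ι → ℝ} (hτ : Measurable τ) {φ : 𝒵 × (ι → ℝ) × 𝒲 → ι → ℝ} (hφ : Measurable φ)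
    {s σA σB d : ℝ} (hs : 0 < s) (hσA : 0 < σA) (hAB : σA ≤ σB) (hd : 0 < d)
    (hlaw : μ.map X = Measure.pi fun _ => gaussianReal 0 s.toNNReal)
    (hζlaw : μ.map ζ = Measure.pi fun _ => gaussianReal 0 (σA * (σB - σA) / σB).toNNReal)
    (hτlaw : ∀ i, μ.map (fun ω => X ω i - τ (Z ω) i) = gaussianReal 0 σB.toNNReal)
    {T : Ω → ι → ℝ}
    (hT : ∀ ω i, T ω i = (σB - σA) / σB * X ω i + σA / σB * τ (Z ω) i + ζ ω i)
    (hTlaw : ∀ i, μ.map (fun ω => X ω i - T ω i) = gaussianReal 0 σA.toNNReal)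
    (hdist : ∫⁻ ω, ENNReal.ofReal (∑ i, (X ω i - φ (Z ω, T ω, R ω) i) ^ 2) ∂μ
      ≤ ENNReal.ofReal (Fintype.card ι * d)) :
    ENNReal.ofReal (Fintype.card ι * (1 / 2 * Real.log (s / σB) + 1 / 2 * Real.log (σA / d)))
      ≤ klDiv (μ.map fun ω => (X ω, Z ω)) ((μ.map X).prod (μ.map Z)) := by
  have hσB : 0 < σB := hσA.trans_le hAB
  have : IsProbabilityMeasure (μ.map X) := Measure.isProbabilityMeasure_map hX.aemeasurable
  have : IsProbabilityMeasure (μ.map Z) := Measure.isProbabilityMeasure_map hZ.aemeasurable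
  have : IsProbabilityMeasure (μ.map R) := Measure.isProbabilityMeasure_map hR.aemeasurable
  have : IsProbabilityMeasure (μ.map ζ) := Measure.isProbabilityMeasure_map hζ.aemeasurable
  have : IsProbabilityMeasure (μ.map fun ω => (ζ ω, R ω)) :=
    Measure.isProbabilityMeasure_map (by fun_prop)
  have : IsProbabilityMeasure (μ.map fun ω => (X ω, Z ω)) :=
    Measure.isProbabilityMeasure_map (by fun_prop)
  have hTm : Measurable T := by
    have : T = fun ω i => (σB - σA) / σB * X ω i + σA / σB * τ (Z ω) i + ζ ω i := by
      ext ω i; exact hT ω i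
    rw [this]; fun_prop
  have hX0 (i : ι) : μ.map (fun ω => X ω i - (0 : Ω → ι → ℝ) ω i) = gaussianReal 0 s.toNNReal := by
    have : (fun ω => X ω i - (0 : Ω → ι → ℝ) ω i) = Function.eval i ∘ X := by ext; simp
    rw [this, ← Measure.map_map (measurable_pi_apply i) hX, hlaw]
    exact (measurePreserving_eval (fun _ : ι => gaussianReal 0 s.toNNReal) i).map_eq
  obtain ⟨i1, e1⟩ := integral_sum_gaussLogRatio (m := fun ω => τ (Z ω)) (m₀ := 0) hX
    (by fun_prop) measurable_zero hσB hs
    (lintegral_sum_sq_of_map_eq_gaussianReal (U := fun ω i => X ω i - τ (Z ω) i) (by fun_prop)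
      hσB.le hτlaw).le hX0
  obtain ⟨i2, e2⟩ := integral_sum_gaussLogRatio (m := fun ω => φ (Z ω, T ω, R ω)) (m₀ := T) hX
    (by fun_prop) hTm hd hσA hdist hTlaw
  -- The simulation noise is adjoined to both laws at no cost, so that the test function may depend
  -- on the simulated side information.
  rw [← klDiv_prod_right _ _ (μ.map fun ω => (ζ ω, R ω))]
  set ℓ : ((ι → ℝ) × 𝒵) × ((ι → ℝ) × 𝒲) → ℝ := fun p =>
    ∑ i, gaussLogRatio (τ p.1.2 i) σB 0 s (p.1.1 i)
      + ∑ i, gaussLogRatio (φ (p.1.2, fun j => (σB - σA) / σB * p.1.1 j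
          + σA / σB * τ p.1.2 j + p.2.1 j, p.2.2) i) d
        ((σB - σA) / σB * p.1.1 i + σA / σB * τ p.1.2 i + p.2.1 i) σA (p.1.1 i) with hℓdef
  have hℓ : Measurable ℓ := by fun_prop
  have hm : AEMeasurable (fun ω => ((X ω, Z ω), (ζ ω, R ω))) μ := by fun_prop
  have hmap : (μ.map fun ω => (X ω, Z ω)).prod (μ.map fun ω => (ζ ω, R ω))
      = μ.map fun ω => ((X ω, Z ω), (ζ ω, R ω)) :=
    (hind.map_prod_eq_prod_map_map (by fun_prop) (by fun_prop)).symm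
  have hcomp : ∀ ω, ℓ ((X ω, Z ω), (ζ ω, R ω))
      = ∑ i, gaussLogRatio (τ (Z ω) i) σB ((0 : Ω → ι → ℝ) ω i) s (X ω i)
        + ∑ i, gaussLogRatio (φ (Z ω, T ω, R ω) i) d (T ω i) σA (X ω i) := by
    intro ω
    have : T ω = fun j => (σB - σA) / σB * X ω j + σA / σB * τ (Z ω) j + ζ ω j := funext (hT ω)
    rw [this]
    rfl
  refine le_trans (ENNReal.ofReal_le_ofReal ?_) (ofReal_integral_le_klDiv hℓ ?_ ?_)
  · rw [hmap, integral_map hm hℓ.aestronglyMeasurable]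
    simp_rw [hcomp]
    rw [integral_add i1 i2, mul_add]
    exact add_le_add e1 e2
  · rw [hmap, integrable_map_measure hℓ.aestronglyMeasurable hm]
    exact (i1.add i2).congr (ae_of_all _ fun ω => (hcomp ω).symm)
  · rw [lintegral_prod_symm' _ (by fun_prop),
      hζR.map_prod_eq_prod_map_map hζ.aemeasurable hR.aemeasurable,
      lintegral_prod_symm' _ (by fun_prop)]
    calc _ = ∫⁻ r, ∫⁻ ζ', ∫⁻ z, ∫⁻ x, ENNReal.ofReal (Real.exp (ℓ ((x, z), (ζ', r)))) ∂(μ.map X)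
          ∂(μ.map Z) ∂(μ.map ζ) ∂(μ.map R) := by
          refine lintegral_congr fun r => lintegral_congr fun ζ' => ?_
          rw [lintegral_prod_symm' _ (by fun_prop)]
      -- The normalization lemma needs `x` and the noise integrated jointly with `z` fixed, hence
      -- the swap.
      _ = ∫⁻ r, ∫⁻ z, ∫⁻ ζ', ∫⁻ x, ENNReal.ofReal (Real.exp (ℓ ((x, z), (ζ', r)))) ∂(μ.map X)
          ∂(μ.map ζ) ∂(μ.map Z) ∂(μ.map R) := by
          refine lintegral_congr fun r => ?_
          refine lintegral_lintegral_swap (Measurable.aemeasurable ?_)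
          exact Measurable.lintegral_prod_right' (f := fun q : ((ι → ℝ) × 𝒵) × (ι → ℝ) =>
            ENNReal.ofReal (Real.exp (ℓ ((q.2, q.1.2), (q.1.1, r))))) (by fun_prop)
      _ = ∫⁻ r, ∫⁻ z, 1 ∂(μ.map Z) ∂(μ.map R) := by
          refine lintegral_congr fun r => lintegral_congr fun z => ?_
          rw [hlaw, hζlaw]
          exact lintegral_exp_sum_gaussLogRatio_add hs hσA hAB hd (τ z)
            (ψ := fun t => φ (z, t, r)) (by fun_prop)
      _ ≤ 1 := by simp

/-! ### Linear estimation in a Gaussian source -/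

/-- `T` is the best estimate of the source symbol from the side information of the users `S`, with
error variance `σ`; what remains of the side information after subtracting `T y • l` is
independent of `T` and of the source symbol. -/
structure IsLinearEstimate {L : ℕ} (P : Measure (ℝ × (Fin L → ℝ))) (S : Finset (Fin L))
    (s σ : ℝ) (T : (S → ℝ) → ℝ) (l : S → ℝ) : Prop where
  measurable : Measurable T
  pos : 0 < σ
  le : σ ≤ s
  law_source : P.map (fun p => p.1) = gaussianReal 0 s.toNNReal
  law_error : P.map (fun p => p.1 - T (S.restrict p.2)) = gaussianReal 0 σ.toNNReal
  law_estimate : P.map (fun p => T (S.restrict p.2)) = gaussianReal 0 (s - σ).toNNReal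
  indep_error : IndepFun (fun p => S.restrict p.2) (fun p => p.1 - T (S.restrict p.2)) P
  indep_rest : IndepFun (fun p => (p.1, T (S.restrict p.2)))
    (fun p => S.restrict p.2 - T (S.restrict p.2) • l) P
  gaussian : HasGaussianLaw (fun p => (p.1, T (S.restrict p.2))) P

theorem covariance_eq_zero_of_variance_eq_zero {Ω : Type*} [MeasurableSpace Ω] {μ : Measure Ω}
    [IsProbabilityMeasure μ] {Y Z : Ω → ℝ} (hZ : MemLp Z 2 μ) (h : Var[Z; μ] = 0) :
    cov[Y, Z; μ] = 0 := by
  have hae := ae_eq_integral_of_variance_eq_zero hZ h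
  rw [covariance, integral_congr_ae (g := fun _ => (0 : ℝ)), integral_zero]
  filter_upwards [hae] with ω hω
  simp [hω]

namespace IsGaussianSource

variable {L : ℕ} {P : Measure (ℝ × (Fin L → ℝ))}

theorem hasGaussianLaw (hP : IsGaussianSource P) {E : Type*} [NormedAddCommGroup E]
    [NormedSpace ℝ E] [MeasurableSpace E] [BorelSpace E] (M : ℝ × (Fin L → ℝ) →L[ℝ] E) :
    HasGaussianLaw (fun p => M p) P := by
  have := hP.gaussian
  exact (IsGaussian.hasGaussianLaw_id (μ := P)).map_fun M

theorem hasGaussianLaw_of_eq (hP : IsGaussianSource P) {E : Type*} [NormedAddCommGroup E]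
    [NormedSpace ℝ E] [MeasurableSpace E] [BorelSpace E] (M : ℝ × (Fin L → ℝ) →L[ℝ] E)
    {f : ℝ × (Fin L → ℝ) → E} (h : ∀ p, M p = f p) : HasGaussianLaw f P :=
  (funext h : (fun p => M p) = f) ▸ hP.hasGaussianLaw M

theorem hasGaussianLaw_fst (hP : IsGaussianSource P) : HasGaussianLaw (fun p => p.1) P :=
  hP.hasGaussianLaw (ContinuousLinearMap.fst ℝ ℝ (Fin L → ℝ))

theorem hasGaussianLaw_side (hP : IsGaussianSource P) (j : Fin L) :
    HasGaussianLaw (fun p => p.2 j) P :=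
  hP.hasGaussianLaw_of_eq
    (ContinuousLinearMap.proj (R := ℝ) (φ := fun _ : Fin L => ℝ) j ∘L
      ContinuousLinearMap.snd ℝ ℝ (Fin L → ℝ)) fun _ => rfl

/-- A variable of zero variance is uncorrelated with every coordinate, so its coefficient vector
lies in the kernel of the non-singular covariance matrix. -/
theorem eq_zero_of_variance_eq_zero (hP : IsGaussianSource P) {a : ℝ} {u : Fin L → ℝ}
    (h : Var[fun p => a * p.1 + ∑ l, u l * p.2 l; P] = 0) : a = 0 ∧ u = 0 := by
  have := hP.gaussian
  have hX := hP.hasGaussianLaw_fst.memLp_two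
  have hY (l : Fin L) := (hP.hasGaussianLaw_side l).memLp_two
  have hS : MemLp (fun p : ℝ × (Fin L → ℝ) => ∑ l, u l * p.2 l) 2 P :=
    memLp_finsetSum _ fun l _ => (hY l).const_mul (u l)
  have hZ : MemLp (fun p : ℝ × (Fin L → ℝ) => a * p.1 + ∑ l, u l * p.2 l) 2 P :=
    (hX.const_mul a).add hS
  have hv : (covMatrix P).mulVec (fun o : Option (Fin L) => o.elim a u) = 0 := by
    ext j
    have hc : MemLp (fun p : ℝ × (Fin L → ℝ) => j.elim p.1 p.2) 2 P := by
      cases j with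
      | none => exact hX
      | some l => exact hY l
    have h0 := covariance_eq_zero_of_variance_eq_zero
      (Y := fun p : ℝ × (Fin L → ℝ) => j.elim p.1 p.2) hZ h
    have h1 : cov[fun p : ℝ × (Fin L → ℝ) => j.elim p.1 p.2,
        fun p => a * p.1 + ∑ l, u l * p.2 l; P]
        = a * cov[fun p : ℝ × (Fin L → ℝ) => j.elim p.1 p.2, fun p => p.1; P]
          + ∑ l, u l * cov[fun p : ℝ × (Fin L → ℝ) => j.elim p.1 p.2, fun p => p.2 l; P] := by
      rw [← covariance_const_mul_right]
      simp_rw [← covariance_const_mul_right]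
      rw [← covariance_fun_sum_right (fun l => (hY l).const_mul (u l)) hc]
      exact covariance_add_right hc (hX.const_mul a) hS
    rw [h1] at h0
    simp only [Matrix.mulVec, dotProduct, Fintype.sum_option, covMatrix, Matrix.of_apply,
      Option.elim, Pi.zero_apply]
    rw [← h0, mul_comm a]
    congr 1
    exact Finset.sum_congr rfl fun l _ => mul_comm _ _
  have hv0 := Matrix.eq_zero_of_mulVec_eq_zero hP.nonsingular hv
  exact ⟨by simpa using congrFun hv0 none, funext fun l => by simpa using congrFun hv0 (some l)⟩

theorem sum_extend (S : Finset (Fin L)) (w : S → ℝ) (y : Fin L → ℝ) :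
    ∑ l, (if h : l ∈ S then w ⟨l, h⟩ else 0) * y l = ∑ l : S, w l * y l := by
  rw [← Finset.sum_subset (Finset.subset_univ S) fun l _ hl => by simp [hl],
    ← Finset.sum_coe_sort S]
  exact Finset.sum_congr rfl fun l _ => by simp

/-- The normal equations. -/
theorem exists_coeff (hP : IsGaussianSource P) (S : Finset (Fin L)) :
    ∃ t : S → ℝ, ∀ j : S, cov[fun p => p.2 j, fun p => p.1 - ∑ l : S, t l * p.2 l; P] = 0 := by
  have := hP.gaussian
  have hX := hP.hasGaussianLaw_fst.memLp_two
  have hY (l : Fin L) := (hP.hasGaussianLaw_side l).memLp_two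
  set M : Matrix S S ℝ := Matrix.of fun j l => cov[fun p => p.2 j, fun p => p.2 l; P] with hM
  have hS (w : S → ℝ) : MemLp (fun p : ℝ × (Fin L → ℝ) => ∑ l : S, w l * p.2 l) 2 P :=
    memLp_finsetSum _ fun l _ => (hY l).const_mul (w l)
  have hcov (w : S → ℝ) (j : S) : cov[fun p => p.2 j, fun p => ∑ l : S, w l * p.2 l; P]
      = M.mulVec w j := by
    rw [covariance_fun_sum_right (fun l : S => (hY l).const_mul (w l)) (hY j)]
    simp only [Matrix.mulVec, dotProduct, hM, Matrix.of_apply, covariance_const_mul_right]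
    exact Finset.sum_congr rfl fun l _ => mul_comm _ _
  have hker : ∀ w : S → ℝ, M.mulVec w = 0 → w = 0 := by
    intro w hw
    have hvar : cov[fun p => ∑ l : S, w l * p.2 l, fun p => ∑ l : S, w l * p.2 l; P] = 0 := by
      rw [covariance_fun_sum_left (fun l : S => (hY l).const_mul (w l)) (hS w)]
      refine Finset.sum_eq_zero fun l _ => ?_
      rw [covariance_const_mul_left, hcov, hw, Pi.zero_apply, mul_zero]
    rw [covariance_self (hS w).aemeasurable] at hvar
    have h0 := hP.eq_zero_of_variance_eq_zero (a := 0)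
      (u := fun l => if h : l ∈ S then w ⟨l, h⟩ else 0) (by
        simp only [sum_extend, zero_mul, zero_add]; exact hvar)
    ext l
    simpa using congrFun h0.2 l
  have hinj : Function.Injective M.mulVec := by
    intro w w' h
    have := hker (w - w') (by rw [Matrix.mulVec_sub, h, sub_self])
    exact sub_eq_zero.1 this
  obtain ⟨t, ht⟩ := Matrix.mulVec_surjective_iff_isUnit.2 (Matrix.mulVec_injective_iff_isUnit.1 hinj)
    (fun j => cov[fun p => p.2 j, fun p => p.1; P])
  refine ⟨t, fun j => ?_⟩
  rw [covariance_fun_sub_right (hY j) hX (hS t), hcov, ht, sub_self]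

/-- Take the least-squares estimate. All the variables involved are jointly Gaussian, so each
independence claim reduces to vanishing covariances, which are the normal equations or follow from
them. -/
theorem exists_isLinearEstimate (hP : IsGaussianSource P) (S : Finset (Fin L)) :
    ∃ (σ : ℝ) (T : (S → ℝ) → ℝ) (l : S → ℝ),
      IsLinearEstimate P S (Var[fun p => p.1; P]) σ T l := by
  have := hP.gaussian
  obtain ⟨t, ht⟩ := hP.exists_coeff S
  have hXG := hP.hasGaussianLaw_fst
  have hX := hXG.memLp_two
  have hY (l : Fin L) := (hP.hasGaussianLaw_side l).memLp_two
  set T : (S → ℝ) → ℝ := fun y => ∑ l, t l * y l with hT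
  set τ : ℝ × (Fin L → ℝ) → ℝ := fun p => T (S.restrict p.2) with hτ
  set cX : ℝ × (Fin L → ℝ) →L[ℝ] ℝ := ContinuousLinearMap.fst ℝ ℝ (Fin L → ℝ)
  set cY : Fin L → ℝ × (Fin L → ℝ) →L[ℝ] ℝ := fun j =>
    ContinuousLinearMap.proj j ∘L ContinuousLinearMap.snd ℝ ℝ (Fin L → ℝ)
  set cT : ℝ × (Fin L → ℝ) →L[ℝ] ℝ := ∑ l : S, t l • cY l
  have hcT : ∀ p, cT p = τ p := fun p => by simp [cT, cY, hτ, hT]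
  have hτG : HasGaussianLaw τ P := by
    exact hP.hasGaussianLaw_of_eq cT hcT
  have hτ2 := hτG.memLp_two
  have hW2 : MemLp (fun p => p.1 - τ p) 2 P := hX.sub hτ2
  have hYW (j : S) : cov[fun p => p.2 j, fun p => p.1 - τ p; P] = 0 := ht j
  have hτW : cov[τ, fun p => p.1 - τ p; P] = 0 := by
    change cov[fun p => ∑ l : S, t l * p.2 l, fun p => p.1 - τ p; P] = 0
    rw [covariance_fun_sum_left (fun l : S => (hY l).const_mul (t l)) hW2]
    simp only [covariance_const_mul_left]
    exact Finset.sum_eq_zero fun l _ => by rw [hYW l, mul_zero]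
  have hτX : cov[τ, fun p => p.1; P] = cov[τ, τ; P] := by
    rw [covariance_fun_sub_right hτ2 hX hτ2] at hτW
    linarith
  have hXτ : cov[fun p => p.1, τ; P] = cov[τ, τ; P] := by rw [covariance_comm, hτX]
  have hττ : cov[τ, τ; P] = Var[τ; P] := covariance_self hτG.aemeasurable
  have hWvar : Var[fun p => p.1 - τ p; P] = Var[fun p => p.1; P] - Var[τ; P] := by
    rw [← covariance_self hW2.aemeasurable, covariance_fun_sub_fun_sub hX hτ2 hX hτ2, hτX, hXτ,
      hττ, covariance_self hXG.aemeasurable]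
    ring
  -- An error of zero variance would be a degenerate linear combination in which `X` has coefficient
  -- `1`.
  have hpos : 0 < Var[fun p => p.1 - τ p; P] := by
    refine lt_of_le_of_ne (variance_nonneg _ _) fun h0 => ?_
    have he : (fun p : ℝ × (Fin L → ℝ) => 1 * p.1
        + ∑ l, (if h : l ∈ S then -t ⟨l, h⟩ else 0) * p.2 l) = fun p => p.1 - τ p := by
      ext p
      rw [sum_extend S (fun l => -t l)]
      simp [hτ, hT, sub_eq_add_neg]
    have := hP.eq_zero_of_variance_eq_zero (by rw [he]; exact h0.symm)
    exact one_ne_zero this.1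
  -- These are the regression coefficients of the side information on the estimate. If the estimate
  -- is constant, division by zero gives `l = 0`, which is correct since all the covariances vanish
  -- too.
  set l : S → ℝ := fun j => cov[fun p => p.2 j, τ; P] / Var[τ; P] with hl
  have hYτ (j : S) : cov[fun p => p.2 j, τ; P] = l j * Var[τ; P] := by
    by_cases hv : Var[τ; P] = 0
    · rw [covariance_eq_zero_of_variance_eq_zero hτ2 hv, hv, mul_zero]
    · simp only [hl]; field_simp
  -- By the normal equations `Y_j` has the same covariance with `X` as with the estimate, so
  -- subtracting its regression on the estimate also decorrelates it from `X`.
  have hYX (j : S) : cov[fun p => p.2 j, fun p => p.1; P] = l j * Var[τ; P] := by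
    have := hYW j
    rw [covariance_fun_sub_right (hY j) hX hτ2, hYτ] at this
    linarith
  have hmX : ∫ p, p.1 ∂P = 0 := hP.mean_source
  have hmτ : ∫ p, τ p ∂P = 0 := by
    change ∫ p, ∑ l : S, t l * p.2 l ∂P = 0
    rw [integral_finsetSum _ fun (l : S) _ =>
      (hP.hasGaussianLaw_side l).integrable.const_mul (t l)]
    simp_rw [integral_const_mul]
    exact Finset.sum_eq_zero fun l _ => by rw [hP.mean_side, mul_zero]
  have hWG : HasGaussianLaw (fun p => p.1 - τ p) P :=
    hP.hasGaussianLaw_of_eq (cX - cT) fun p => by rw [← hcT]; rfl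
  have hTm : Measurable T := by fun_prop
  refine ⟨Var[fun p => p.1 - τ p; P], T, l, hTm, hpos, ?_, ?_, ?_, ?_, ?_, ?_, ?_⟩
  · rw [hWvar]; linarith [variance_nonneg τ P]
  · rw [hXG.map_eq_gaussianReal, hmX]
  · change P.map (fun p => p.1 - τ p) = _
    rw [hWG.map_eq_gaussianReal, integral_sub hXG.integrable hτG.integrable, hmX, hmτ, sub_zero]
  · change P.map τ = _
    rw [hτG.map_eq_gaussianReal, hmτ, hWvar]
    congr 2
    ring
  · have hG : HasGaussianLaw (fun p => (fun (j : S) => p.2 j, fun _ : Unit => p.1 - τ p)) P :=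
      hP.hasGaussianLaw_of_eq ((ContinuousLinearMap.pi fun j : S => cY j).prod
        (ContinuousLinearMap.pi fun _ : Unit => cX - cT)) fun p => by rw [← hcT]; rfl
    exact (hG.indepFun_of_covariance_eval (X := fun (j : S) p => p.2 j)
      (Y := fun _ p => p.1 - τ p) fun j _ => hYW j).comp measurable_id (measurable_pi_apply ())
  · have hG : HasGaussianLaw (fun p => (fun (i : Bool) => if i then p.1 else τ p,
        fun (j : S) => p.2 j - τ p * l j)) P :=
      hP.hasGaussianLaw_of_eq ((ContinuousLinearMap.pi fun i : Bool => if i then cX else cT).prod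
        (ContinuousLinearMap.pi fun j : S => cY j - l j • cT)) fun p => by
          refine Prod.ext (funext fun i => ?_) (funext fun j => ?_)
          · cases i
            · exact hcT p
            · rfl
          · change p.2 j - l j * cT p = p.2 j - τ p * l j
            rw [hcT, mul_comm]
    have hlm (j : S) : cov[fun p => p.1, fun p => τ p * l j; P] = Var[τ; P] * l j := by
      rw [covariance_mul_const_right, hXτ, hττ]
    have h := hG.indepFun_of_covariance_eval (X := fun (i : Bool) p => if i then p.1 else τ p)
      (Y := fun (j : S) p => p.2 j - τ p * l j) (by
        intro i j
        have hτl : MemLp (fun p => τ p * l j) 2 P := hτ2.mul_const (l j)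
        cases i with
        | true =>
          simp only [if_true]
          rw [covariance_fun_sub_right hX (hY j) hτl, covariance_comm, hYX, hlm]
          ring
        | false =>
          simp only [Bool.false_eq_true, if_false]
          rw [covariance_fun_sub_right hτ2 (hY j) hτl, covariance_comm, hYτ,
            covariance_mul_const_right, hττ]
          ring)
    exact h.comp (φ := fun q : Bool → ℝ => (q true, q false)) (by fun_prop) measurable_id
  · exact hP.hasGaussianLaw_of_eq (cX.prod cT) fun p => Prod.ext rfl (hcT p)

end IsGaussianSource

/-! ### Simulating side information -/

/-- The two hypotheses make `U`, `V`, `R` mutually independent, so they may be regrouped; it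
suffices to check boxes. -/
theorem indepFun_prodMk_of_indepFun {Ω α β γ : Type*} [MeasurableSpace Ω] [MeasurableSpace α]
    [MeasurableSpace β] [MeasurableSpace γ] {μ : Measure Ω} [IsProbabilityMeasure μ]
    {U : Ω → α} {V : Ω → β} {R : Ω → γ} (hU : Measurable U) (hV : Measurable V)
    (hR : Measurable R) (h : IndepFun (fun ω => (U ω, V ω)) R μ) (hUV : IndepFun U V μ) :
    IndepFun (fun ω => (U ω, R ω)) V μ := by
  have : IsProbabilityMeasure (μ.map V) := Measure.isProbabilityMeasure_map hV.aemeasurable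
  have : IsProbabilityMeasure (μ.map fun ω => (U ω, R ω)) :=
    Measure.isProbabilityMeasure_map (by fun_prop)
  rw [indepFun_iff_map_prod_eq_prod_map_map (by fun_prop) hV.aemeasurable,
    Measure.ext_prod₃_iff']
  intro s t u hs ht hu
  have hUR : IndepFun U R μ := h.comp measurable_fst measurable_id
  rw [Measure.map_apply (by fun_prop) ((hs.prod ht).prod hu), Measure.prod_prod,
    Measure.map_apply (by fun_prop) (hs.prod ht), Measure.map_apply hV hu]
  have h1 := h.measure_inter_preimage_eq_mul (s ×ˢ u) t (hs.prod hu) ht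
  have h2 := hUV.measure_inter_preimage_eq_mul s u hs hu
  have h3 := hUR.measure_inter_preimage_eq_mul s t hs ht
  have e1 : (fun ω => ((U ω, R ω), V ω)) ⁻¹' ((s ×ˢ t) ×ˢ u)
      = (fun ω => (U ω, V ω)) ⁻¹' (s ×ˢ u) ∩ R ⁻¹' t := by
    ext ω; simp only [Set.mem_preimage, Set.mem_prod, Set.mem_inter_iff]; tauto
  have e2 : (fun ω => (U ω, V ω)) ⁻¹' (s ×ˢ u) = U ⁻¹' s ∩ V ⁻¹' u := by
    ext ω; simp
  have e3 : (fun ω => (U ω, R ω)) ⁻¹' (s ×ˢ t) = U ⁻¹' s ∩ R ⁻¹' t := by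
    ext ω; simp
  rw [e1, h1, e2, h2, e3, h3]
  ring

variable {L : ℕ} {P : Measure (ℝ × (Fin L → ℝ))}

namespace IsLinearEstimate

variable {S : Finset (Fin L)} {s σ : ℝ} {T : (S → ℝ) → ℝ} {l : S → ℝ}

theorem map_eq (h : IsLinearEstimate P S s σ T l) :
    P.map (fun p => (p.1, T (S.restrict p.2)))
      = ((gaussianReal 0 (s - σ).toNNReal).prod (gaussianReal 0 σ.toNNReal)).map
        (fun p : ℝ × ℝ => (p.1 + p.2, p.1)) := by
  have := h.gaussian.isProbabilityMeasure
  have hT := h.measurable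
  have hm : Measurable fun p : ℝ × (Fin L → ℝ) => T (S.restrict p.2) := by fun_prop
  have hind : IndepFun (fun p => T (S.restrict p.2)) (fun p => p.1 - T (S.restrict p.2)) P :=
    h.indep_error.comp hT measurable_id
  rw [← h.law_estimate, ← h.law_error, ← hind.map_prod_eq_prod_map_map (by fun_prop) (by fun_prop),
    Measure.map_map (by fun_prop) (by fun_prop)]
  congr 1
  ext p <;> simp

theorem mean_source (h : IsLinearEstimate P S s σ T l) : ∫ p, p.1 ∂P = 0 :=
  (moments_of_map_eq_gaussianReal (by fun_prop) h.law_source).2.1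

theorem cov_source (h : IsLinearEstimate P S s σ T l) :
    cov[fun p => p.1, fun p => p.1; P] = s := by
  rw [(moments_of_map_eq_gaussianReal (by fun_prop) h.law_source).2.2,
    Real.coe_toNNReal _ (h.pos.le.trans h.le)]

theorem mean_estimate (h : IsLinearEstimate P S s σ T l) : ∫ p, T (S.restrict p.2) ∂P = 0 :=
  (moments_of_map_eq_gaussianReal h.gaussian.snd.aemeasurable h.law_estimate).2.1

theorem cov_estimate (h : IsLinearEstimate P S s σ T l) :
    cov[fun p => T (S.restrict p.2), fun p => T (S.restrict p.2); P] = s - σ := by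
  rw [(moments_of_map_eq_gaussianReal h.gaussian.snd.aemeasurable h.law_estimate).2.2,
    Real.coe_toNNReal _ (sub_nonneg.2 h.le)]

theorem cov_source_estimate (h : IsLinearEstimate P S s σ T l) :
    cov[fun p => p.1, fun p => T (S.restrict p.2); P] = s - σ := by
  have := h.gaussian.isProbabilityMeasure
  have hX := h.gaussian.fst.memLp_two
  have hT := h.gaussian.snd.memLp_two
  have hm := h.measurable
  have h0 : cov[fun p => T (S.restrict p.2), fun p => p.1 - T (S.restrict p.2); P] = 0 :=
    (h.indep_error.comp hm measurable_id).covariance_eq_zero hT (hX.sub hT)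
  rw [covariance_fun_sub_right hT hX hT, h.cov_estimate] at h0
  rw [covariance_comm]
  linarith

end IsLinearEstimate

/-- A sample of the source, extended by the independent randomness that is needed to simulate the
side information of the users `A`. -/
abbrev SimSpace (L : ℕ) (A : Finset (Fin L)) : Type := (ℝ × (Fin L → ℝ)) × (ℝ × (A → ℝ))

/-- The law of the extended sample: the noise added to the estimate has variance `v`. -/
def simLaw (P : Measure (ℝ × (Fin L → ℝ))) (A : Finset (Fin L)) (T : (A → ℝ) → ℝ) (l : A → ℝ)
    (v : ℝ) : Measure (SimSpace L A) :=
  P.prod ((gaussianReal 0 v.toNNReal).prod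
    (P.map fun p => A.restrict p.2 - T (A.restrict p.2) • l))

section Simulation

variable {A B : Finset (Fin L)} {s σA σB : ℝ} {TA : (A → ℝ) → ℝ} {lA : A → ℝ}
  {TB : (B → ℝ) → ℝ} {lB : B → ℝ} {b c v : ℝ}

/-- The simulated estimate. -/
def simEstimate (TB : (B → ℝ) → ℝ) (b c : ℝ) (ω : SimSpace L A) : ℝ :=
  b * ω.1.1 + c * TB (B.restrict ω.1.2) + ω.2.1

theorem isProbabilityMeasure_simLaw (hA : IsLinearEstimate P A s σA TA lA) :
    IsProbabilityMeasure (simLaw P A TA lA v) := by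
  have := hA.gaussian.isProbabilityMeasure
  have hT := hA.measurable
  have : IsProbabilityMeasure (P.map fun p => A.restrict p.2 - TA (A.restrict p.2) • lA) :=
    Measure.isProbabilityMeasure_map (by fun_prop)
  unfold simLaw
  infer_instance

theorem simLaw_map_fst (hA : IsLinearEstimate P A s σA TA lA) :
    (simLaw P A TA lA v).map Prod.fst = P := by
  have := hA.gaussian.isProbabilityMeasure
  have hT := hA.measurable
  have : IsProbabilityMeasure (P.map fun p => A.restrict p.2 - TA (A.restrict p.2) • lA) :=
    Measure.isProbabilityMeasure_map (by fun_prop)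
  simp [simLaw]

theorem simLaw_map_snd (hA : IsLinearEstimate P A s σA TA lA) :
    (simLaw P A TA lA v).map Prod.snd = (gaussianReal 0 v.toNNReal).prod
      (P.map fun p => A.restrict p.2 - TA (A.restrict p.2) • lA) := by
  have := hA.gaussian.isProbabilityMeasure
  have hT := hA.measurable
  have : IsProbabilityMeasure (P.map fun p => A.restrict p.2 - TA (A.restrict p.2) • lA) :=
    Measure.isProbabilityMeasure_map (by fun_prop)
  simp [simLaw]

theorem simLaw_map_noise (hA : IsLinearEstimate P A s σA TA lA) :
    (simLaw P A TA lA v).map (fun ω => ω.2.1) = gaussianReal 0 v.toNNReal := by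
  have := hA.gaussian.isProbabilityMeasure
  have hT := hA.measurable
  have : IsProbabilityMeasure (P.map fun p => A.restrict p.2 - TA (A.restrict p.2) • lA) :=
    Measure.isProbabilityMeasure_map (by fun_prop)
  rw [← Function.comp_def Prod.fst Prod.snd, ← Measure.map_map measurable_fst measurable_snd,
    simLaw_map_snd hA]
  simp

theorem simLaw_map_rest (hA : IsLinearEstimate P A s σA TA lA) :
    (simLaw P A TA lA v).map (fun ω => ω.2.2)
      = P.map fun p => A.restrict p.2 - TA (A.restrict p.2) • lA := by
  have := hA.gaussian.isProbabilityMeasure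
  have hT := hA.measurable
  have : IsProbabilityMeasure (P.map fun p => A.restrict p.2 - TA (A.restrict p.2) • lA) :=
    Measure.isProbabilityMeasure_map (by fun_prop)
  rw [← Function.comp_def Prod.snd Prod.snd, ← Measure.map_map measurable_snd measurable_snd,
    simLaw_map_snd hA]
  simp

theorem simLaw_indep (hA : IsLinearEstimate P A s σA TA lA) :
    IndepFun Prod.fst Prod.snd (simLaw P A TA lA v) := by
  have := hA.gaussian.isProbabilityMeasure
  have hT := hA.measurable
  have : IsProbabilityMeasure (P.map fun p => A.restrict p.2 - TA (A.restrict p.2) • lA) :=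
    Measure.isProbabilityMeasure_map (by fun_prop)
  exact indepFun_prod measurable_id measurable_id

theorem simLaw_indep_rest (hA : IsLinearEstimate P A s σA TA lA) :
    IndepFun (fun ω : SimSpace L A => (ω.1, ω.2.1)) (fun ω => ω.2.2)
      (simLaw P A TA lA v) := by
  have := isProbabilityMeasure_simLaw (v := v) hA
  have := hA.gaussian.isProbabilityMeasure
  have hT := hA.measurable
  have : IsProbabilityMeasure (P.map fun p => A.restrict p.2 - TA (A.restrict p.2) • lA) :=
    Measure.isProbabilityMeasure_map (by fun_prop)
  rw [indepFun_iff_map_prod_eq_prod_map_map (by fun_prop) (by fun_prop), simLaw_map_rest hA]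
  have h1 : (simLaw P A TA lA v).map (fun ω : SimSpace L A => (ω.1, ω.2.1))
      = P.prod (gaussianReal 0 v.toNNReal) := by
    have := Measure.map_prod_map P ((gaussianReal 0 v.toNNReal).prod
      (P.map fun p => A.restrict p.2 - TA (A.restrict p.2) • lA)) measurable_id measurable_fst
    simp only [Measure.map_id, Measure.map_fst_prod, measure_univ, one_smul] at this
    rw [this]
    rfl
  rw [h1, ← MeasurableEquiv.prodAssoc.map_measurableEquiv_injective.eq_iff,
    Measure.prodAssoc_prod, Measure.map_map (by fun_prop) (by fun_prop)]
  exact Measure.map_id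

theorem simLaw_indep_noise_rest (hA : IsLinearEstimate P A s σA TA lA) :
    IndepFun (fun ω : SimSpace L A => ω.2.1) (fun ω => ω.2.2) (simLaw P A TA lA v) :=
  (simLaw_indep_rest hA).comp measurable_snd measurable_id

theorem simLaw_gaussian (hA : IsLinearEstimate P A s σA TA lA)
    (hB : IsLinearEstimate P B s σB TB lB) :
    HasGaussianLaw (fun ω : SimSpace L A => ((ω.1.1, TB (B.restrict ω.1.2)), ω.2.1))
      (simLaw P A TA lA v) := by
  have hT := hB.measurable
  have := hB.gaussian.isProbabilityMeasure
  have h1 : HasGaussianLaw (fun ω : SimSpace L A => (ω.1.1, TB (B.restrict ω.1.2)))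
      (simLaw P A TA lA v) := by
    refine ⟨?_⟩
    have h2 := hB.gaussian.isGaussian_map
    rw [← simLaw_map_fst (v := v) hA, Measure.map_map (by fun_prop) measurable_fst] at h2
    exact h2
  have h2 : HasGaussianLaw (fun ω : SimSpace L A => ω.2.1) (simLaw P A TA lA v) :=
    (moments_of_map_eq_gaussianReal (by fun_prop) (simLaw_map_noise hA)).1
  exact ((simLaw_indep hA).comp (φ := fun p => (p.1, TB (B.restrict p.2))) (ψ := Prod.fst)
    (by fun_prop) measurable_fst).hasGaussianLaw h1 h2

theorem integral_simLaw_fst (hA : IsLinearEstimate P A s σA TA lA)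
    {f : ℝ × (Fin L → ℝ) → ℝ} (hf : Measurable f) :
    ∫ ω, f ω.1 ∂(simLaw P A TA lA v) = ∫ p, f p ∂P := by
  conv_rhs => rw [← simLaw_map_fst (v := v) hA]
  rw [integral_map (by fun_prop) hf.aestronglyMeasurable]

theorem covariance_simLaw_fst (hA : IsLinearEstimate P A s σA TA lA)
    {f g : ℝ × (Fin L → ℝ) → ℝ} (hf : Measurable f) (hg : Measurable g) :
    cov[fun ω => f ω.1, fun ω => g ω.1; simLaw P A TA lA v] = cov[f, g; P] := by
  conv_rhs => rw [← simLaw_map_fst (v := v) hA]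
  rw [covariance_map hf.aestronglyMeasurable hg.aestronglyMeasurable (by fun_prop)]
  rfl

/-- Both pairs are centred Gaussian, so matching second moments is enough: `hc` fits the covariance
with the source and `hvar` fits the variance of the estimate. -/
theorem simLaw_map_estimate (hA : IsLinearEstimate P A s σA TA lA)
    (hB : IsLinearEstimate P B s σB TB lB) (hv : 0 ≤ v)
    (hc : b * s + c * (s - σB) = s - σA)
    (hvar : b ^ 2 * s + 2 * b * c * (s - σB) + c ^ 2 * (s - σB) + v = s - σA) :
    (simLaw P A TA lA v).map (fun ω => (ω.1.1, simEstimate TB b c ω))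
      = P.map (fun p => (p.1, TA (A.restrict p.2))) := by
  have := isProbabilityMeasure_simLaw (v := v) hA
  have hT := hB.measurable
  have hTm : Measurable fun p : ℝ × (Fin L → ℝ) => TB (B.restrict p.2) := by fun_prop
  rw [hA.map_eq]
  refine map_prodMk_combo_eq (simLaw_gaussian hA hB).fst (by fun_prop) (r := s - σB) (m := 0)
    (simLaw_map_noise hA)
    ((simLaw_indep hA).comp (φ := fun p => (p.1, TB (B.restrict p.2))) (ψ := Prod.fst)
      (by fun_prop) measurable_fst) ?_ ?_ ?_ ?_ ?_ hv hA.pos.le hA.le (by simp) hc hvar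
  · rw [integral_simLaw_fst hA measurable_fst, hA.mean_source]
  · rw [integral_simLaw_fst hA hTm, hB.mean_estimate]
  · rw [covariance_simLaw_fst hA measurable_fst measurable_fst, hA.cov_source]
  · rw [covariance_simLaw_fst hA measurable_fst hTm, hB.cov_source_estimate]
  · rw [covariance_simLaw_fst hA hTm hTm, hB.cov_estimate]

/-- The simulated side information has the right joint law with the source symbol. -/
theorem simLaw_map_side (hA : IsLinearEstimate P A s σA TA lA)
    (hB : IsLinearEstimate P B s σB TB lB) (hv : 0 ≤ v)
    (hc : b * s + c * (s - σB) = s - σA)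
    (hvar : b ^ 2 * s + 2 * b * c * (s - σB) + c ^ 2 * (s - σB) + v = s - σA) :
    (simLaw P A TA lA v).map (fun ω => (ω.1.1, simEstimate TB b c ω • lA + ω.2.2))
      = P.map (fun p => (p.1, A.restrict p.2)) := by
  have := isProbabilityMeasure_simLaw (v := v) hA
  have := hA.gaussian.isProbabilityMeasure
  have hTA := hA.measurable
  have hTB := hB.measurable
  have hE : Measurable (simEstimate TB b c : SimSpace L A → ℝ) := by
    unfold simEstimate; fun_prop
  have hg : Measurable fun q : (ℝ × ℝ) × (A → ℝ) => (q.1.1, q.1.2 • lA + q.2) := by fun_prop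
  have h1 : IndepFun (fun ω : SimSpace L A => (ω.1.1, simEstimate TB b c ω)) (fun ω => ω.2.2)
      (simLaw P A TA lA v) :=
    (simLaw_indep_rest hA).comp (φ := fun q => (q.1.1, b * q.1.1 + c * TB (B.restrict q.1.2) + q.2))
      (by fun_prop) measurable_id
  have e1 := h1.map_prod_eq_prod_map_map (by fun_prop) (by fun_prop)
  have e2 := hA.indep_rest.map_prod_eq_prod_map_map (by fun_prop) (by fun_prop)
  -- On both sides the remainder is independent of the pair (source, estimate). The laws of the pair
  -- and of the remainder agree, so the joint laws agree, and `estimate • lA + remainder` rebuilds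
  -- the side information.
  rw [simLaw_map_estimate hA hB hv hc hvar, simLaw_map_rest hA, ← e2] at e1
  have := congrArg (Measure.map fun q : (ℝ × ℝ) × (A → ℝ) => (q.1.1, q.1.2 • lA + q.2)) e1
  rw [Measure.map_map hg (by fun_prop), Measure.map_map hg (by fun_prop)] at this
  exact this.trans (congrArg (fun h => P.map h) (funext fun p => Prod.ext rfl (by simp)))

/-- If the users `B` know more than the users `A`, then what they know in addition is Gaussian
noise around the source symbol. -/
theorem simLaw_indep_extra (hA : IsLinearEstimate P A s σA TA lA)
    (hB : IsLinearEstimate P B s σB TB lB) (hv : 0 ≤ v) (hc : c * (s - σB) = s - σA)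
    (hvar : c ^ 2 * (s - σB) + v = s - σA) :
    IndepFun (fun ω : SimSpace L A => (ω.1.1, simEstimate TB 0 c ω • lA + ω.2.2))
      (fun ω => (TB (B.restrict ω.1.2) - ω.1.1) / σB - (simEstimate TB 0 c ω - ω.1.1) / σA)
      (simLaw P A TA lA v) ∧
    (simLaw P A TA lA v).map
      (fun ω => (TB (B.restrict ω.1.2) - ω.1.1) / σB - (simEstimate TB 0 c ω - ω.1.1) / σA)
      = gaussianReal 0 (1 / σB - 1 / σA).toNNReal := by
  have := isProbabilityMeasure_simLaw (v := v) hA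
  have hTB := hB.measurable
  have hTm : Measurable fun p : ℝ × (Fin L → ℝ) => TB (B.restrict p.2) := by fun_prop
  set μ := simLaw P A TA lA v with hμ
  set X : SimSpace L A → ℝ := fun ω => ω.1.1 with hX
  set τ : SimSpace L A → ℝ := fun ω => TB (B.restrict ω.1.2) with hτ
  set ζ : SimSpace L A → ℝ := fun ω => ω.2.1 with hζ
  set E : SimSpace L A → ℝ := simEstimate TB 0 c with hE
  have hEm : Measurable E := by rw [hE]; unfold simEstimate; fun_prop
  have hG : HasGaussianLaw (fun ω => ((X ω, τ ω), ζ ω)) μ := simLaw_gaussian hA hB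
  have hX2 := hG.fst.fst.memLp_two
  have hτ2 := hG.fst.snd.memLp_two
  have hζ2 := hG.snd.memLp_two
  have hEfun : E = fun ω => c * τ ω + 1 * ζ ω := by
    ext ω; simp [hE, simEstimate, hτ, hζ]
  have hE2 : MemLp E 2 μ := by rw [hEfun]; exact (hτ2.const_mul c).add (hζ2.const_mul 1)
  have i1 : IndepFun (fun ω => (X ω, τ ω)) ζ μ :=
    (simLaw_indep hA).comp (φ := fun p => (p.1, TB (B.restrict p.2))) (ψ := Prod.fst)
      (by fun_prop) measurable_fst
  have cXζ : cov[X, ζ; μ] = 0 :=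
    (i1.comp measurable_fst measurable_id).covariance_eq_zero hX2 hζ2
  have cτζ : cov[τ, ζ; μ] = 0 :=
    (i1.comp measurable_snd measurable_id).covariance_eq_zero hτ2 hζ2
  have cζζ : cov[ζ, ζ; μ] = v := by
    rw [(moments_of_map_eq_gaussianReal (by fun_prop) (simLaw_map_noise hA)).2.2,
      Real.coe_toNNReal _ hv]
  have mζ : ∫ ω, ζ ω ∂μ = 0 :=
    (moments_of_map_eq_gaussianReal (by fun_prop) (simLaw_map_noise hA)).2.1
  have mX : ∫ ω, X ω ∂μ = 0 :=
    (integral_simLaw_fst hA measurable_fst).trans hA.mean_source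
  have mτ : ∫ ω, τ ω ∂μ = 0 :=
    (integral_simLaw_fst hA hTm).trans hB.mean_estimate
  have cXX : cov[X, X; μ] = s :=
    (covariance_simLaw_fst hA measurable_fst measurable_fst).trans hA.cov_source
  have cXτ : cov[X, τ; μ] = s - σB :=
    (covariance_simLaw_fst hA measurable_fst hTm).trans hB.cov_source_estimate
  have cττ : cov[τ, τ; μ] = s - σB :=
    (covariance_simLaw_fst hA hTm hTm).trans hB.cov_estimate
  have cζτ : cov[ζ, τ; μ] = 0 := by rw [covariance_comm, cτζ]
  have cτX : cov[τ, X; μ] = s - σB := by rw [covariance_comm, cXτ]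
  have cXE : cov[X, E; μ] = s - σA := by
    rw [hEfun, covariance_combo_right hτ2 hζ2 hX2, cXτ, cXζ]; linarith
  have cτE : cov[τ, E; μ] = s - σA := by
    rw [hEfun, covariance_combo_right hτ2 hζ2 hτ2, cττ, cτζ]; linarith
  have cζE : cov[ζ, E; μ] = v := by
    rw [hEfun, covariance_combo_right hτ2 hζ2 hζ2, cζτ, cζζ]; ring
  have cEE : cov[E, E; μ] = s - σA := by
    nth_rw 1 [hEfun]
    rw [covariance_combo_left hτ2 hζ2 hE2, cτE, cζE]
    have : c ^ 2 * (s - σB) = c * (s - σA) := by rw [← hc]; ring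
    linarith
  have cEX : cov[E, X; μ] = s - σA := by rw [covariance_comm, cXE]
  have cEτ : cov[E, τ; μ] = s - σA := by rw [covariance_comm, cτE]
  set N : SimSpace L A → ℝ := fun ω => (τ ω - X ω) / σB - (E ω - X ω) / σA with hN
  set N₁ : SimSpace L A → ℝ := fun ω => (1 / σB) * τ ω + (-(1 / σA)) * E ω with hN₁
  have hN₁2 : MemLp N₁ 2 μ := (hτ2.const_mul _).add (hE2.const_mul _)
  have hNfun : N = fun ω => 1 * N₁ ω + (1 / σA - 1 / σB) * X ω := by
    ext ω; simp only [hN, hN₁]; ring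
  have hσB := hB.pos
  have hσA := hA.pos
  have hN2 : MemLp N 2 μ := by rw [hNfun]; exact (hN₁2.const_mul _).add (hX2.const_mul _)
  -- The weights `1/σB` and `1/σA` are the ones that make `N` uncorrelated with both the source and
  -- the simulated estimate; joint Gaussianity upgrades this to independence.
  have cXN : cov[X, N; μ] = 0 := by
    rw [hNfun, covariance_combo_right hN₁2 hX2 hX2, hN₁, covariance_combo_right hτ2 hE2 hX2,
      cXτ, cXE, cXX]
    field_simp; ring
  have cEN : cov[E, N; μ] = 0 := by
    rw [hNfun, covariance_combo_right hN₁2 hX2 hE2, hN₁, covariance_combo_right hτ2 hE2 hE2,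
      cEτ, cEE, cEX]
    field_simp; ring
  have cτN : cov[τ, N; μ] = 1 - σB / σA := by
    rw [hNfun, covariance_combo_right hN₁2 hX2 hτ2, hN₁, covariance_combo_right hτ2 hE2 hτ2,
      cττ, cτE, cτX]
    field_simp; ring
  have cNN : cov[N, N; μ] = 1 / σB - 1 / σA := by
    nth_rw 1 [hNfun]
    rw [covariance_combo_left hN₁2 hX2 hN2, hN₁, covariance_combo_left hτ2 hE2 hN2, cτN, cEN, cXN]
    field_simp; ring
  have mN : ∫ ω, N ω ∂μ = 0 := by
    have hE0 : ∫ ω, E ω ∂μ = 0 := by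
      simp only [hEfun]
      rw [integral_add (hG.fst.snd.integrable.const_mul _) (hG.snd.integrable.const_mul _),
        integral_const_mul, integral_const_mul, mτ, mζ]
      ring
    have hEi : Integrable E μ := hE2.integrable (by norm_num)
    rw [hNfun, integral_add ((hN₁2.integrable (by norm_num)).const_mul _)
      (hG.fst.fst.integrable.const_mul _), integral_const_mul, integral_const_mul, mX, hN₁,
      integral_add (hG.fst.snd.integrable.const_mul _) (hEi.const_mul _),
      integral_const_mul, integral_const_mul, mτ, hE0]
    ring
  have hG2 : HasGaussianLaw (fun ω => ((X ω, E ω), N ω)) μ := by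
    set π₁ : (ℝ × ℝ) × ℝ →L[ℝ] ℝ :=
      ContinuousLinearMap.fst ℝ ℝ ℝ ∘L ContinuousLinearMap.fst ℝ (ℝ × ℝ) ℝ
    set π₂ : (ℝ × ℝ) × ℝ →L[ℝ] ℝ :=
      ContinuousLinearMap.snd ℝ ℝ ℝ ∘L ContinuousLinearMap.fst ℝ (ℝ × ℝ) ℝ
    set π₃ : (ℝ × ℝ) × ℝ →L[ℝ] ℝ := ContinuousLinearMap.snd ℝ (ℝ × ℝ) ℝ
    have h := hG.map_fun ((π₁.prod (c • π₂ + π₃)).prod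
      ((1 / σB) • (π₂ - π₁) - (1 / σA) • (c • π₂ + π₃ - π₁)))
    have he : (fun ω => ((X ω, E ω), N ω)) = fun ω => ((π₁.prod (c • π₂ + π₃)).prod
      ((1 / σB) • (π₂ - π₁) - (1 / σA) • (c • π₂ + π₃ - π₁))) ((X ω, τ ω), ζ ω) := by
      ext ω
      · rfl
      · simp [hEfun, π₁, π₂, π₃]
      · simp [hN, hEfun, π₁, π₂, π₃]; ring
    rw [he]
    exact h
  have i2 : IndepFun (fun ω => (X ω, E ω)) N μ := by
    refine hG2.indepFun_of_covariance_strongDual fun L₁ L₂ => ?_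
    obtain ⟨p, q, hL₁⟩ : ∃ p q : ℝ, ∀ x e : ℝ, L₁ (x, e) = p * x + q * e := by
      refine ⟨L₁ (1, 0), L₁ (0, 1), fun u v => ?_⟩
      have : ((u, v) : ℝ × ℝ) = u • (1, 0) + v • (0, 1) := by simp
      rw [this, map_add, map_smul, map_smul]
      simp only [smul_eq_mul]; ring
    have hL₂ : ∀ y : ℝ, L₂ y = y * L₂ 1 := fun y => by
      rw [← smul_eq_mul, ← map_smul]; simp
    have f1 : (L₁ ∘ fun ω => (X ω, E ω)) = fun ω => p * X ω + q * E ω := funext fun ω => hL₁ _ _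
    have f2 : (L₂ ∘ N) = fun ω => N ω * L₂ 1 := funext fun ω => hL₂ _
    rw [f1, f2, covariance_mul_const_right, covariance_combo_left hX2 hE2 hN2, cXN, cEN]
    ring
  have hNm : Measurable N := by fun_prop
  refine ⟨?_, ?_⟩
  · have i3 : IndepFun (fun ω => ((X ω, E ω), N ω)) (fun ω => ω.2.2) μ := by
      have := (simLaw_indep_rest (v := v) hA).comp (φ := fun q : (ℝ × (Fin L → ℝ)) × ℝ =>
        ((q.1.1, 0 * q.1.1 + c * TB (B.restrict q.1.2) + q.2),
          (TB (B.restrict q.1.2) - q.1.1) / σB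
            - (0 * q.1.1 + c * TB (B.restrict q.1.2) + q.2 - q.1.1) / σA)) (ψ := id)
        (by fun_prop) measurable_id
      exact this
    have i4 := indepFun_prodMk_of_indepFun (by fun_prop) hNm (by fun_prop) i3 i2
    exact i4.comp (φ := fun q : (ℝ × ℝ) × (A → ℝ) => (q.1.1, q.1.2 • lA + q.2)) (by fun_prop)
      measurable_id
  · rw [hG2.snd.map_eq_gaussianReal, mN, ← covariance_self hNm.aemeasurable, cNN]

end Simulation

/-! ### Blocks -/

theorem pi_map_apply {ι Ω β : Type*} [Fintype ι] [MeasurableSpace Ω]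
    [MeasurableSpace β] {μ : Measure Ω} [IsProbabilityMeasure μ] {g : Ω → β} (hg : Measurable g) :
    (Measure.pi fun _ : ι => μ).map (fun ω i => g (ω i)) = Measure.pi fun _ : ι => μ.map g := by
  have : IsProbabilityMeasure (μ.map g) := Measure.isProbabilityMeasure_map hg.aemeasurable
  exact Measure.pi_map_pi fun _ => hg.aemeasurable

theorem pi_map_congr {ι Ω Ω' β : Type*} [Fintype ι] [MeasurableSpace Ω] [MeasurableSpace Ω']
    [MeasurableSpace β] {μ : Measure Ω} {ν : Measure Ω'} [IsProbabilityMeasure μ]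
    [IsProbabilityMeasure ν] {g : Ω → β} {h : Ω' → β} (hg : Measurable g) (hh : Measurable h)
    (e : μ.map g = ν.map h) :
    (Measure.pi fun _ : ι => μ).map (fun ω i => g (ω i))
      = (Measure.pi fun _ : ι => ν).map (fun ω i => h (ω i)) := by
  rw [pi_map_apply hg, pi_map_apply hh, e]

theorem pi_map_eval {ι Ω β : Type*} [Fintype ι] [MeasurableSpace Ω]
    [MeasurableSpace β] {μ : Measure Ω} [IsProbabilityMeasure μ] {g : Ω → β} (hg : Measurable g)
    (i : ι) : (Measure.pi fun _ : ι => μ).map (fun ω => g (ω i)) = μ.map g := by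
  rw [← Function.comp_def g (fun ω : ι → Ω => ω i), ← Measure.map_map hg (by fun_prop)]
  congr 1
  exact (measurePreserving_eval (fun _ : ι => μ) i).map_eq

variable {L n K : ℕ} {P : Measure (ℝ × (Fin L → ℝ))}

theorem measurable_srcSeq : Measurable (srcSeq : Block L n → Fin n → ℝ) := by
  unfold srcSeq; fun_prop

theorem measurable_sideSeq (S : Finset (Fin L)) :
    Measurable (sideSeq S : Block L n → Fin n → (S → ℝ)) := by
  unfold sideSeq; fun_prop

/-- The information, in nats, about the source block that the message and the side information of
the users `B` carry. -/
def blockInfo (P : Measure (ℝ × (Fin L → ℝ))) (f : (Fin n → ℝ) → Fin K) (B : Finset (Fin L)) :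
    ℝ≥0∞ :=
  klDiv ((Measure.pi fun _ => P).map fun ω : Block L n => (srcSeq ω, (f (srcSeq ω), sideSeq B ω)))
    (((Measure.pi fun _ => P).map fun ω : Block L n => srcSeq ω).prod
      ((Measure.pi fun _ => P).map fun ω : Block L n => (f (srcSeq ω), sideSeq B ω)))

/-- The total square error of a decoder. -/
def blockError (P : Measure (ℝ × (Fin L → ℝ))) (f : (Fin n → ℝ) → Fin K) (A : Finset (Fin L))
    (g : Fin K × (Fin n → (A → ℝ)) → Fin n → ℝ) : ℝ≥0∞ :=
  ∫⁻ ω : Block L n, ENNReal.ofReal (∑ i, (srcSeq ω i - g (f (srcSeq ω), sideSeq A ω) i) ^ 2)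
    ∂(Measure.pi fun _ => P)

/-! ### Converse bounds for a single code, over a coupling chosen to suit `A` and `B` -/

section Converse

variable {A B : Finset (Fin L)} {s σA σB d : ℝ} {TA : (A → ℝ) → ℝ} {lA : A → ℝ}
  {TB : (B → ℝ) → ℝ} {lB : B → ℝ} {b c v : ℝ} {f : (Fin n → ℝ) → Fin K}
  {g : Fin K × (Fin n → (A → ℝ)) → Fin n → ℝ}

theorem map_srcSeq (hA : IsLinearEstimate P A s σA TA lA) :
    (Measure.pi fun _ => P).map (fun ω : Block L n => srcSeq ω)
      = Measure.pi fun _ => gaussianReal 0 s.toNNReal := by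
  have := hA.gaussian.isProbabilityMeasure
  rw [← hA.law_source]
  exact pi_map_apply measurable_fst

theorem log_card_ge (hA : IsLinearEstimate P A s σA TA lA) (hf : Measurable f) (hg : Measurable g)
    (hd : 0 < d) (herr : blockError P f A g ≤ ENNReal.ofReal (n * d)) :
    n * (1 / 2 * Real.log (σA / d)) ≤ Real.log K := by
  have := hA.gaussian.isProbabilityMeasure
  have hT := hA.measurable
  have hX : Measurable fun p : ℝ × (Fin L → ℝ) => p.1 - TA (A.restrict p.2) := by fun_prop
  have : IsProbabilityMeasure (P.map fun p => p.1 - TA (A.restrict p.2)) :=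
    Measure.isProbabilityMeasure_map hX.aemeasurable
  have h := log_card_ge_of_distortion (μ := Measure.pi fun _ : Fin n => P) (K := K)
    (X := srcSeq) (Y := sideSeq A) (t := fun y i => TA (y i)) (φ := g) measurable_srcSeq
    (measurable_sideSeq A) (by fun_prop) hf hg hA.pos hd ?_ ?_ (by simpa [blockError] using herr)
  · simpa using h
  · rw [← hA.law_error, ← Measure.pi_map_pi fun _ => hX.aemeasurable]
    rfl
  · exact indepFun_pi (by fun_prop) hX hA.indep_error

/-- Even without the message, `B` holds the estimate `TB` of the source, whose distortion is `σB`;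
the rate-distortion bound applies to it. -/
theorem blockInfo_ge (hB : IsLinearEstimate P B s σB TB lB) (hf : Measurable f) :
    ENNReal.ofReal (n * (1 / 2 * Real.log (s / σB))) ≤ blockInfo P f B := by
  have := hB.gaussian.isProbabilityMeasure
  have hT := hB.measurable
  have hsrc := measurable_srcSeq (L := L) (n := n)
  have hside := measurable_sideSeq (L := L) (n := n) B
  have hX : Measurable fun p : ℝ × (Fin L → ℝ) => p.1 - TB (B.restrict p.2) := by fun_prop
  have h := rate_distortion_le_klDiv (μ := Measure.pi fun _ : Fin n => P)
    (X := srcSeq) (Z := fun ω => (f (srcSeq ω), sideSeq B ω)) (φ := fun z i => TB (z.2 i))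
    measurable_srcSeq (by fun_prop) (by fun_prop) (hB.pos.trans_le hB.le) hB.pos (map_srcSeq hB) ?_
  · simpa [blockInfo] using h
  · refine (lintegral_sum_sq_of_map_eq_gaussianReal
      (U := fun (ω : Block L n) i => srcSeq ω i - TB (sideSeq B ω i)) ?_ hB.pos.le fun i => ?_).le
    · fun_prop
    · rw [← hB.law_error]
      exact pi_map_eval hX i

/-- The extended space keeps the original source and the original side information of `B`, so their
joint law is unchanged. -/
theorem blockInfo_eq_simLaw (hA : IsLinearEstimate P A s σA TA lA) (hf : Measurable f) :
    blockInfo P f B = klDiv ((Measure.pi fun _ : Fin n => simLaw P A TA lA v).map fun ω =>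
        (fun i => (ω i).1.1, (f fun i => (ω i).1.1, fun i => B.restrict (ω i).1.2)))
      (((Measure.pi fun _ : Fin n => simLaw P A TA lA v).map fun ω i => (ω i).1.1).prod
        ((Measure.pi fun _ : Fin n => simLaw P A TA lA v).map fun ω =>
          (f fun i => (ω i).1.1, fun i => B.restrict (ω i).1.2))) := by
  have := hA.gaussian.isProbabilityMeasure
  have := isProbabilityMeasure_simLaw (v := v) hA
  have hsrc := measurable_srcSeq (L := L) (n := n)
  have hside := measurable_sideSeq (L := L) (n := n) B
  have h : (Measure.pi fun _ : Fin n => simLaw P A TA lA v).map (fun ω i => (ω i).1)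
      = Measure.pi fun _ => P := by
    have := pi_map_congr (ι := Fin n) measurable_fst measurable_id
      ((simLaw_map_fst (v := v) hA).trans Measure.map_id.symm)
    rw [this]
    exact Measure.map_id
  unfold blockInfo
  rw [← h, Measure.map_map (by fun_prop) (by fun_prop), Measure.map_map (by fun_prop) (by fun_prop),
    Measure.map_map (by fun_prop) (by fun_prop)]
  rfl

theorem simLaw_map_source (hA : IsLinearEstimate P A s σA TA lA) :
    (Measure.pi fun _ : Fin n => simLaw P A TA lA v).map (fun ω i => (ω i).1.1)
      = Measure.pi fun _ => gaussianReal 0 s.toNNReal := by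
  have := isProbabilityMeasure_simLaw (v := v) hA
  rw [pi_map_apply (g := fun ω : SimSpace L A => ω.1.1) (by fun_prop), ← hA.law_source]
  conv_rhs => rw [← simLaw_map_fst (v := v) hA, Measure.map_map (by fun_prop) (by fun_prop)]
  rfl

/-- The error involves only the law of the source together with the side information of `A`, which
the simulation reproduces letter by letter. -/
theorem blockError_eq_simLaw (hA : IsLinearEstimate P A s σA TA lA)
    (hB : IsLinearEstimate P B s σB TB lB) (hf : Measurable f) (hg : Measurable g) (hv : 0 ≤ v)
    (hc : b * s + c * (s - σB) = s - σA)
    (hvar : b ^ 2 * s + 2 * b * c * (s - σB) + c ^ 2 * (s - σB) + v = s - σA) :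
    blockError P f A g = ∫⁻ ω, ENNReal.ofReal (∑ i, ((ω i).1.1 - g (f fun i => (ω i).1.1,
        fun i => simEstimate TB b c (ω i) • lA + (ω i).2.2) i) ^ 2)
      ∂(Measure.pi fun _ : Fin n => simLaw P A TA lA v) := by
  have := hA.gaussian.isProbabilityMeasure
  have := isProbabilityMeasure_simLaw (v := v) hA
  have hTB := hB.measurable
  have hE : Measurable (simEstimate TB b c : SimSpace L A → ℝ) := by
    unfold simEstimate; fun_prop
  have h := pi_map_congr (ι := Fin n) (by fun_prop) (by fun_prop)
    (simLaw_map_side (v := v) hA hB hv hc hvar)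
  set F : (Fin n → ℝ × (A → ℝ)) → ℝ≥0∞ := fun q => ENNReal.ofReal (∑ i, ((q i).1
    - g (f fun i => (q i).1, fun i => (q i).2) i) ^ 2) with hF
  have hFm : Measurable F := by fun_prop
  have h2 : ∫⁻ q, F q ∂_ = ∫⁻ q, F q ∂_ := congrArg (fun m => ∫⁻ q, F q ∂m) h
  rw [lintegral_map hFm (by fun_prop), lintegral_map hFm (by fun_prop)] at h2
  exact h2.symm

/-- Leakage to users who know more than the users of the decoder. -/
theorem blockInfo_ge_of_le (hA : IsLinearEstimate P A s σA TA lA)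
    (hB : IsLinearEstimate P B s σB TB lB) (hf : Measurable f) (hg : Measurable g)
    (hBA : σB ≤ σA) (hd : 0 < d) (herr : blockError P f A g ≤ ENNReal.ofReal (n * d)) :
    ENNReal.ofReal (n * (1 / 2 * Real.log (s * (1 / d + 1 / σB - 1 / σA)))) ≤ blockInfo P f B := by
  have := hA.gaussian.isProbabilityMeasure
  have hTB := hB.measurable
  -- Scaling `TB` by `c` and adding noise of variance `v` gives the moments of `TA` without using
  -- the source itself, hence `b = 0`. If `s = σB`, then also `σA = s`, and the default `c = 0`
  -- works.
  set c := (s - σA) / (s - σB) with hcdef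
  set v := (s - σA) - c ^ 2 * (s - σB) with hvdef
  have := isProbabilityMeasure_simLaw (v := v) hA
  have hsB := hB.le
  have hsA := hA.le
  have hc : c * (s - σB) = s - σA := by
    rcases eq_or_lt_of_le hsB with h | h
    · have : s - σA = 0 := by linarith
      rw [hcdef, this]; simp
    · exact div_mul_cancel₀ _ (sub_pos.2 h).ne'
  have hc1 : c ≤ 1 := div_le_one_of_le₀ (by linarith) (by linarith)
  have hv : 0 ≤ v := by
    have : c ^ 2 * (s - σB) = c * (s - σA) := by rw [← hc]; ring
    rw [hvdef, this]
    nlinarith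
  have hvar : c ^ 2 * (s - σB) + v = s - σA := by rw [hvdef]; ring
  have hE : Measurable (simEstimate TB 0 c : SimSpace L A → ℝ) := by
    unfold simEstimate; fun_prop
  obtain ⟨hi, hl⟩ := simLaw_indep_extra hA hB hv hc hvar
  have hcE : ∀ ω : SimSpace L A, simEstimate TB 0 c ω = c * TB (B.restrict ω.1.2) + ω.2.1 :=
    fun ω => by simp [simEstimate]
  rw [blockError_eq_simLaw (v := v) (b := 0) (c := c) hA hB hf hg hv (by linarith)
    (by linarith)] at herr
  rw [blockInfo_eq_simLaw (v := v) hA hf]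
  have hind : IndepFun (fun (ω : Fin n → SimSpace L A) => fun i => (ω i).1)
      (fun ω i => (ω i).2) (Measure.pi fun _ : Fin n => simLaw P A TA lA v) :=
    indepFun_pi measurable_fst measurable_snd (simLaw_indep hA)
  have h := combined_estimate_le_klDiv (μ := Measure.pi fun _ : Fin n => simLaw P A TA lA v)
    (X := fun ω i => (ω i).1.1)
    (Z := fun ω => (f fun i => (ω i).1.1, fun i => B.restrict (ω i).1.2))
    (ζ := fun ω i => (ω i).2.1) (R := fun ω i => (ω i).2.2) (by fun_prop) (by fun_prop)
    (by fun_prop) (by fun_prop)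
    (hind.comp (φ := fun q : Fin n → ℝ × (Fin L → ℝ) =>
      (fun i => (q i).1, (f fun i => (q i).1, fun i => B.restrict (q i).2)))
      (ψ := fun q : Fin n → ℝ × (A → ℝ) => (fun i => (q i).1, fun i => (q i).2))
      (by fun_prop) (by fun_prop))
    (τ := fun z i => TB (z.2 i)) (by fun_prop)
    (φ := fun q => g (q.1.1, fun i => q.2.1 i • lA + q.2.2 i)) (by fun_prop)
    (s := s) (σA := σA) (σB := σB) (d := d) (c := c) (hA.pos.trans_le hsA) hB.pos hBA hd ?_ ?_ ?_ ?_
  · simpa using h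
  · exact simLaw_map_source hA
  · have h := (indepFun_pi (ι := Fin n) (by fun_prop) (by fun_prop) hi).comp
      (φ := fun q : Fin n → ℝ × (A → ℝ) =>
        g (f fun i => (q i).1, fun i => (q i).2) - fun i => (q i).1) (ψ := id) (by fun_prop)
      measurable_id
    simp only [hcE] at h
    exact h
  · intro i
    rw [← hl]
    simp only [hcE]
    exact pi_map_eval (μ := simLaw P A TA lA v) (g := fun ω : SimSpace L A =>
      (TB (B.restrict ω.1.2) - ω.1.1) / σB - (c * TB (B.restrict ω.1.2) + ω.2.1 - ω.1.1) / σA)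
      (by fun_prop) i
  · simp only [hcE] at herr
    simpa using herr

/-- Leakage to users who know less than the users of the decoder. -/
theorem blockInfo_ge_of_ge (hA : IsLinearEstimate P A s σA TA lA)
    (hB : IsLinearEstimate P B s σB TB lB) (hf : Measurable f) (hg : Measurable g)
    (hAB : σA ≤ σB) (hd : 0 < d) (herr : blockError P f A g ≤ ENNReal.ofReal (n * d)) :
    ENNReal.ofReal (n * (1 / 2 * Real.log (s / σB) + 1 / 2 * Real.log (σA / d)))
      ≤ blockInfo P f B := by
  have := hA.gaussian.isProbabilityMeasure
  have hTB := hB.measurable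
  have hTA := hA.measurable
  have hσA := hA.pos
  have hσB := hB.pos
  -- The weights `b`, `c` and the variance `v` describe the conditional law, given the source and
  -- `TB`, of an estimate with error variance `σA` of which `TB` is a degraded version.
  set b := (σB - σA) / σB with hbdef
  set c := σA / σB with hcdef
  set v := σA * (σB - σA) / σB with hvdef
  have := isProbabilityMeasure_simLaw (v := v) hA
  have hv : 0 ≤ v := div_nonneg (mul_nonneg hσA.le (sub_nonneg.2 hAB)) hσB.le
  have hc : b * s + c * (s - σB) = s - σA := by
    rw [hbdef, hcdef]; field_simp; ring
  have hvar : b ^ 2 * s + 2 * b * c * (s - σB) + c ^ 2 * (s - σB) + v = s - σA := by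
    rw [hbdef, hcdef, hvdef]; field_simp; ring
  have hE : Measurable (simEstimate TB b c : SimSpace L A → ℝ) := by
    unfold simEstimate; fun_prop
  rw [blockError_eq_simLaw (v := v) (b := b) (c := c) hA hB hf hg hv hc hvar] at herr
  rw [blockInfo_eq_simLaw (v := v) hA hf]
  have hind : IndepFun (fun (ω : Fin n → SimSpace L A) => fun i => (ω i).1)
      (fun ω i => (ω i).2) (Measure.pi fun _ : Fin n => simLaw P A TA lA v) :=
    indepFun_pi measurable_fst measurable_snd (simLaw_indep hA)
  have h := degraded_side_information_le_klDiv
    (μ := Measure.pi fun _ : Fin n => simLaw P A TA lA v)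
    (X := fun ω i => (ω i).1.1)
    (Z := fun ω => (f fun i => (ω i).1.1, fun i => B.restrict (ω i).1.2))
    (ζ := fun ω i => (ω i).2.1) (R := fun ω i => (ω i).2.2) (by fun_prop) (by fun_prop)
    (by fun_prop) (by fun_prop)
    (hind.comp (φ := fun q : Fin n → ℝ × (Fin L → ℝ) =>
      (fun i => (q i).1, (f fun i => (q i).1, fun i => B.restrict (q i).2)))
      (ψ := fun q : Fin n → ℝ × (A → ℝ) => (fun i => (q i).1, fun i => (q i).2))
      (by fun_prop) (by fun_prop))
    (indepFun_pi (by fun_prop) (by fun_prop) (simLaw_indep_noise_rest hA))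
    (τ := fun z i => TB (z.2 i)) (by fun_prop)
    (φ := fun q => g (q.1.1, fun i => q.2.1 i • lA + q.2.2 i)) (by fun_prop)
    (s := s) (σA := σA) (σB := σB) (d := d) (hA.pos.trans_le hA.le) hσA hAB hd ?_ ?_ ?_
    (T := fun ω i => simEstimate TB b c (ω i)) (fun ω i => rfl) ?_ (by simpa using herr)
  · simpa using h
  · exact simLaw_map_source hA
  · rw [← simLaw_map_noise (v := v) hA]
    exact pi_map_apply (μ := simLaw P A TA lA v) (g := fun ω : SimSpace L A => ω.2.1)
      (by fun_prop)
  · intro i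
    rw [← hB.law_error]
    conv_rhs => rw [← simLaw_map_fst (v := v) hA, Measure.map_map (by fun_prop) (by fun_prop)]
    exact pi_map_eval (μ := simLaw P A TA lA v) (g := fun ω : SimSpace L A =>
      ω.1.1 - TB (B.restrict ω.1.2)) (by fun_prop) i
  · intro i
    rw [← hA.law_error, pi_map_eval (μ := simLaw P A TA lA v) (g := fun ω : SimSpace L A =>
      ω.1.1 - simEstimate TB b c ω) (by fun_prop) i]
    have h := congrArg (Measure.map fun q : ℝ × ℝ => q.1 - q.2)
      (simLaw_map_estimate hA hB hv hc hvar)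
    rw [Measure.map_map (by fun_prop) (by fun_prop), Measure.map_map (by fun_prop)
      (by fun_prop)] at h
    exact h

end Converse

/-! ### Passage to the limit -/

section Limit

open Topology

variable {L : ℕ} {P : Measure (ℝ × (Fin L → ℝ))} {𝔸 : Set (Finset (Fin L))} {R D Δ : ℝ}

theorem SourceCode.measurable_decode {n : ℕ} (c : SourceCode 𝔸 R n) (A : 𝔸) :
    Measurable fun ω : Block L n => c.dec A (c.enc (srcSeq ω), sideSeq A.1 ω) := by
  have h1 := measurable_srcSeq (L := L) (n := n)
  have h2 := measurable_sideSeq (L := L) (n := n) A.1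
  have h3 := c.measurable_enc
  have h4 := c.measurable_dec A
  fun_prop

theorem SourceCode.blockError_le {n : ℕ} (hn : 0 < n) {c : SourceCode 𝔸 R n} {A : 𝔸} {d : ℝ}
    (h : c.distortion P A ≤ ENNReal.ofReal d) :
    blockError P c.enc A.1 (c.dec A) ≤ ENNReal.ofReal (n * d) := by
  have hn' : (0 : ℝ) < n := by exact_mod_cast hn
  have h1 := measurable_srcSeq (L := L) (n := n)
  have h2 := c.measurable_decode A
  have e : blockError P c.enc A.1 (c.dec A) = ENNReal.ofReal n * c.distortion P A := by
    unfold blockError SourceCode.distortion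
    rw [← lintegral_const_mul _ (by fun_prop)]
    refine lintegral_congr fun ω => ?_
    rw [← ENNReal.ofReal_mul hn'.le]
    congr 1
    field_simp
  rw [e, ENNReal.ofReal_mul hn'.le]
  gcongr

theorem eventually_blockError_le {c : (n : ℕ) → SourceCode 𝔸 R n} {A : 𝔸} (hD : 0 < D)
    (h : limsup (fun n => (c n).distortion P A) atTop ≤ ENNReal.ofReal D) {d : ℝ} (hd : D < d) :
    ∀ᶠ n : ℕ in atTop, 0 < n ∧
      blockError P (c n).enc A.1 ((c n).dec A) ≤ ENNReal.ofReal (n * d) := by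
  have h1 : limsup (fun n => (c n).distortion P A) atTop < ENNReal.ofReal d :=
    h.trans_lt ((ENNReal.ofReal_lt_ofReal_iff (hD.trans hd)).2 hd)
  filter_upwards [eventually_lt_of_limsup_lt h1, eventually_gt_atTop 0] with n hn hn0
  exact ⟨hn0, SourceCode.blockError_le hn0 hn.le⟩

theorem le_of_limsup_leakage_le {c : (n : ℕ) → SourceCode 𝔸 R n} {B : Finset (Fin L)}
    (hΔ : 0 ≤ Δ) (h : limsup (fun n => (c n).leakage P B) atTop ≤ ENNReal.ofReal Δ) {a : ℝ}
    (ha : ∀ᶠ n : ℕ in atTop, 0 < n ∧ ENNReal.ofReal (n * a) ≤ blockInfo P (c n).enc B) :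
    a ≤ Δ * Real.log 2 := by
  have hlog : 0 < Real.log 2 := Real.log_pos one_lt_two
  have h1 : ENNReal.ofReal (a / Real.log 2) ≤ limsup (fun n => (c n).leakage P B) atTop := by
    refine le_limsup_of_frequently_le (Eventually.frequently ?_)
    filter_upwards [ha] with n hn
    have hn0 : (0 : ℝ) < n := by exact_mod_cast hn.1
    have : a / Real.log 2 = n * a / Real.log 2 / n := by field_simp
    rw [this, ENNReal.ofReal_div_of_pos hn0, ENNReal.ofReal_div_of_pos hlog,
      ENNReal.ofReal_natCast]
    unfold SourceCode.leakage mutualInfo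
    gcongr
    exact hn.2
  have h2 := (ENNReal.ofReal_le_ofReal_iff hΔ).1 (h1.trans h)
  rwa [div_le_iff₀ hlog] at h2

/-- The limsup condition bounds the distortion only by each `d > D`, eventually in `n`; continuity
of the bounds lets `d` decrease to `D`. -/
theorem le_of_forall_gt_of_continuousAt {F : ℝ → ℝ} {a : ℝ} (hF : ContinuousAt F D)
    (h : ∀ d, D < d → F d ≤ a) : F D ≤ a :=
  le_of_tendsto (hF.tendsto.mono_left nhdsWithin_le_nhds)
    (eventually_nhdsWithin_of_forall (s := Set.Ioi D) h)

theorem le_leakage_of_forall {c : (n : ℕ) → SourceCode 𝔸 R n} {A : 𝔸} {B : Finset (Fin L)}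
    (hD : 0 < D) (hΔ : 0 ≤ Δ)
    (hdist : limsup (fun n => (c n).distortion P A) atTop ≤ ENNReal.ofReal D)
    (hleak : limsup (fun n => (c n).leakage P B) atTop ≤ ENNReal.ofReal Δ) {F : ℝ → ℝ}
    (hF : ContinuousAt F D)
    (h : ∀ d, D < d → ∀ n : ℕ, blockError P (c n).enc A.1 ((c n).dec A) ≤ ENNReal.ofReal (n * d) →
      ENNReal.ofReal (n * F d) ≤ blockInfo P (c n).enc B) :
    F D ≤ Δ * Real.log 2 :=
  le_of_forall_gt_of_continuousAt hF fun d hd => le_of_limsup_leakage_le hΔ hleak <| by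
    filter_upwards [eventually_blockError_le hD hdist hd] with n hn
    exact ⟨hn.1, h d hd n hn.2⟩

/-- Since `2 ^ x ≥ 1`, rounding up at most doubles it. The extra bit disappears after division by
the block length. -/
theorem log_ceil_two_rpow_le {x : ℝ} (hx : 0 ≤ x) :
    Real.log (⌈(2 : ℝ) ^ x⌉₊ : ℝ) ≤ Real.log 2 + x * Real.log 2 := by
  have h1 : (1 : ℝ) ≤ 2 ^ x := Real.one_le_rpow one_le_two hx
  have h2 : (⌈(2 : ℝ) ^ x⌉₊ : ℝ) ≤ 2 * 2 ^ x := by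
    have := Nat.ceil_lt_add_one (zero_le_one.trans h1)
    linarith
  have h3 : (0 : ℝ) < ⌈(2 : ℝ) ^ x⌉₊ := by
    have := Nat.le_ceil ((2 : ℝ) ^ x)
    linarith
  calc _ ≤ Real.log (2 * 2 ^ x) := Real.log_le_log h3 h2
    _ = _ := by
      rw [Real.log_mul two_ne_zero (by positivity), Real.log_rpow two_pos]

variable {s σA σB : ℝ} {A : 𝔸} {B : Finset (Fin L)} {TA : (A.1 → ℝ) → ℝ} {lA : A.1 → ℝ}
  {TB : (B → ℝ) → ℝ} {lB : B → ℝ} {c : (n : ℕ) → SourceCode 𝔸 R n}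

theorem rate_ge (hA : IsLinearEstimate P A.1 s σA TA lA) (hD : 0 < D) (hR : 0 ≤ R)
    (hdist : limsup (fun n => (c n).distortion P A) atTop ≤ ENNReal.ofReal D) :
    1 / 2 * Real.log (σA / D) ≤ R * Real.log 2 := by
  have hσA := hA.pos
  refine le_of_forall_gt_of_continuousAt (F := fun d => 1 / 2 * Real.log (σA / d)) ?_
    fun d hd => ?_
  · exact continuousAt_const.mul ((continuousAt_const.div continuousAt_id hD.ne').log
      (div_pos hσA hD).ne')
  · have hlim : Tendsto (fun n : ℕ => Real.log 2 / n + R * Real.log 2) atTop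
        (𝓝 (0 + R * Real.log 2)) :=
      (tendsto_const_div_atTop_nhds_zero_nat _).add_const _
    rw [zero_add] at hlim
    refine ge_of_tendsto hlim ?_
    filter_upwards [eventually_blockError_le hD hdist hd] with n hn
    have h1 := log_card_ge hA (c n).measurable_enc ((c n).measurable_dec A) (hD.trans hd) hn.2
    have hn0 : (0 : ℝ) < n := by exact_mod_cast hn.1
    have h2 := h1.trans (log_ceil_two_rpow_le (mul_nonneg hn0.le hR))
    rw [show Real.log 2 / n + R * Real.log 2 = (Real.log 2 + n * R * Real.log 2) / n by
      field_simp, le_div_iff₀ hn0]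
    linarith

theorem leakage_ge (hB : IsLinearEstimate P B s σB TB lB) (hΔ : 0 ≤ Δ)
    (hleak : limsup (fun n => (c n).leakage P B) atTop ≤ ENNReal.ofReal Δ) :
    1 / 2 * Real.log (s / σB) ≤ Δ * Real.log 2 :=
  le_of_limsup_leakage_le hΔ hleak <| by
    filter_upwards [eventually_gt_atTop 0] with n hn
    exact ⟨hn, blockInfo_ge hB (c n).measurable_enc⟩

theorem leakage_ge_of_le (hA : IsLinearEstimate P A.1 s σA TA lA)
    (hB : IsLinearEstimate P B s σB TB lB) (hBA : σB ≤ σA) (hD : 0 < D) (hΔ : 0 ≤ Δ)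
    (hdist : limsup (fun n => (c n).distortion P A) atTop ≤ ENNReal.ofReal D)
    (hleak : limsup (fun n => (c n).leakage P B) atTop ≤ ENNReal.ofReal Δ) :
    1 / 2 * Real.log (s * (1 / D + 1 / σB - 1 / σA)) ≤ Δ * Real.log 2 := by
  have hσB := hB.pos
  have hs := hσB.trans_le hB.le
  refine le_leakage_of_forall (F := fun d => 1 / 2 * Real.log (s * (1 / d + 1 / σB - 1 / σA)))
    hD hΔ hdist hleak ?_ fun d hd n hn => blockInfo_ge_of_le hA hB (c n).measurable_enc
      ((c n).measurable_dec A) hBA (hD.trans hd) hn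
  have h1 : 0 < 1 / D + (1 / σB - 1 / σA) :=
    add_pos_of_pos_of_nonneg (by positivity) (sub_nonneg.2 (one_div_le_one_div_of_le hσB hBA))
  have h2 : ContinuousAt (fun d : ℝ => 1 / d + 1 / σB - 1 / σA) D :=
    ((continuousAt_const.div continuousAt_id hD.ne').add continuousAt_const).sub
      continuousAt_const
  refine continuousAt_const.mul ((continuousAt_const.mul h2).log ?_)
  change s * (1 / D + 1 / σB - 1 / σA) ≠ 0
  rw [add_sub_assoc]
  positivity

theorem leakage_ge_of_ge (hA : IsLinearEstimate P A.1 s σA TA lA)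
    (hB : IsLinearEstimate P B s σB TB lB) (hAB : σA ≤ σB) (hD : 0 < D) (hΔ : 0 ≤ Δ)
    (hdist : limsup (fun n => (c n).distortion P A) atTop ≤ ENNReal.ofReal D)
    (hleak : limsup (fun n => (c n).leakage P B) atTop ≤ ENNReal.ofReal Δ) :
    1 / 2 * Real.log (s / σB) + 1 / 2 * Real.log (σA / D) ≤ Δ * Real.log 2 := by
  have hσA := hA.pos
  refine le_leakage_of_forall
    (F := fun d => 1 / 2 * Real.log (s / σB) + 1 / 2 * Real.log (σA / d))
    hD hΔ hdist hleak ?_ fun d hd n hn => blockInfo_ge_of_ge hA hB (c n).measurable_enc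
      ((c n).measurable_dec A) hAB (hD.trans hd) hn
  exact continuousAt_const.add (continuousAt_const.mul
    ((continuousAt_const.div continuousAt_id hD.ne').log (div_pos hσA hD).ne'))

end Limit

/-! ### Gaussian conditional laws -/

/-- Given `Y`, the conditional law of `X` is the Gaussian law with mean `τ Y` and variance `v`. -/
structure IsGaussianGiven {Ω 𝒴 : Type*} [MeasurableSpace Ω] [MeasurableSpace 𝒴] (μ : Measure Ω)
    (X : Ω → ℝ) (Y : Ω → 𝒴) (τ : 𝒴 → ℝ) (v : ℝ) : Prop where
  measurable_left : Measurable X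
  measurable_right : Measurable Y
  measurable_mean : Measurable τ
  pos : 0 < v
  indep : IndepFun Y (fun ω => X ω - τ (Y ω)) μ
  law : μ.map (fun ω => X ω - τ (Y ω)) = gaussianReal 0 v.toNNReal

/-- The Gaussian kernel with mean `τ` and variance `v`. -/
def gaussKernel {𝒴 : Type*} [MeasurableSpace 𝒴] (τ : 𝒴 → ℝ) (v : ℝ) : Kernel 𝒴 ℝ :=
  (Kernel.id ×ₖ Kernel.const 𝒴 (gaussianReal 0 v.toNNReal)).map fun p => τ p.1 + p.2

theorem gaussKernel_apply {𝒴 : Type*} [MeasurableSpace 𝒴] {τ : 𝒴 → ℝ} (hτ : Measurable τ) (v : ℝ)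
    (y : 𝒴) : gaussKernel τ v y = gaussianReal (τ y) v.toNNReal := by
  rw [gaussKernel, Kernel.map_apply _ (by fun_prop), Kernel.prod_apply, Kernel.id_apply,
    Kernel.const_apply, Measure.dirac_prod, Measure.map_map (by fun_prop) (by fun_prop)]
  have := gaussianReal_map_const_add (μ := 0) (v := v.toNNReal) (τ y)
  rw [zero_add] at this
  exact this

instance {𝒴 : Type*} [MeasurableSpace 𝒴] (τ : 𝒴 → ℝ) (v : ℝ) :
    IsFiniteKernel (gaussKernel τ v) := by
  unfold gaussKernel; infer_instance

namespace IsGaussianGiven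

variable {Ω 𝒴 γ : Type*} [MeasurableSpace Ω] [MeasurableSpace 𝒴] [MeasurableSpace γ]
  {μ : Measure Ω} [IsProbabilityMeasure μ]
  {X : Ω → ℝ} {Y : Ω → 𝒴} {Z : Ω → γ} {τ : 𝒴 → ℝ} {v : ℝ}

theorem lintegral_eq (h : IsGaussianGiven μ X Y τ v) {F : 𝒴 × ℝ → ℝ≥0∞} (hF : Measurable F) :
    ∫⁻ ω, F (Y ω, X ω) ∂μ
      = ∫⁻ y, ∫⁻ x, F (y, x) ∂(gaussianReal (τ y) v.toNNReal) ∂(μ.map Y) := by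
  have hX := h.measurable_left
  have hY := h.measurable_right
  have hτ := h.measurable_mean
  have := lintegral_prodMk_of_indepFun hY (by fun_prop) h.indep
    (F := fun p => F (p.1, τ p.1 + p.2)) (by fun_prop)
  simp only [add_sub_cancel] at this
  rw [this, h.law]
  refine lintegral_congr fun y => ?_
  have e := gaussianReal_map_const_add (μ := 0) (v := v.toNNReal) (τ y)
  rw [zero_add] at e
  rw [← e, lintegral_map (by fun_prop) (by fun_prop)]

/-- Conditional laws are unique almost everywhere, and an error independent of `Y` makes the shifted
Gaussian kernel a version. No Gaussianity of `Y` is involved. -/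
theorem condDistrib_ae_eq (h : IsGaussianGiven μ X Y τ v) :
    condDistrib X Y μ =ᵐ[μ.map Y] gaussKernel τ v := by
  have hX := h.measurable_left
  have hY := h.measurable_right
  refine condDistrib_ae_eq_of_measure_eq_compProd_of_measurable hY hX ?_
  refine Measure.ext_of_lintegral _ fun F hF => ?_
  rw [lintegral_map hF (by fun_prop), h.lintegral_eq hF, Measure.lintegral_compProd hF]
  simp_rw [gaussKernel_apply h.measurable_mean]

/-- The observation may be coarsened or repackaged as long as the conditional mean remains a
function of it. -/
theorem of_comp (h : IsGaussianGiven μ X Y τ v) {φ : 𝒴 → γ} (hφ : Measurable φ) {τ' : γ → ℝ}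
    (hτ' : Measurable τ') (e : ∀ ω, τ' (φ (Y ω)) = τ (Y ω)) :
    IsGaussianGiven μ X (fun ω => φ (Y ω)) τ' v where
  measurable_left := h.measurable_left
  measurable_right := hφ.comp h.measurable_right
  measurable_mean := hτ'
  pos := h.pos
  indep := by simp only [e]; exact h.indep.comp hφ measurable_id
  law := by simp only [e]; exact h.law

/-- Used to carry statements about the source over to a space enlarged by independent noise. -/
theorem of_map {Ω' : Type*} [MeasurableSpace Ω'] {ν : Measure Ω'} [IsProbabilityMeasure ν]
    {π : Ω' → Ω} (hπ : Measurable π) (hν : ν.map π = μ) (h : IsGaussianGiven μ X Y τ v) :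
    IsGaussianGiven ν (fun ω => X (π ω)) (fun ω => Y (π ω)) τ v where
  measurable_left := h.measurable_left.comp hπ
  measurable_right := h.measurable_right.comp hπ
  measurable_mean := h.measurable_mean
  pos := h.pos
  indep := by
    have hX := h.measurable_left
    have hY := h.measurable_right
    have hτ := h.measurable_mean
    have hi := h.indep
    rw [indepFun_iff_map_prod_eq_prod_map_map (by fun_prop) (by fun_prop), ← hν,
      Measure.map_map (by fun_prop) hπ, Measure.map_map (by fun_prop) hπ,
      Measure.map_map (by fun_prop) hπ] at hi
    exact (indepFun_iff_map_prod_eq_prod_map_map (by fun_prop) (by fun_prop)).2 hi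
  law := by
    have hX := h.measurable_left
    have hY := h.measurable_right
    have hτ := h.measurable_mean
    rw [← h.law, ← hν, Measure.map_map (by fun_prop) hπ]
    rfl

/-- The conditional mean is `τ (Y ω)`, because the remaining error is independent of `Y` and
centred. The mean conditional variance is thus the second moment of the error. -/
theorem integral_condVar (h : IsGaussianGiven μ X Y τ v) (hi : Integrable X μ) :
    ∫ ω, (condVar (MeasurableSpace.comap Y inferInstance) X μ) ω ∂μ = v := by
  have hX := h.measurable_left
  have hY := h.measurable_right
  have hτ := h.measurable_mean
  have hW : Measurable fun ω => X ω - τ (Y ω) := by fun_prop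
  obtain ⟨gW, mW, -⟩ := moments_of_map_eq_gaussianReal hW.aemeasurable h.law
  have iτ : Integrable (fun ω => τ (Y ω)) μ :=
    (hi.sub gW.integrable).congr (ae_of_all _ fun ω => by simp)
  have hm : MeasurableSpace.comap Y inferInstance ≤ _ := hY.comap_le
  have h1 := condExp_indep_eq (f := fun ω => X ω - τ (Y ω)) hW.comap_le hm
    (comap_measurable _).stronglyMeasurable h.indep.symm
  have h2 : μ[fun ω => τ (Y ω) | MeasurableSpace.comap Y inferInstance] = fun ω => τ (Y ω) :=
    condExp_of_stronglyMeasurable hm (hτ.comp (comap_measurable Y)).stronglyMeasurable iτ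
  have h3 := condExp_add gW.integrable iτ (MeasurableSpace.comap Y inferInstance)
  have h4 : (fun ω => (X ω - τ (Y ω))) + (fun ω => τ (Y ω)) = X := by ext; simp
  rw [h4, h2] at h3
  rw [condVar, integral_condExp hm,
    ← (integral_sq_of_map_eq_gaussianReal h.pos.le hW.aemeasurable h.law).2]
  refine integral_congr_ae ?_
  filter_upwards [h1, h3] with ω h1 h3
  simp only [Pi.pow_apply, Pi.sub_apply, h3, Pi.add_apply, h1, mW, zero_add]

/-- The law of a Gaussian variable after observing a noisy version of it. -/
theorem add_noise (h : IsGaussianGiven μ X Y τ v) {N : Ω → ℝ} (hN : Measurable N) {w : ℝ}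
    (hw : 0 < w) (hNl : μ.map N = gaussianReal 0 w.toNNReal)
    (hi : IndepFun (fun ω => (X ω, Y ω)) N μ) :
    IsGaussianGiven μ X (fun ω => (X ω + N ω, Y ω))
      (fun p => (τ p.2 / v + p.1 / w) / (1 / v + 1 / w)) (1 / (1 / v + 1 / w)) ∧
    IsGaussianGiven μ (fun ω => X ω + N ω) Y τ (v + w) ∧
    IsGaussianGiven μ (fun ω => X ω + N ω) (fun ω => (Y ω, X ω)) (fun p => p.2) w := by
  have hX := h.measurable_left
  have hY := h.measurable_right
  have hτ := h.measurable_mean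
  have hv := h.pos
  set W : Ω → ℝ := fun ω => X ω - τ (Y ω) with hW
  have hWm : Measurable W := by fun_prop
  obtain ⟨gW, mW, vW⟩ := moments_of_map_eq_gaussianReal hWm.aemeasurable h.law
  obtain ⟨gN, mN, vN⟩ := moments_of_map_eq_gaussianReal hN.aemeasurable hNl
  rw [Real.coe_toNNReal _ hv.le] at vW
  rw [Real.coe_toNNReal _ hw.le] at vN
  have iWYN : IndepFun (fun ω => (W ω, Y ω)) N μ :=
    hi.comp (φ := fun p => (p.1 - τ p.2, p.2)) (by fun_prop) measurable_id
  have iWN : IndepFun W N μ := iWYN.comp measurable_fst measurable_id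
  have iWNY := indepFun_prodMk_of_indepFun hWm hY hN iWYN h.indep.symm
  have g2 : HasGaussianLaw (fun ω => (W ω, N ω)) μ := iWN.hasGaussianLaw gW gN
  have hW2 := gW.memLp_two
  have hN2 := gN.memLp_two
  have cWN : cov[W, N; μ] = 0 := iWN.covariance_eq_zero hW2 hN2
  have cNW : cov[N, W; μ] = 0 := by rw [covariance_comm, cWN]
  set q := 1 / (1 / v + 1 / w) with hq
  set S : Ω → ℝ := fun ω => 1 * W ω + 1 * N ω with hS
  -- `E` is the error after observing `S = W + N` and weighting by precisions. It is uncorrelated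
  -- with `S`, hence independent of it, and its variance `q` is the inverse of the summed
  -- precisions.
  set E : Ω → ℝ := fun ω => (q / v) * W ω + (-(q / w)) * N ω with hE
  have hS2 : MemLp S 2 μ := (hW2.const_mul _).add (hN2.const_mul _)
  have hE2 : MemLp E 2 μ := (hW2.const_mul _).add (hN2.const_mul _)
  have g3 : HasGaussianLaw (fun ω => (S ω, E ω)) μ := by
    have := g2.map_fun (((ContinuousLinearMap.fst ℝ ℝ ℝ) + ContinuousLinearMap.snd ℝ ℝ ℝ).prod
      ((q / v) • (ContinuousLinearMap.fst ℝ ℝ ℝ) + (-(q / w)) • ContinuousLinearMap.snd ℝ ℝ ℝ))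
    simpa [hS, hE] using this
  have cWE : cov[W, E; μ] = q := by
    rw [hE, covariance_combo_right hW2 hN2 hW2, vW, cWN]; field_simp; ring
  have cNE : cov[N, E; μ] = -q := by
    rw [hE, covariance_combo_right hW2 hN2 hN2, vN, cNW]; field_simp; ring
  have cSE : cov[S, E; μ] = 0 := by
    rw [hS, covariance_combo_left hW2 hN2 hE2, cWE, cNE]; ring
  have cEE : cov[E, E; μ] = q := by
    nth_rw 1 [hE]
    rw [covariance_combo_left hW2 hN2 hE2, cWE, cNE, hq]; field_simp
  have cSS : cov[S, S; μ] = v + w := by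
    rw [hS, covariance_combo_left hW2 hN2 hS2, hS, covariance_combo_right hW2 hN2 hW2,
      covariance_combo_right hW2 hN2 hN2, vW, vN, cWN, cNW]; ring
  have mS : ∫ ω, S ω ∂μ = 0 := by rw [hS, g2.integral_combo, mW, mN]; simp
  have mE : ∫ ω, E ω ∂μ = 0 := by rw [hE, g2.integral_combo, mW, mN]; simp
  have hSm : Measurable S := by fun_prop
  have hEm : Measurable E := by fun_prop
  have iSE : IndepFun S E μ := g3.indepFun_of_covariance_eq_zero cSE
  have iSEY : IndepFun (fun ω => (S ω, E ω)) Y μ :=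
    iWNY.comp (φ := fun p => (1 * p.1 + 1 * p.2, (q / v) * p.1 + (-(q / w)) * p.2))
      (by fun_prop) measurable_id
  have iSYE := indepFun_prodMk_of_indepFun hSm hEm hY iSEY iSE
  have hq0 : 0 < q := by positivity
  have eE : (fun ω => X ω - (τ (Y ω) / v + (X ω + N ω) / w) / (1 / v + 1 / w)) = E := by
    ext ω
    simp only [hE, hW, hq]
    field_simp
    ring
  have eS : (fun ω => X ω + N ω - τ (Y ω)) = S := by
    ext ω
    simp only [hS, hW]
    ring
  refine ⟨⟨hX, by fun_prop, by fun_prop, hq0, ?_, ?_⟩, ⟨by fun_prop, hY, hτ, by positivity, ?_, ?_⟩,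
    ⟨by fun_prop, by fun_prop, by fun_prop, hw, ?_, ?_⟩⟩
  · rw [eE]
    have := iSYE.comp (φ := fun p : ℝ × 𝒴 => (p.1 + τ p.2, p.2)) (ψ := id) (by fun_prop)
      measurable_id
    have e : (fun ω => (X ω + N ω, Y ω)) = (fun p : ℝ × 𝒴 => (p.1 + τ p.2, p.2)) ∘
        fun ω => (S ω, Y ω) := by
      ext ω
      · simp [hS, hW]; ring
      · rfl
    rw [e]
    exact this
  · rw [eE, g3.snd.map_eq_gaussianReal, mE, ← covariance_self hEm.aemeasurable, cEE]
  · rw [eS]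
    exact (iSEY.comp measurable_fst measurable_id).symm
  · rw [eS, g3.fst.map_eq_gaussianReal, mS, ← covariance_self hSm.aemeasurable, cSS]
  · simp only [add_sub_cancel_left]
    exact hi.comp (φ := Prod.swap) measurable_swap measurable_id
  · simp only [add_sub_cancel_left]
    exact hNl

/-- Each normalized square error has mean one, so the quadratic terms cancel and only the ratio of
variances survives, whatever the conditional means are. -/
theorem integral_gaussLogRatio (h : IsGaussianGiven μ X Y τ v) {τ₀ : γ → ℝ} {v₀ : ℝ}
    (h₀ : IsGaussianGiven μ X Z τ₀ v₀) :
    Integrable (fun ω => gaussLogRatio (τ (Y ω)) v (τ₀ (Z ω)) v₀ (X ω)) μ ∧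
      ∫ ω, gaussLogRatio (τ (Y ω)) v (τ₀ (Z ω)) v₀ (X ω) ∂μ = 1 / 2 * Real.log (v₀ / v) := by
  have hX := h.measurable_left
  have hY := h.measurable_right
  have hτ := h.measurable_mean
  have hZ := h₀.measurable_right
  have hτ₀ := h₀.measurable_mean
  have hv := h.pos
  have hv₀ := h₀.pos
  obtain ⟨i1, e1⟩ := integral_sq_of_map_eq_gaussianReal hv.le (by fun_prop) h.law
  obtain ⟨i2, e2⟩ := integral_sq_of_map_eq_gaussianReal hv₀.le (by fun_prop) h₀.law
  have i3 := ((integrable_const (μ := μ) (1 / 2 * Real.log (v₀ / v))).sub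
    (i1.div_const (2 * v)))
  refine ⟨i3.add (i2.div_const (2 * v₀)), ?_⟩
  have := integral_add i3 (i2.div_const (2 * v₀))
  refine this.trans ?_
  have h2 := integral_sub (integrable_const (μ := μ) (1 / 2 * Real.log (v₀ / v)))
    (i1.div_const (2 * v))
  refine (congrArg (· + _) h2).trans ?_
  simp only [integral_div, e1, e2, integral_const, probReal_univ, smul_eq_mul, one_mul]
  field_simp
  ring

theorem mutualInfo_eq (h : IsGaussianGiven μ X Y τ v) {v₀ : ℝ} (hv₀ : 0 < v₀)
    (h₀ : μ.map X = gaussianReal 0 v₀.toNNReal) :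
    mutualInfo Y X μ = ENNReal.ofReal (1 / 2 * Real.log (v₀ / v) / Real.log 2) := by
  have hX := h.measurable_left
  have hY := h.measurable_right
  have hτ := h.measurable_mean
  -- The prior law is treated as the conditional law given a trivial observation.
  have hG : IsGaussianGiven μ X (fun _ => ()) (fun _ => 0) v₀ :=
    ⟨hX, by fun_prop, by fun_prop, hv₀, indepFun_const_left _ _, by simpa using h₀⟩
  obtain ⟨hi, he⟩ := integral_gaussLogRatio h hG
  have : IsProbabilityMeasure (μ.map X) := Measure.isProbabilityMeasure_map hX.aemeasurable
  have : IsProbabilityMeasure (μ.map Y) := Measure.isProbabilityMeasure_map hY.aemeasurable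
  have : IsProbabilityMeasure (μ.map fun ω => (Y ω, X ω)) :=
    Measure.isProbabilityMeasure_map (by fun_prop)
  have hℓ : Measurable fun p : 𝒴 × ℝ => gaussLogRatio (τ p.1) v 0 v₀ p.2 := by fun_prop
  have hYX : AEMeasurable (fun ω => (Y ω, X ω)) μ := by fun_prop
  rw [mutualInfo, klDiv_eq_of_withDensity hℓ
    ((integrable_map_measure hℓ.aestronglyMeasurable hYX).2 hi) ?_,
    integral_map hYX hℓ.aestronglyMeasurable, ENNReal.ofReal_div_of_pos (Real.log_pos one_lt_two)]
  · congr 2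
  · refine Measure.ext_of_lintegral _ fun F hF => ?_
    rw [lintegral_map hF (by fun_prop), h.lintegral_eq hF,
      lintegral_withDensity_eq_lintegral_mul _ (by fun_prop) hF,
      lintegral_prod _ (by fun_prop), h₀]
    refine lintegral_congr fun y => ?_
    rw [← gaussianReal_withDensity (m₀ := 0) h.pos hv₀,
      lintegral_withDensity_eq_lintegral_mul _ (by fun_prop) (by fun_prop)]
    rfl

/-- Given `Z`, passing from the conditionally independent law to the joint law replaces `N(τ₀, v₀)`
by `N(τ, v)` as the law of `X` for each `y`. The Gaussian ratio is therefore the density, and its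
logarithm has the mean computed above. -/
theorem condMutualInfo_eq [StandardBorelSpace 𝒴] [Nonempty 𝒴] {τ : γ × 𝒴 → ℝ}
    (h : IsGaussianGiven μ X (fun ω => (Z ω, Y ω)) τ v) {τ₀ : γ → ℝ} {v₀ : ℝ}
    (h₀ : IsGaussianGiven μ X Z τ₀ v₀) :
    condMutualInfo X Y Z μ = ENNReal.ofReal (1 / 2 * Real.log (v₀ / v) / Real.log 2) := by
  have hX := h.measurable_left
  have hY : Measurable Y := measurable_snd.comp h.measurable_right
  have hZ := h₀.measurable_right
  have hτ := h.measurable_mean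
  have hτ₀ := h₀.measurable_mean
  obtain ⟨hi, he⟩ := integral_gaussLogRatio h h₀
  have : IsProbabilityMeasure (μ.map Z) := Measure.isProbabilityMeasure_map hZ.aemeasurable
  have : IsProbabilityMeasure (μ.map fun ω => (Z ω, X ω, Y ω)) :=
    Measure.isProbabilityMeasure_map (by fun_prop)
  have hℓ : Measurable fun p : γ × ℝ × 𝒴 =>
    gaussLogRatio (τ (p.1, p.2.2)) v (τ₀ p.1) v₀ p.2.1 := by fun_prop
  have hm : AEMeasurable (fun ω => (Z ω, X ω, Y ω)) μ := by fun_prop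
  rw [condMutualInfo, klDiv_eq_of_withDensity hℓ
    ((integrable_map_measure hℓ.aestronglyMeasurable hm).2 hi) ?_,
    integral_map hm hℓ.aestronglyMeasurable, ENNReal.ofReal_div_of_pos (Real.log_pos one_lt_two)]
  · congr 2
  · refine Measure.ext_of_lintegral _ fun F hF => ?_
    rw [lintegral_map hF (by fun_prop),
      h.lintegral_eq (F := fun p => F (p.1.1, p.2, p.1.2)) (by fun_prop),
      lintegral_withDensity_eq_lintegral_mul _ (by fun_prop) hF,
      Measure.lintegral_compProd (by fun_prop), ← compProd_map_condDistrib hY.aemeasurable,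
      Measure.lintegral_compProd ?_]
    · refine lintegral_congr_ae ?_
      filter_upwards [h₀.condDistrib_ae_eq] with z hz
      rw [Kernel.prod_apply, lintegral_prod_symm' _ (by fun_prop), hz, gaussKernel_apply hτ₀]
      refine lintegral_congr fun y => ?_
      rw [← gaussianReal_withDensity (m₀ := τ₀ z) h.pos h₀.pos,
        lintegral_withDensity_eq_lintegral_mul _ (by fun_prop) (by fun_prop)]
      rfl
    · have : (fun p : γ × 𝒴 => ∫⁻ x, F (p.1, x, p.2) ∂(gaussianReal (τ p) v.toNNReal))
          = fun p => ∫⁻ x, F (p.1, x, p.2) ∂(gaussKernel τ v p) := by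
        ext p; rw [gaussKernel_apply hτ]
      rw [this]
      exact Measurable.lintegral_kernel_prod_right' (f := fun q : (γ × 𝒴) × ℝ =>
        F (q.1.1, q.2, q.1.2)) (by fun_prop)

end IsGaussianGiven

/-! ### Gaussian auxiliary random variables -/

theorem condMutualInfo_eq_zero {Ω α β γ : Type*} [MeasurableSpace Ω] [StandardBorelSpace Ω]
    [MeasurableSpace α] [StandardBorelSpace α] [Nonempty α]
    [MeasurableSpace β] [StandardBorelSpace β] [Nonempty β] [MeasurableSpace γ]
    {X : Ω → α} {Y : Ω → β} {Z : Ω → γ} {μ : Measure Ω} [IsProbabilityMeasure μ]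
    (hX : Measurable X) (hY : Measurable Y) (hZ : Measurable Z)
    (h : X ⟂ᵢ[Z, hZ; μ] Y) : condMutualInfo X Y Z μ = 0 := by
  have : IsProbabilityMeasure (μ.map Z) := Measure.isProbabilityMeasure_map hZ.aemeasurable
  rw [condIndepFun_iff_map_prod_eq_prod_condDistrib_prod_condDistrib hX hY hZ,
    ← Measure.compProd_eq_comp_prod] at h
  rw [condMutualInfo, h, klDiv_self, ENNReal.zero_div]

theorem mutualInfo_eq_zero {Ω α β : Type*} [MeasurableSpace Ω] [MeasurableSpace α]
    [MeasurableSpace β] {X : Ω → α} {Y : Ω → β} {μ : Measure Ω} [IsProbabilityMeasure μ]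
    (hX : Measurable X) (hY : Measurable Y) (h : IndepFun X Y μ) : mutualInfo X Y μ = 0 := by
  have : IsProbabilityMeasure (μ.map X) := Measure.isProbabilityMeasure_map hX.aemeasurable
  have : IsProbabilityMeasure (μ.map Y) := Measure.isProbabilityMeasure_map hY.aemeasurable
  rw [mutualInfo, h.map_prod_eq_prod_map_map hX.aemeasurable hY.aemeasurable, klDiv_self,
    ENNReal.zero_div]

/-- The conditional law of `V` given `(X, Y)` has a mean depending on `X` only and a constant
variance, so it coincides with the conditional law given `X`. -/
theorem IsGaussianGiven.condIndepFun {Ω 𝒴 γ : Type*} [MeasurableSpace Ω] [StandardBorelSpace Ω]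
    [MeasurableSpace 𝒴] [StandardBorelSpace 𝒴] [Nonempty 𝒴] [MeasurableSpace γ] {μ : Measure Ω}
    [IsProbabilityMeasure μ] {V : Ω → ℝ} {X : Ω → γ} {Y : Ω → 𝒴} {τ : γ → ℝ} {v : ℝ}
    (hτ : Measurable τ) (hX : Measurable X)
    (h : IsGaussianGiven μ V (fun ω => (X ω, Y ω)) (fun p => τ p.1) v) : V ⟂ᵢ[X, hX; μ] Y := by
  have hV := h.measurable_left
  have hY : Measurable Y := measurable_snd.comp h.measurable_right
  have hVX : IsGaussianGiven μ V X τ v :=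
    h.of_comp measurable_fst hτ fun _ => rfl
  refine CondIndepFun.symm ((condIndepFun_iff_condDistrib_prod_ae_eq_prodMkRight hV hY hX).2 ?_)
  have h1 : ∀ᵐ p ∂μ.map (fun ω => (X ω, Y ω)), condDistrib V X μ p.1 = gaussKernel τ v p.1 := by
    refine ae_of_ae_map (f := Prod.fst) (p := fun x => condDistrib V X μ x = gaussKernel τ v x)
      (by fun_prop) ?_
    rw [Measure.map_map measurable_fst (by fun_prop)]
    exact hVX.condDistrib_ae_eq
  filter_upwards [h.condDistrib_ae_eq, h1] with p hp h1
  rw [hp, Kernel.prodMkRight_apply, h1, gaussKernel_apply hτ, gaussKernel_apply (by fun_prop)]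

/-- Truncation at zero can only enlarge the subtracted term, so no sign condition on `b` is needed,
unlike for `a` and `c`. -/
theorem coe_ofReal_sub_add_le {a b c Δ : ℝ} (ha : 0 ≤ a) (hc : 0 ≤ c) (h : a - b + c ≤ Δ) :
    (ENNReal.ofReal a : EReal) - ENNReal.ofReal b + ENNReal.ofReal c ≤ Δ := by
  rw [EReal.coe_ennreal_ofReal, EReal.coe_ennreal_ofReal, EReal.coe_ennreal_ofReal,
    max_eq_left ha, max_eq_left hc, ← EReal.coe_sub, ← EReal.coe_add, EReal.coe_le_coe_iff]
  have := le_max_left b 0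
  linarith

theorem coe_ofReal_le {a R : ℝ} (hR : 0 ≤ R) (h : a ≤ R) : (ENNReal.ofReal a : EReal) ≤ R := by
  rw [EReal.coe_ennreal_ofReal, EReal.coe_le_coe_iff]
  exact max_le h hR

/-! ### Gaussian auxiliaries that attain the converse bounds -/

section Region

variable {L : ℕ} {P : Measure (ℝ × (Fin L → ℝ))} {A B : Finset (Fin L)} {s σ σA σB D R Δ : ℝ}
  {T TA : (A → ℝ) → ℝ} {l lA : A → ℝ} {TB : (B → ℝ) → ℝ} {lB : B → ℝ}

theorem IsLinearEstimate.isGaussianGiven (h : IsLinearEstimate P A s σ T l) :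
    IsGaussianGiven P (fun p => p.1) (fun p => A.restrict p.2) T σ :=
  ⟨by fun_prop, by fun_prop, h.measurable, h.pos, h.indep_error, h.law_error⟩

theorem IsLinearEstimate.isGaussianGiven_const (h : IsLinearEstimate P A s σ T l) :
    IsGaussianGiven P (fun p => p.1) (fun _ => ()) (fun _ => 0) s := by
  have := h.gaussian.isProbabilityMeasure
  exact ⟨by fun_prop, by fun_prop, by fun_prop, h.pos.trans_le h.le, indepFun_const_left _ _,
    by simpa using h.law_source⟩

theorem half_log_div_nonneg {a b : ℝ} (hb : 0 < b) (h : b ≤ a) :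
    0 ≤ 1 / 2 * Real.log (a / b) / Real.log 2 := by
  have := Real.log_nonneg ((one_le_div hb).2 h)
  have := Real.log_pos one_lt_two
  positivity

/-- No description is needed if the side information is good enough. -/
theorem mem_singleLetterRegion_of_le (hA : IsLinearEstimate P A s σA TA lA)
    (hB : IsLinearEstimate P B s σB TB lB) (hD : σA ≤ D) (hR : 0 ≤ R)
    (hΔ : 1 / 2 * Real.log (s / σB) ≤ Δ * Real.log 2) :
    (R, Δ) ∈ singleLetterRegion (pairLaw P A B) D := by
  have := hA.gaussian.isProbabilityMeasure
  have hlog : 0 < Real.log 2 := Real.log_pos one_lt_two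
  refine ⟨ℝ × (Fin L → ℝ), Unit, Unit, inferInstance, inferInstance, inferInstance, inferInstance,
    inferInstance, inferInstance, inferInstance, inferInstance, P, inferInstance,
    fun _ => (), fun _ => (), fun p => p.1, fun p => A.restrict p.2, fun p => B.restrict p.2,
    measurable_const, measurable_const, measurable_fst, by fun_prop, by fun_prop, rfl, ⟨?_, ?_⟩,
    ?_, ?_, ?_⟩
  · exact condIndepFun_const_left _ _
  · exact condIndepFun_const_left _ _
  · have h := hA.isGaussianGiven.of_comp (φ := fun y => (y, ())) (by fun_prop)
      (τ' := fun p => TA p.1) (by have := hA.measurable; fun_prop) fun _ => rfl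
    rw [h.integral_condVar hA.gaussian.fst.integrable]
    exact hD
  · rw [condMutualInfo_eq_zero measurable_const measurable_fst (by fun_prop)
      (condIndepFun_const_left _ _)]
    simpa using hR
  · have h1 := hB.isGaussianGiven.of_comp (φ := fun y => ((), y)) (by fun_prop)
      (τ' := fun p => TB p.2) (by have := hB.measurable; fun_prop) fun _ => rfl
    rw [h1.condMutualInfo_eq hB.isGaussianGiven_const,
      mutualInfo_eq_zero measurable_const measurable_fst (indepFun_const_left _ _),
      condMutualInfo_eq_zero measurable_const (by fun_prop) measurable_const
        (condIndepFun_const_left _ _), ← ENNReal.ofReal_zero]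
    refine coe_ofReal_sub_add_le le_rfl (half_log_div_nonneg hB.pos hB.le) ?_
    rw [sub_zero, zero_add, div_le_iff₀ hlog]
    exact hΔ

/-- The conditional laws of the source symbol and of a noisy version of it. -/
theorem isGaussianGiven_noise (hA : IsLinearEstimate P A s σA TA lA) {v : ℝ} (hv : 0 < v) :
    IsGaussianGiven (P.prod (gaussianReal 0 v.toNNReal)) (fun ω => ω.1.1)
      (fun ω => (ω.1.1 + ω.2, A.restrict ω.1.2))
      (fun p => (TA p.2 / σA + p.1 / v) / (1 / σA + 1 / v)) (1 / (1 / σA + 1 / v)) ∧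
    IsGaussianGiven (P.prod (gaussianReal 0 v.toNNReal)) (fun ω => ω.1.1 + ω.2)
      (fun ω => A.restrict ω.1.2) TA (σA + v) ∧
    IsGaussianGiven (P.prod (gaussianReal 0 v.toNNReal)) (fun ω => ω.1.1 + ω.2)
      (fun ω => (A.restrict ω.1.2, ω.1.1)) (fun p => p.2) v := by
  have := hA.gaussian.isProbabilityMeasure
  exact (hA.isGaussianGiven.of_map (ν := P.prod (gaussianReal 0 v.toNNReal)) measurable_fst
    (by simp)).add_noise (N := fun ω => ω.2) measurable_snd hv (by simp)
    (indepFun_prod (X := fun p : ℝ × (Fin L → ℝ) => (p.1, A.restrict p.2)) (by fun_prop)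
      measurable_id)

theorem isGaussianGiven_noise_const (hA : IsLinearEstimate P A s σA TA lA) {v : ℝ} (hv : 0 < v) :
    IsGaussianGiven (P.prod (gaussianReal 0 v.toNNReal)) (fun ω => ω.1.1)
      (fun ω => ω.1.1 + ω.2) (fun x => x / v / (1 / s + 1 / v)) (1 / (1 / s + 1 / v)) ∧
    IsGaussianGiven (P.prod (gaussianReal 0 v.toNNReal)) (fun ω => ω.1.1 + ω.2)
      (fun _ => ()) (fun _ => 0) (s + v) := by
  have := hA.gaussian.isProbabilityMeasure
  obtain ⟨h1, h2, -⟩ :=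
    (hA.isGaussianGiven_const.of_map (ν := P.prod (gaussianReal 0 v.toNNReal)) measurable_fst
    (by simp)).add_noise (N := fun ω => ω.2) measurable_snd hv (by simp)
    (indepFun_prod (X := fun p : ℝ × (Fin L → ℝ) => (p.1, ())) (by fun_prop)
      measurable_id)
  exact ⟨h1.of_comp measurable_fst (by fun_prop) fun ω => by simp, h2⟩

theorem isGaussianGiven_source (hA : IsLinearEstimate P A s σA TA lA) {v : ℝ} (hv : 0 < v) :
    IsGaussianGiven (P.prod (gaussianReal 0 v.toNNReal)) (fun ω => ω.1.1 + ω.2)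
      (fun ω => (ω.1.1, (A.restrict ω.1.2, B.restrict ω.1.2))) (fun p => p.1) v := by
  have := hA.gaussian.isProbabilityMeasure
  refine ⟨by fun_prop, by fun_prop, by fun_prop, hv, ?_, ?_⟩
  · simp only [add_sub_cancel_left]
    exact indepFun_prod (X := fun p : ℝ × (Fin L → ℝ) => (p.1, (A.restrict p.2, B.restrict p.2)))
      (by fun_prop) measurable_id
  · simp

/-- The common part of the two constructions with a noisy version of the source symbol. -/
theorem mem_singleLetterRegion_of_noise (hA : IsLinearEstimate P A s σA TA lA)
    (hD : 0 < D) (hR : 0 ≤ R) (hRA : 1 / 2 * Real.log (σA / D) ≤ R * Real.log 2)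
    {v : ℝ} (hv : 0 < v) (hvD : 1 / v = 1 / D - 1 / σA)
    {𝒰 : Type} [MeasurableSpace 𝒰] [StandardBorelSpace 𝒰] [Nonempty 𝒰] {u : ℝ → 𝒰}
    (hu : Measurable u)
    (hΔ : letI μ := P.prod (gaussianReal 0 v.toNNReal)
      haveI : IsProbabilityMeasure P := hA.gaussian.isProbabilityMeasure
      (mutualInfo (fun ω => ω.1.1 + ω.2) (fun ω => ω.1.1) μ : EReal)
        - (condMutualInfo (fun ω => ω.1.1 + ω.2) (fun ω => A.restrict ω.1.2)
          (fun ω => u (ω.1.1 + ω.2)) μ : EReal)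
        + (condMutualInfo (fun ω => ω.1.1) (fun ω => B.restrict ω.1.2)
          (fun ω => u (ω.1.1 + ω.2)) μ : EReal) ≤ (Δ : EReal)) :
    (R, Δ) ∈ singleLetterRegion (pairLaw P A B) D := by
  have := hA.gaussian.isProbabilityMeasure
  have hlog : 0 < Real.log 2 := Real.log_pos one_lt_two
  have hσA := hA.pos
  obtain ⟨g1, g2, g3⟩ := isGaussianGiven_noise hA hv
  have g4 := isGaussianGiven_source (B := B) hA hv
  have hV : Measurable fun ω : (ℝ × (Fin L → ℝ)) × ℝ => ω.1.1 + ω.2 := by fun_prop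
  refine ⟨(ℝ × (Fin L → ℝ)) × ℝ, 𝒰, ℝ, inferInstance, inferInstance, inferInstance, inferInstance,
    inferInstance, inferInstance, inferInstance, inferInstance,
    P.prod (gaussianReal 0 v.toNNReal), inferInstance,
    fun ω => u (ω.1.1 + ω.2), fun ω => ω.1.1 + ω.2, fun ω => ω.1.1, fun ω => A.restrict ω.1.2,
    fun ω => B.restrict ω.1.2, by fun_prop, by fun_prop, by fun_prop, by fun_prop, by fun_prop,
    ?_, ⟨?_, ?_⟩, ?_, ?_, hΔ⟩
  · have : (fun ω : (ℝ × (Fin L → ℝ)) × ℝ => (ω.1.1, A.restrict ω.1.2, B.restrict ω.1.2))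
        = (fun p : ℝ × (Fin L → ℝ) => (p.1, A.restrict p.2, B.restrict p.2)) ∘ Prod.fst := rfl
    rw [this, ← Measure.map_map (by fun_prop) measurable_fst, Measure.map_fst_prod]
    simp [pairLaw]
  · exact condIndepFun_of_measurable_left (hu.comp (comap_measurable _)) (by fun_prop)
  · exact (g4.condIndepFun (τ := fun x => x) (by fun_prop) (by fun_prop)).comp
      (φ := fun x => (u x, x)) (by fun_prop) measurable_id
  · have hTA := hA.measurable
    have h := g1.of_comp (φ := Prod.swap) measurable_swap
      (τ' := fun p => (TA p.1 / σA + p.2 / v) / (1 / σA + 1 / v)) (by fun_prop) fun _ => rfl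
    have hi : Integrable (fun ω : (ℝ × (Fin L → ℝ)) × ℝ => ω.1.1)
        (P.prod (gaussianReal 0 v.toNNReal)) := hA.gaussian.fst.integrable.comp_fst _
    have e := h.integral_condVar hi
    refine (e.trans ?_).le
    -- The noise variance is tuned so that the precisions `1/σA` and `1/v` add up to `1/D`; the
    -- distortion constraint holds with equality.
    rw [hvD, add_sub_cancel, one_div_one_div]
  · rw [g3.condMutualInfo_eq g2]
    refine coe_ofReal_le hR ?_
    rw [div_le_iff₀ hlog]
    have : (σA + v) / v = σA / D := by
      have : (σA + v) / v = σA * (1 / v) + 1 := by field_simp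
      rw [this, hvD]
      field_simp
      ring
    rw [this]
    exact hRA

/-- Choosing `U = V` kills `I(V; Y_A | U)`, and the rest is `I(V; X) + I(X; Y_B | V)`, the
information about `X` in `(V, Y_B)`. The posterior precision there is `1/σB + 1/v`. -/
theorem mem_singleLetterRegion_of_better (hA : IsLinearEstimate P A s σA TA lA)
    (hB : IsLinearEstimate P B s σB TB lB) (hD : 0 < D) (hDA : D < σA)
    (hR : 0 ≤ R) (hRA : 1 / 2 * Real.log (σA / D) ≤ R * Real.log 2)
    (hΔ : 1 / 2 * Real.log (s * (1 / D + 1 / σB - 1 / σA)) ≤ Δ * Real.log 2) :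
    (R, Δ) ∈ singleLetterRegion (pairLaw P A B) D := by
  have := hA.gaussian.isProbabilityMeasure
  have hlog : 0 < Real.log 2 := Real.log_pos one_lt_two
  have hσA := hA.pos
  have hσB := hB.pos
  have hs := hσB.trans_le hB.le
  have hw : 0 < 1 / D - 1 / σA := sub_pos.2 (one_div_lt_one_div_of_lt hD hDA)
  set v := 1 / (1 / D - 1 / σA) with hvdef
  have hv : 0 < v := by positivity
  have hvD : 1 / v = 1 / D - 1 / σA := by rw [hvdef, one_div_one_div]
  refine mem_singleLetterRegion_of_noise hA hD hR hRA hv hvD (u := id) measurable_id ?_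
  obtain ⟨b1, -, -⟩ := isGaussianGiven_noise hB hv
  obtain ⟨c1, -⟩ := isGaussianGiven_noise_const hA hv
  have hX : (P.prod (gaussianReal 0 v.toNNReal)).map (fun ω => ω.1.1)
      = gaussianReal 0 s.toNNReal := by
    rw [← Function.comp_def (fun p : ℝ × (Fin L → ℝ) => p.1) Prod.fst,
      ← Measure.map_map measurable_fst measurable_fst, Measure.map_fst_prod]
    simp [hA.law_source]
  have hle : 1 / (1 / s + 1 / v) ≤ s := by
    rw [div_le_iff₀ (by positivity)]
    have : 0 ≤ s * (1 / v) := by positivity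
    have : s * (1 / s) = 1 := by field_simp
    linarith
  have hle2 : 1 / (1 / σB + 1 / v) ≤ 1 / (1 / s + 1 / v) :=
    one_div_le_one_div_of_le (by positivity)
      (add_le_add_left (one_div_le_one_div_of_le hσB hB.le) _)
  simp only [id]
  rw [c1.mutualInfo_eq hs hX, b1.condMutualInfo_eq c1,
    condMutualInfo_eq_zero (by fun_prop) (by fun_prop) (by fun_prop)
      (condIndepFun_self_left (by fun_prop) (by fun_prop)), ← ENNReal.ofReal_zero]
  refine coe_ofReal_sub_add_le (half_log_div_nonneg (by positivity) hle)
    (half_log_div_nonneg (by positivity) hle2) ?_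
  rw [sub_zero, ← add_div, div_le_iff₀ hlog, ← mul_add, ← Real.log_mul (by positivity) (by positivity)]
  have e : s / (1 / (1 / s + 1 / v)) * (1 / (1 / s + 1 / v) / (1 / (1 / σB + 1 / v)))
      = s * (1 / D + 1 / σB - 1 / σA) := by
    rw [show 1 / D + 1 / σB - 1 / σA = 1 / σB + 1 / v by rw [hvD]; ring]
    field_simp
  rw [e]
  exact hΔ

/-- With `U` constant the leakage bound reads `I(V; X) - I(V; Y_A) + I(X; Y_B)`. The first two terms
combine to `I(V; X | Y_A)`, which is `½ log (σA / D)` in nats. -/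
theorem mem_singleLetterRegion_of_worse (hA : IsLinearEstimate P A s σA TA lA)
    (hB : IsLinearEstimate P B s σB TB lB) (hD : 0 < D) (hDA : D < σA)
    (hR : 0 ≤ R) (hRA : 1 / 2 * Real.log (σA / D) ≤ R * Real.log 2)
    (hΔ : 1 / 2 * Real.log (s / σB) + 1 / 2 * Real.log (σA / D) ≤ Δ * Real.log 2) :
    (R, Δ) ∈ singleLetterRegion (pairLaw P A B) D := by
  have := hA.gaussian.isProbabilityMeasure
  have hlog : 0 < Real.log 2 := Real.log_pos one_lt_two
  have hσA := hA.pos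
  have hσB := hB.pos
  have hs := hσB.trans_le hB.le
  have hw : 0 < 1 / D - 1 / σA := sub_pos.2 (one_div_lt_one_div_of_lt hD hDA)
  set v := 1 / (1 / D - 1 / σA) with hvdef
  have hv : 0 < v := by positivity
  have hvD : 1 / v = 1 / D - 1 / σA := by rw [hvdef, one_div_one_div]
  refine mem_singleLetterRegion_of_noise hA hD hR hRA hv hvD (u := fun _ => ())
    measurable_const ?_
  obtain ⟨-, a2, -⟩ := isGaussianGiven_noise hA hv
  obtain ⟨c1, c2⟩ := isGaussianGiven_noise_const hA hv
  have a2' := a2.of_comp (φ := fun y => ((), y)) (by fun_prop)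
    (τ' := fun p => TA p.2) (by have := hA.measurable; fun_prop) fun _ => rfl
  have b0 := hB.isGaussianGiven_const.of_map (ν := P.prod (gaussianReal 0 v.toNNReal))
    measurable_fst (by simp)
  have b1 := (hB.isGaussianGiven.of_comp (φ := fun y => ((), y)) (by fun_prop)
    (τ' := fun p => TB p.2) (by have := hB.measurable; fun_prop) fun _ => rfl).of_map
      (ν := P.prod (gaussianReal 0 v.toNNReal)) measurable_fst (by simp)
  have hX : (P.prod (gaussianReal 0 v.toNNReal)).map (fun ω => ω.1.1)
      = gaussianReal 0 s.toNNReal := by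
    rw [← Function.comp_def (fun p : ℝ × (Fin L → ℝ) => p.1) Prod.fst,
      ← Measure.map_map measurable_fst measurable_fst, Measure.map_fst_prod]
    simp [hA.law_source]
  have hle : 1 / (1 / s + 1 / v) ≤ s := by
    rw [div_le_iff₀ (by positivity)]
    have : 0 ≤ s * (1 / v) := by positivity
    have : s * (1 / s) = 1 := by field_simp
    linarith
  rw [c1.mutualInfo_eq hs hX, a2'.condMutualInfo_eq c2, b1.condMutualInfo_eq b0]
  refine coe_ofReal_sub_add_le (half_log_div_nonneg (by positivity) hle)
    (half_log_div_nonneg hσB hB.le) ?_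
  rw [← sub_div, ← add_div, div_le_iff₀ hlog, ← mul_sub,
    ← Real.log_div (by positivity) (by positivity)]
  have e : s / (1 / (1 / s + 1 / v)) / ((s + v) / (σA + v)) = σA / D := by
    have h1 : s / (1 / (1 / s + 1 / v)) / ((s + v) / (σA + v)) = σA * (1 / v) + 1 := by
      field_simp
      ring
    rw [h1, hvD]
    field_simp
    ring
  rw [e]
  linarith

end Region

end SecureSourceCoding

end

/-! ### The inclusion, by comparing `σA` with `D` and `σB` with `σA` -/

theorem theorem4 (L : ℕ) (P : MeasureTheory.Measure (ℝ × (Fin L → ℝ)))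
    (hP : SecureSourceCoding.IsGaussianSource P)
    (𝔸 : Set (Finset (Fin L))) (h𝔸 : IsUpperSet 𝔸) (D : ℝ) (hD : 0 < D) :
    SecureSourceCoding.rateLeakageRegion P D 𝔸 ⊆
      ⋂ A ∈ 𝔸, ⋂ B ∈ 𝔸ᶜ,
        SecureSourceCoding.singleLetterRegion (SecureSourceCoding.pairLaw P A B) D := by
  rintro ⟨R, Δ⟩ ⟨hR, hΔ, c, hdist, hleak⟩
  simp only [Set.mem_iInter]
  intro A hA B hB
  obtain ⟨σA, TA, lA, eA⟩ := hP.exists_isLinearEstimate A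
  obtain ⟨σB, TB, lB, eB⟩ := hP.exists_isLinearEstimate B
  rcases le_or_gt σA D with hD' | hD'
  · exact SecureSourceCoding.mem_singleLetterRegion_of_le eA eB hD' hR
      (SecureSourceCoding.leakage_ge eB hΔ (hleak B hB))
  · have hrate := SecureSourceCoding.rate_ge (A := ⟨A, hA⟩) eA hD hR (hdist ⟨A, hA⟩)
    rcases le_total σB σA with h | h
    · exact SecureSourceCoding.mem_singleLetterRegion_of_better eA eB hD hD' hR hrate
        (SecureSourceCoding.leakage_ge_of_le (A := ⟨A, hA⟩) eA eB h hD hΔ (hdist ⟨A, hA⟩)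
          (hleak B hB))
    · exact SecureSourceCoding.mem_singleLetterRegion_of_worse eA eB hD hD' hR hrate
        (SecureSourceCoding.leakage_ge_of_ge (A := ⟨A, hA⟩) eA eB h hD hΔ (hdist ⟨A, hA⟩)
          (hleak B hB))
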